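/- Let $(\xi_n)_{n\ge 0}$ be independent standard complex Gaussian random variables (density $\pi^{-1}e^{-|z|^2}$ on $\mathbb{C}$), let $a_n\ge 0$ with $a_n^{1/n}\to 0$ and $a_n\neq 0$ for infinitely many $n$, and let $f(z)=\sum_{n\ge 0}\xi_n a_n z^n$ be the corresponding Gaussian entire function, with covariance kernel $\mathbb{E}[f(z)\overline{f(w)}]=G(z\overline w)$, where $G(z)=\sum_{n\ge0}a_n^2z^n$. For $r>0$ put $a(r)=rG'(r)/G(r)$ and $b(r)=r\,a'(r)$. Suppose that $G$ is admissible in Hayman's sense, that is: $b(r)\to\infty$ as $r\to\infty$, and there is a function $\delta:[0,\infty)\to(0,\pi)$ such that, as $r\to\infty$, $$G(re^{i\theta})=G(r)\exp\left(i\theta a(r)-\tfrac12\theta^2 b(r)\right)(1+o(1))\quad\text{uniformly for } |\theta|\le\delta(r),$$ $$|G(re^{i\theta})|=\frac{o(G(r))}{\sqrt{b(r)}}\quad\text{uniformly for } \delta(r)\le|\theta|\le\pi.$$ Suppose also that $$B:=\liminf_{r\to\infty}\frac{\log b(r)}{\log r}>0 .$$ A random point set $\mathcal{Z}\subset\mathbb{C}$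 is called rigid of level $n\in\{1,2,\dots\}\cup\{\infty\}$ if for every bounded open set $D\subset\mathbb{C}$ and every integer $0\le k<n$ there is a map $S_k$ from the set of locally finite point configurations in $\mathbb{C}\setminus D$ to $\mathbb{C}$ such that almost surely $\mathcal{Z}\cap D$ is finite, $\mathcal{Z}\cap(\mathbb{C}\setminus D)$ is locally finite, and $$\sum_{z\in D\cap\mathcal{Z}}z^k=S_k\left(\mathcal{Z}\cap(\mathbb{C}\setminus D)\right);$$ it is called fully rigid if it is rigid of level $\infty$. Then, if $B<\infty$, the zero set $\mathcal{Z}_f=f^{-1}\{0\}$ is rigid of level $\lceil B\rceil$, the smallest integer greater than or equal to $B$. Moreover, if $\frac{\log b(r)}{\log r}\to\infty$ as $r\to\infty$ (equivalently $B=\infty$), then $\mathcal{Z}_f$ is fully rigid. -/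

import Mathlib

open MeasureTheory ProbabilityTheory Filter Topology
open scoped NNReal ComplexConjugate

noncomputable section

/-- The law of a standard complex Gaussian: independent real and imaginary parts, each a centred
real Gaussian of variance `1/2` (density `π⁻¹ exp (-|z|²)`). -/
def stdComplexGaussian : Measure ℂ :=
  ((gaussianReal 0 (1 / 2 : ℝ≥0)).prod (gaussianReal 0 (1 / 2 : ℝ≥0))).map
    (fun p : ℝ × ℝ => (p.1 : ℂ) + (p.2 : ℂ) * Complex.I)

/-- `f` is a (transcendental) Gaussian entire function on the probability space `(Ω, P)`: almost
surely `f(z) = ∑ ξₙ aₙ zⁿ` for all `z`, where the `ξₙ` are independent standard complex Gaussians,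
`aₙ ≥ 0`, `aₙ ^ (1/n) → 0`, and infinitely many `aₙ` are non-zero. (The condition on `aₙ ^ (1/n)`
makes the series converge everywhere, almost surely.) -/
def IsGaussianEntireFunction {Ω : Type*} [MeasurableSpace Ω] (P : Measure Ω)
    (f : Ω → ℂ → ℂ) : Prop :=
  ∃ (a : ℕ → ℝ) (ξ : ℕ → Ω → ℂ),
    (∀ n, 0 ≤ a n) ∧
    {n | a n ≠ 0}.Infinite ∧
    Tendsto (fun n : ℕ => a n ^ (1 / (n : ℝ))) atTop (𝓝 0) ∧
    (∀ n, Measurable (ξ n)) ∧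
    (∀ n, P.map (ξ n) = stdComplexGaussian) ∧
    iIndepFun ξ P ∧
    ∀ᵐ ω ∂P, ∀ z : ℂ, f ω z = ∑' n : ℕ, ξ n ω * (a n : ℂ) * z ^ n

/-- `(z, w) ↦ G (z * conj w)` is the covariance kernel `𝔼[f(z) * conj (f(w))]` of `f`. -/
def HasCovarianceKernel {Ω : Type*} [MeasurableSpace Ω] (P : Measure Ω)
    (f : Ω → ℂ → ℂ) (G : ℂ → ℂ) : Prop :=
  ∀ z w : ℂ, ∫ ω, f ω z * conj (f ω w) ∂P = G (z * conj w)

/-- `a(r) = r G'(r) / G(r)`. The real part only serves to have a real number: the functions `G`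
considered are real on the real axis. -/
def haymanA (G : ℂ → ℂ) (r : ℝ) : ℝ :=
  ((r : ℂ) * deriv G (r : ℂ) / G (r : ℂ)).re

/-- `b(r) = r a'(r)`. -/
def haymanB (G : ℂ → ℂ) (r : ℝ) : ℝ :=
  r * deriv (haymanA G) r

/-- Hayman's admissibility for entire functions. -/
structure IsAdmissible (G : ℂ → ℂ) : Prop where
  entire : Differentiable ℂ G
  real_on_reals : ∀ r : ℝ, (G (r : ℂ)).im = 0
  eventually_pos : ∀ᶠ r : ℝ in atTop, 0 < (G (r : ℂ)).re
  tendsto_b : Tendsto (haymanB G) atTop atTop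
  exists_delta : ∃ δ : ℝ → ℝ, (∀ r, 0 ≤ r → δ r ∈ Set.Ioo 0 Real.pi) ∧
    (∀ ε > 0, ∀ᶠ r : ℝ in atTop, ∀ θ : ℝ, |θ| ≤ δ r →
      ‖G (r * Complex.exp (θ * Complex.I))
          - G r * Complex.exp (Complex.I * θ * haymanA G r - θ ^ 2 * haymanB G r / 2)‖
        ≤ ε * ‖G r * Complex.exp (Complex.I * θ * haymanA G r - θ ^ 2 * haymanB G r / 2)‖) ∧
    (∀ ε > 0, ∀ᶠ r : ℝ in atTop, ∀ θ : ℝ, δ r ≤ |θ| → |θ| ≤ Real.pi →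
      ‖G (r * Complex.exp (θ * Complex.I))‖ ≤ ε * ‖G r‖ / √(haymanB G r))

/-- `B = liminf_{r → ∞} log b(r) / log r`, as an extended real number. -/
def growthExponent (G : ℂ → ℂ) : EReal :=
  liminf (fun r : ℝ => ((Real.log (haymanB G r) / Real.log r : ℝ) : EReal)) atTop

/-- The random zero set `f⁻¹{0}`. -/
def zeroSet {Ω : Type*} (f : Ω → ℂ → ℂ) (ω : Ω) : Set ℂ :=
  f ω ⁻¹' {0}

/-- The locally finite point configurations contained in `A`. -/
def LocallyFiniteConfig (A : Set ℂ) : Set (Set ℂ) :=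
  {C | C ⊆ A ∧ ∀ K : Set ℂ, IsCompact K → (C ∩ K).Finite}

/-- The random point set `Z` is rigid of level `n`: for every bounded open `D` and `k < n`, the
`k`-th moment of the points in `D` is almost surely a function of the points outside `D`. -/
def IsRigidOfLevel {Ω : Type*} [MeasurableSpace Ω] (P : Measure Ω)
    (Z : Ω → Set ℂ) (n : ℕ∞) : Prop :=
  ∀ D : Set ℂ, IsOpen D → Bornology.IsBounded D → ∀ k : ℕ, (k : ℕ∞) < n →
    ∃ S : LocallyFiniteConfig Dᶜ → ℂ, ∀ᵐ ω ∂P,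
      (D ∩ Z ω).Finite ∧
      ∃ h : Z ω ∩ Dᶜ ∈ LocallyFiniteConfig Dᶜ,
        ∑ᶠ z ∈ D ∩ Z ω, z ^ k = S ⟨Z ω ∩ Dᶜ, h⟩

/-- Fully rigid: rigid of level `∞`. -/
def IsFullyRigid {Ω : Type*} [MeasurableSpace Ω] (P : Measure Ω) (Z : Ω → Set ℂ) : Prop :=
  IsRigidOfLevel P Z ⊤

end

open scoped ENNReal

noncomputable section

/-! The moments of the zeros in `D` are read off from a statistic of log|f| that is almost
deterministic at large scales. A weighted combination of the averages of z^k log|f| over the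
adjacent annuli L ≤ |z| ≤ eL and eL ≤ |z| ≤ e²L is a sum over the zeros (`linearStat_eq_sum_zeros`):
by Jensen-type formulas a zero a with |a| < L contributes exactly a^k, and a zero beyond e²L
contributes nothing. If this statistic at scale L = e^j is, almost surely, a deterministic μ_j up to
o(1), then the moment over `D` is the limit of μ_j minus the contributions of the zeros outside `D`,
up to a correction at the origin (`finsum_pow_eq_momentFromOutside`).

For the fluctuations, f(z) and f(w) divided by their standard deviations are standard Gaussians
whose correlation has modulus `normalizedKernel G z w`, and the covariance of their logarithms is at
most a constant times this (`norm_integral_log_mul_log_le`). Let |z| = Le^t, |w| = Le^s and b ≥ M on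
[L², ∞). Admissibility makes the integral of |G| over the circle of radius r of order G(r)/√b(r).
Since log G(e^x) has second derivative b(e^x) in x, G(|zw|)/√(G(|z|²)G(|w|²)) is at most
exp(-M(t-s)²/2). Integration over the angle and over t thus gains 1/√M each
(`exists_lintegral_normalizedKernel_le`), and the average of z^k log|f| has variance O(L^(2k)/M). If
b(r) ≥ r^c with c > k, then M = L^(2c) is allowed and the variances are summable along L = e^j
(`ae_tendsto_fluctuation`). Such a c exists for every integer k < B, that is, for every k < ⌈B⌉.

A configuration is a set and carries no multiplicities. The zeros off the origin are therefore shown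
to be almost surely simple (`ae_deriv_ne_zero`), and the order of the zero at the origin to be
almost surely constant (`exists_ae_factorization`). -/

/-! ### Integrability of 1/|z| and log|z| under the complex Gaussian law -/

lemma gaussianReal_half_le_volume : gaussianReal 0 (1 / 2 : ℝ≥0) ≤ volume := by
  have h0 : (1 / 2 : ℝ≥0) ≠ 0 := by norm_num
  rw [gaussianReal_of_var_ne_zero _ h0]
  conv_rhs => rw [← withDensity_one (μ := (volume : Measure ℝ))]
  refine withDensity_mono (Eventually.of_forall fun x => ?_)
  simp only [gaussianPDF, Pi.one_apply]
  rw [← ENNReal.ofReal_one]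
  apply ENNReal.ofReal_le_ofReal
  unfold gaussianPDFReal
  have h1 : (√(2 * Real.pi * ((1 / 2 : ℝ≥0) : ℝ)))⁻¹ ≤ 1 := by
    apply inv_le_one_of_one_le₀
    rw [Real.one_le_sqrt]
    push_cast
    linarith [Real.pi_gt_three]
  have h2 : Real.exp (-(x - 0) ^ 2 / (2 * ((1 / 2 : ℝ≥0) : ℝ))) ≤ 1 := by
    rw [Real.exp_le_one_iff]
    push_cast
    nlinarith [sq_nonneg x]
  exact mul_le_one₀ h1 (Real.exp_pos _).le h2

/-- Uniformity in the shift: outside [-1, 1] the integrand is at most 1, and on [-1, 1] the Gaussian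
is dominated by Lebesgue measure, which is translation invariant. -/
lemma exists_lintegral_add_rpow_le : ∃ C : ℝ≥0∞, C ≠ ∞ ∧ ∀ a : ℝ,
    ∫⁻ x, ‖a + x‖ₑ ^ (-(1 / 2) : ℝ) ∂gaussianReal 0 (1 / 2 : ℝ≥0) ≤ C := by
  have hint : ∫⁻ x in Set.Icc (-1 : ℝ) 1, ‖x‖ₑ ^ (-(1 / 2) : ℝ) ≠ ∞ := by
    have h01 : ∫⁻ x in Set.Ioc (0 : ℝ) 1, ‖x‖ₑ ^ (-(1 / 2) : ℝ) ≠ ∞ := by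
      have := (intervalIntegral.intervalIntegrable_rpow' (a := 0) (b := 1) (r := -(1/2)) (by norm_num)).1
      have h2 := this.hasFiniteIntegral
      rw [HasFiniteIntegral] at h2
      refine ((setLIntegral_mono_ae' measurableSet_Ioc ?_).trans_lt h2).ne
      refine Eventually.of_forall fun x hx => ?_
      rw [Real.enorm_eq_ofReal (Real.rpow_nonneg hx.1.le _), ← ENNReal.ofReal_rpow_of_pos hx.1,
        Real.enorm_eq_ofReal hx.1.le]
    have h10 : ∫⁻ x in Set.Ico (-1 : ℝ) 0, ‖x‖ₑ ^ (-(1 / 2) : ℝ) ≠ ∞ := by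
      have := (Measure.measurePreserving_neg (volume : Measure ℝ)).setLIntegral_comp_preimage
        (s := Set.Ioc (0 : ℝ) 1) measurableSet_Ioc
        (f := fun x => ‖x‖ₑ ^ (-(1 / 2) : ℝ)) (by fun_prop)
      simp only [Set.neg_preimage, Set.neg_Ioc, neg_zero, enorm_neg] at this
      rw [this]; exact h01
    have hsub : Set.Icc (-1 : ℝ) 1 ⊆ (Set.Ico (-1 : ℝ) 0 ∪ Set.Ioc (0 : ℝ) 1) ∪ {0} := by
      intro x hx
      simp only [Set.mem_union, Set.mem_Ico, Set.mem_Ioc, Set.mem_singleton_iff]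
      rcases lt_trichotomy x 0 with h | h | h
      · exact Or.inl (Or.inl ⟨hx.1, h⟩)
      · exact Or.inr h
      · exact Or.inl (Or.inr ⟨h, hx.2⟩)
    refine ((lintegral_mono_set hsub).trans_lt ?_).ne
    refine (lintegral_union_le _ _ _).trans_lt (ENNReal.add_lt_top.2 ⟨?_, by simp⟩)
    exact (lintegral_union_le _ _ _).trans_lt (ENNReal.add_lt_top.2 ⟨h10.lt_top, h01.lt_top⟩)
  refine ⟨_ + 1, ENNReal.add_ne_top.2 ⟨hint, ENNReal.one_ne_top⟩, fun a => ?_⟩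
  set ψ : ℝ → ℝ≥0∞ := (Set.Icc (-1 : ℝ) 1).indicator fun x => ‖x‖ₑ ^ (-(1 / 2) : ℝ) with hψ
  have hψm : Measurable ψ := by
    apply Measurable.indicator _ measurableSet_Icc
    fun_prop
  have hle : ∀ x : ℝ, ‖a + x‖ₑ ^ (-(1 / 2) : ℝ) ≤ ψ (a + x) + 1 := by
    intro x
    by_cases hx : a + x ∈ Set.Icc (-1 : ℝ) 1
    · rw [hψ, Set.indicator_of_mem hx]; exact le_self_add
    · refine le_trans ?_ le_add_self
      rw [ENNReal.rpow_neg, ENNReal.inv_le_one]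
      apply ENNReal.one_le_rpow _ (by norm_num)
      have : 1 ≤ |a + x| := by
        by_contra hh
        push Not at hh
        exact hx (abs_le.1 hh.le)
      rw [Real.enorm_eq_ofReal_abs, ← ENNReal.ofReal_one]
      exact ENNReal.ofReal_le_ofReal this
  calc _ ≤ ∫⁻ x, (ψ (a + x) + 1) ∂gaussianReal 0 (1 / 2 : ℝ≥0) := lintegral_mono hle
    _ = ∫⁻ x, ψ (a + x) ∂gaussianReal 0 (1 / 2 : ℝ≥0) + 1 := by
        rw [lintegral_add_right _ measurable_const]; simp
    _ ≤ (∫⁻ x, ψ (a + x)) + 1 :=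
        add_le_add_left (lintegral_mono' gaussianReal_half_le_volume le_rfl) 1
    _ = _ := by
        rw [lintegral_add_left_eq_self ψ a, hψ, lintegral_indicator measurableSet_Icc]

instance isProbabilityMeasure_stdComplexGaussian : IsProbabilityMeasure stdComplexGaussian := by
  unfold stdComplexGaussian
  exact Measure.isProbabilityMeasure_map (by fun_prop)

/-- Splits the planar singularity 1/|z| into two one-dimensional singularities of order 1/2, each
integrable, so that a product measure can be handled coordinatewise. -/
lemma enorm_inv_le_re_im (z : ℂ) :
    ‖z‖ₑ⁻¹ ≤ ‖z.re‖ₑ ^ (-(1 / 2) : ℝ) * ‖z.im‖ₑ ^ (-(1 / 2) : ℝ) := by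
  have h1 : ‖z.re‖ₑ ≤ ‖z‖ₑ := by
    rw [enorm_le_iff_norm_le]; exact Complex.abs_re_le_norm z
  have h2 : ‖z.im‖ₑ ≤ ‖z‖ₑ := by
    rw [enorm_le_iff_norm_le]; exact Complex.abs_im_le_norm z
  have h3 : ‖z‖ₑ⁻¹ = ‖z‖ₑ ^ (-(1 / 2) : ℝ) * ‖z‖ₑ ^ (-(1 / 2) : ℝ) := by
    rcases eq_or_ne z 0 with rfl | hz
    · simp
    rw [← ENNReal.rpow_add _ _ (by simpa using hz) (by simp), ← ENNReal.rpow_neg_one]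
    norm_num
  rw [h3, ENNReal.rpow_neg, ENNReal.rpow_neg, ENNReal.rpow_neg]
  gcongr

lemma exists_lintegral_add_inv_le : ∃ C : ℝ≥0∞, C ≠ ∞ ∧ ∀ a : ℂ,
    ∫⁻ z, ‖a + z‖ₑ⁻¹ ∂stdComplexGaussian ≤ C := by
  obtain ⟨C, hC, h⟩ := exists_lintegral_add_rpow_le
  refine ⟨C * C, ENNReal.mul_ne_top hC hC, fun a => ?_⟩
  unfold stdComplexGaussian
  rw [lintegral_map (by fun_prop) (by fun_prop)]
  calc _ ≤ ∫⁻ p : ℝ × ℝ, ‖a.re + p.1‖ₑ ^ (-(1 / 2) : ℝ) * ‖a.im + p.2‖ₑ ^ (-(1 / 2) : ℝ)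
        ∂((gaussianReal 0 (1 / 2 : ℝ≥0)).prod (gaussianReal 0 (1 / 2 : ℝ≥0))) := by
        refine lintegral_mono fun p => (enorm_inv_le_re_im _).trans (le_of_eq ?_)
        simp
    _ = _ := lintegral_prod_mul (f := fun x : ℝ => ‖a.re + x‖ₑ ^ (-(1 / 2) : ℝ))
        (g := fun x : ℝ => ‖a.im + x‖ₑ ^ (-(1 / 2) : ℝ)) (by fun_prop) (by fun_prop)
    _ ≤ C * C := mul_le_mul' (h _) (h _)

/-- An integrable 1/|z - a| is almost surely finite, so a is not an atom. -/
instance nullSingletonClass_stdComplexGaussian : NullSingletonClass stdComplexGaussian := by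
  obtain ⟨C, hC, h⟩ := exists_lintegral_add_inv_le
  refine ⟨fun a => ?_⟩
  have h1 := ae_lt_top (μ := stdComplexGaussian) (f := fun z => ‖-a + z‖ₑ⁻¹) (by fun_prop)
    ((h (-a)).trans_lt hC.lt_top).ne
  refine measure_mono_null ?_ h1
  rintro z rfl
  simp

lemma memLp_id_stdComplexGaussian : MemLp (fun z : ℂ => z) 2 stdComplexGaussian := by
  unfold stdComplexGaussian
  rw [memLp_map_measure_iff (by fun_prop) (by fun_prop)]
  have h1 : MemLp (fun p : ℝ × ℝ => (p.1 : ℂ)) 2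
      ((gaussianReal 0 (1 / 2 : ℝ≥0)).prod (gaussianReal 0 (1 / 2 : ℝ≥0))) :=
    ((memLp_id_gaussianReal (μ := 0) (v := 1 / 2) 2).comp_fst _).ofReal
  have h2 : MemLp (fun p : ℝ × ℝ => (p.2 : ℂ)) 2
      ((gaussianReal 0 (1 / 2 : ℝ≥0)).prod (gaussianReal 0 (1 / 2 : ℝ≥0))) :=
    ((memLp_id_gaussianReal (μ := 0) (v := 1 / 2) 2).comp_snd _).ofReal
  exact h1.add (h2.mul_const Complex.I)

lemma integral_sq_norm_stdComplexGaussian : ∫ z, ‖z‖ ^ 2 ∂stdComplexGaussian = 1 := by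
  have hsq : ∫ x, x ^ 2 ∂gaussianReal 0 (1 / 2 : ℝ≥0) = 1 / 2 := by
    have := variance_fun_id_gaussianReal (μ := 0) (v := 1 / 2)
    rw [variance_eq_integral (by fun_prop), integral_id_gaussianReal] at this
    simpa using this
  have i1 : Integrable (fun x : ℝ => x ^ 2) (gaussianReal 0 (1 / 2 : ℝ≥0)) :=
    (memLp_id_gaussianReal (μ := 0) (v := 1 / 2) 2).integrable_sq
  unfold stdComplexGaussian
  rw [integral_map (by fun_prop) (by fun_prop)]
  have : ∀ p : ℝ × ℝ, ‖(p.1 : ℂ) + (p.2 : ℂ) * Complex.I‖ ^ 2 = p.1 ^ 2 + p.2 ^ 2 := by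
    intro p
    rw [← Complex.normSq_eq_norm_sq, Complex.normSq_add_mul_I]
  simp_rw [this]
  rw [integral_add (i1.comp_fst _) (i1.comp_snd _),
    integral_fun_fst (f := fun x : ℝ => x ^ 2), integral_fun_snd (f := fun x : ℝ => x ^ 2), hsq]
  norm_num

lemma sq_log_le (y : ℝ) (hy : 0 < y) : Real.log y ^ 2 ≤ 4 * (y + y⁻¹) := by
  have key : ∀ y : ℝ, 1 ≤ y → Real.log y ^ 2 ≤ 4 * y := by
    intro y hy
    have h0 : 0 ≤ y := by linarith
    have h1 : Real.log y = 2 * Real.log (√y) := by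
      rw [Real.log_sqrt h0]; ring
    have h2 : Real.log (√y) ≤ √y := (Real.log_le_self (Real.sqrt_nonneg _))
    have h3 : 0 ≤ Real.log (√y) := Real.log_nonneg (by rwa [Real.one_le_sqrt])
    have h4 : √y ^ 2 = y := Real.sq_sqrt h0
    rw [h1]
    nlinarith
  rcases le_total 1 y with h | h
  · have := key y h
    have : 0 < y⁻¹ := inv_pos.2 hy
    linarith [key y h]
  · have := key y⁻¹ ((one_le_inv₀ hy).2 h)
    rw [Real.log_inv, neg_sq] at this
    linarith

lemma memLp_log_norm_stdComplexGaussian :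
    MemLp (fun z : ℂ => Real.log ‖z‖) 2 stdComplexGaussian := by
  have hm : Measurable (fun z : ℂ => Real.log ‖z‖) := Real.measurable_log.comp measurable_norm
  rw [memLp_two_iff_integrable_sq hm.aestronglyMeasurable]
  obtain ⟨C, hC, h⟩ := exists_lintegral_add_inv_le
  have i1 : Integrable (fun z : ℂ => ‖z‖⁻¹) stdComplexGaussian := by
    refine ⟨by fun_prop, ?_⟩
    rw [HasFiniteIntegral]
    refine lt_of_le_of_lt (lintegral_mono fun z => ?_) ((h 0).trans_lt hC.lt_top)
    rw [zero_add]
    rcases eq_or_ne z 0 with rfl | hz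
    · simp
    rw [enorm_inv (by simpa using hz), enorm_norm]
  have i2 : Integrable (fun z : ℂ => ‖z‖) stdComplexGaussian :=
    (memLp_id_stdComplexGaussian.integrable (by norm_num)).norm
  refine ((i2.add i1).const_mul 4).mono' (hm.pow_const 2).aestronglyMeasurable ?_
  refine Eventually.of_forall fun z => ?_
  rw [Real.norm_of_nonneg (sq_nonneg _)]
  rcases eq_or_ne z 0 with rfl | hz
  · simp
  exact sq_log_le _ (norm_pos_iff.2 hz)

/-- From log(x/y) ≤ x/y - 1, used in both directions. With values in [0, ∞] the bound also covers u
= 0 or v = 0, where the right side is infinite unless u = v. -/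
lemma enorm_log_norm_sub_log_norm_le (u v : ℂ) :
    ‖Real.log ‖u‖ - Real.log ‖v‖‖ₑ ≤ ‖u - v‖ₑ * (‖u‖ₑ⁻¹ + ‖v‖ₑ⁻¹) := by
  rcases eq_or_ne u v with rfl | huv
  · simp
  have huv' : ‖u - v‖ₑ ≠ 0 := by simpa [sub_eq_zero] using huv
  rcases eq_or_ne u 0 with rfl | hu
  · rw [enorm_zero, ENNReal.inv_zero, top_add, ENNReal.mul_top huv']; exact le_top
  rcases eq_or_ne v 0 with rfl | hv
  · rw [enorm_zero, ENNReal.inv_zero, add_top, ENNReal.mul_top huv']; exact le_top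
  have hu' := norm_pos_iff.2 hu
  have hv' := norm_pos_iff.2 hv
  have key : ∀ x y : ℝ, 0 < x → 0 < y → Real.log x - Real.log y ≤ |x - y| * (x⁻¹ + y⁻¹) := by
    intro x y hx hy
    rw [← Real.log_div hx.ne' hy.ne']
    have h1 := Real.log_le_sub_one_of_pos (div_pos hx hy)
    have h2 : x / y - 1 = (x - y) * y⁻¹ := by field_simp
    have h3 : (x - y) * y⁻¹ ≤ |x - y| * y⁻¹ := by gcongr; exact le_abs_self _
    have h4 : 0 ≤ |x - y| * x⁻¹ := by positivity
    linarith
  have hr : |Real.log ‖u‖ - Real.log ‖v‖| ≤ ‖u - v‖ * (‖u‖⁻¹ + ‖v‖⁻¹) := by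
    have h5 : |‖u‖ - ‖v‖| ≤ ‖u - v‖ := abs_norm_sub_norm_le u v
    have h6 : |‖u‖ - ‖v‖| * (‖u‖⁻¹ + ‖v‖⁻¹) ≤ ‖u - v‖ * (‖u‖⁻¹ + ‖v‖⁻¹) := by gcongr
    rw [abs_le]
    constructor
    · have := key _ _ hv' hu'
      rw [abs_sub_comm, add_comm (‖v‖⁻¹)] at this
      linarith
    · linarith [key _ _ hu' hv']
  have e1 : ‖u‖ₑ⁻¹ = ‖‖u‖⁻¹‖ₑ := by rw [enorm_inv hu'.ne', enorm_norm]
  have e2 : ‖v‖ₑ⁻¹ = ‖‖v‖⁻¹‖ₑ := by rw [enorm_inv hv'.ne', enorm_norm]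
  have e3 : ‖u‖ₑ⁻¹ + ‖v‖ₑ⁻¹ = ‖‖u‖⁻¹ + ‖v‖⁻¹‖ₑ := by
    rw [e1, e2, Real.enorm_eq_ofReal (by positivity), Real.enorm_eq_ofReal (by positivity),
      Real.enorm_eq_ofReal (by positivity), ENNReal.ofReal_add (by positivity) (by positivity)]
  rw [e3, ← enorm_norm (u - v), ← enorm_mul, enorm_le_iff_norm_le, Real.norm_eq_abs,
    Real.norm_of_nonneg (by positivity)]
  exact hr

/-- The perturbation μx changes the logarithm by at most |μ||x| times inverse moduli, whose
y-integrals are bounded uniformly in the shift; s ≥ 1/2 costs a factor 2. What remains, |log|x| -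
m||x|, is a product of two square integrable functions. -/
lemma exists_lintegral_mul_log_diff_le (m : ℝ) : ∃ C : ℝ≥0∞, C ≠ ∞ ∧ ∀ (μ : ℂ) (s : ℝ),
    1 / 2 ≤ s →
    ∫⁻ x, ∫⁻ y, ‖Real.log ‖x‖ - m‖ₑ * ‖Real.log ‖μ * x + s * y‖ - Real.log ‖(s : ℂ) * y‖‖ₑ
      ∂stdComplexGaussian ∂stdComplexGaussian ≤ C * ‖μ‖ₑ := by
  obtain ⟨C, hC, h⟩ := exists_lintegral_add_inv_le
  have hK : ∫⁻ x, ‖Real.log ‖x‖ - m‖ₑ * ‖x‖ₑ ∂stdComplexGaussian ≠ ∞ := by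
    have i1 : Integrable (fun x : ℂ => (Real.log ‖x‖ - m) * ‖x‖) stdComplexGaussian :=
      (memLp_log_norm_stdComplexGaussian.sub (memLp_const m)).integrable_mul
        memLp_id_stdComplexGaussian.norm
    have := i1.hasFiniteIntegral
    rw [HasFiniteIntegral] at this
    simpa [enorm_mul] using this.ne
  refine ⟨(∫⁻ x, ‖Real.log ‖x‖ - m‖ₑ * ‖x‖ₑ ∂stdComplexGaussian) * (2 * (C + C)),
    ENNReal.mul_ne_top hK (ENNReal.mul_ne_top (by simp) (ENNReal.add_ne_top.2 ⟨hC, hC⟩)),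
    fun μ s hs => ?_⟩
  have hs0 : (s : ℂ) ≠ 0 := by
    have : s ≠ 0 := by linarith
    exact_mod_cast this
  have hsinv : ‖(s : ℂ)‖ₑ⁻¹ ≤ 2 := by
    rw [ENNReal.inv_le_iff_inv_le, ← ofReal_norm, Complex.norm_of_nonneg (by linarith)]
    rw [show (2 : ℝ≥0∞)⁻¹ = ENNReal.ofReal (1 / 2) by
      rw [one_div, ENNReal.ofReal_inv_of_pos (by norm_num)]; simp]
    exact ENNReal.ofReal_le_ofReal hs
  have hscale : ∀ w : ℂ, ∫⁻ y, ‖w + s * y‖ₑ⁻¹ ∂stdComplexGaussian ≤ 2 * C := by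
    intro w
    have : ∀ y : ℂ, ‖w + s * y‖ₑ⁻¹ = ‖(s : ℂ)‖ₑ⁻¹ * ‖w / s + y‖ₑ⁻¹ := by
      intro y
      rw [← ENNReal.mul_inv (by simp) (by simp), ← enorm_mul]
      congr 2
      field_simp
    simp_rw [this]
    rw [lintegral_const_mul _ (by fun_prop)]
    exact mul_le_mul' hsinv (h _)
  calc _ ≤ ∫⁻ x, ‖Real.log ‖x‖ - m‖ₑ * (‖μ‖ₑ * ‖x‖ₑ * (2 * (C + C))) ∂stdComplexGaussian := by
        refine lintegral_mono fun x => ?_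
        rw [lintegral_const_mul _ (by fun_prop)]
        gcongr
        calc _ ≤ ∫⁻ y, ‖μ‖ₑ * ‖x‖ₑ * (‖μ * x + s * y‖ₑ⁻¹ + ‖0 + (s : ℂ) * y‖ₑ⁻¹)
              ∂stdComplexGaussian := by
              refine lintegral_mono fun y => (enorm_log_norm_sub_log_norm_le _ _).trans ?_
              rw [add_sub_cancel_right, enorm_mul, zero_add]
          _ ≤ _ := by
              rw [lintegral_const_mul _ (by fun_prop), lintegral_add_left (by fun_prop), mul_add 2]
              exact mul_le_mul_right (add_le_add (hscale _) (hscale _)) _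
    _ = _ := by
        rw [mul_right_comm, ← lintegral_mul_const _ (by fun_prop),
          ← lintegral_mul_const _ (by fun_prop)]
        congr 1; ext x; ring

lemma charFun_stdComplexGaussian (t : ℂ) :
    charFun stdComplexGaussian t = Complex.exp (-(‖t‖ ^ 2 / 4 : ℝ)) := by
  rw [charFun_apply]
  unfold stdComplexGaussian
  rw [integral_map (by fun_prop) (by fun_prop)]
  have hsplit : ∀ p : ℝ × ℝ,
      Complex.exp ((inner ℝ ((p.1 : ℂ) + (p.2 : ℂ) * Complex.I) t : ℝ) * Complex.I)
      = Complex.exp (t.re * p.1 * Complex.I) * Complex.exp (t.im * p.2 * Complex.I) := by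
    intro p
    rw [← Complex.exp_add, Complex.inner]
    congr 1
    simp only [Complex.mul_re, Complex.add_re, Complex.ofReal_re, Complex.I_re, Complex.ofReal_im,
      Complex.I_im, Complex.conj_re, Complex.conj_im, Complex.add_im, Complex.mul_im, map_add,
      map_mul]
    push_cast
    ring
  simp_rw [hsplit]
  rw [integral_prod_mul (f := fun x : ℝ => Complex.exp (t.re * x * Complex.I))
    (g := fun x : ℝ => Complex.exp (t.im * x * Complex.I)), ← charFun_apply_real,
    ← charFun_apply_real, charFun_gaussianReal, charFun_gaussianReal, ← Complex.exp_add]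
  congr 1
  rw [← Complex.normSq_eq_norm_sq, Complex.normSq_apply]
  push_cast
  ring

/-! ### Gaussian series and the covariance of their logarithms -/

section Series

variable {Ω : Type*} [MeasurableSpace Ω] {P : Measure Ω} [IsProbabilityMeasure P]
  {ξ : ℕ → Ω → ℂ}

lemma charFun_map_hasSum (hm : ∀ n, Measurable (ξ n))
    (hlaw : ∀ n, P.map (ξ n) = stdComplexGaussian) (hind : iIndepFun ξ P)
    {c : ℕ → ℂ} {X : Ω → ℂ} (hX : ∀ ω, HasSum (fun n => c n * ξ n ω) (X ω)) {σ : ℝ}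
    (hσ : HasSum (fun n => ‖c n‖ ^ 2) σ) (t : ℂ) :
    ∫ ω, Complex.exp ((inner ℝ (X ω) t : ℝ) * Complex.I) ∂P
      = Complex.exp (-(σ * ‖t‖ ^ 2 / 4 : ℝ)) := by
  have hone : ∀ n, charFun (P.map fun ω => c n * ξ n ω) t
      = Complex.exp (-(‖c n‖ ^ 2 * ‖t‖ ^ 2 / 4 : ℝ)) := by
    intro n
    have : P.map (fun ω => c n * ξ n ω) = stdComplexGaussian.map (fun z => c n * z) := by
      rw [← hlaw n, Measure.map_map (by fun_prop) (hm n)]; rfl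
    rw [this, charFun_apply, integral_map (by fun_prop) (by fun_prop)]
    have h2 : ∀ z : ℂ, inner ℝ (c n * z) t = inner ℝ z (conj (c n) * t) := by
      intro z
      rw [Complex.inner, Complex.inner, map_mul]
      congr 1; ring
    simp_rw [h2]
    rw [← charFun_apply, charFun_stdComplexGaussian, norm_mul, Complex.norm_conj, mul_pow]
  have hfin : ∀ N, ∫ ω, Complex.exp ((inner ℝ (∑ n ∈ Finset.range N, c n * ξ n ω) t : ℝ)
      * Complex.I) ∂P
      = Complex.exp (-((∑ n ∈ Finset.range N, ‖c n‖ ^ 2) * ‖t‖ ^ 2 / 4 : ℝ)) := by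
    intro N
    have hi : iIndepFun (fun n ω => c n * ξ n ω) P :=
      hind.comp (fun n z => c n * z) (fun n => by fun_prop)
    have hmeas : ∀ n, Measurable (fun ω => c n * ξ n ω) := fun n => (hm n).const_mul _
    have h1 := (hi.restrict (Finset.range N)).charFun_map_fun_finsetSum_eq_prod
      (fun n _ => (hmeas n).aemeasurable)
    have h2 := congrFun h1 t
    rw [charFun_apply, integral_map (by fun_prop) (by fun_prop)] at h2
    rw [h2, Finset.prod_apply, Finset.prod_congr rfl fun n _ => hone n, ← Complex.exp_sum]
    congr 1
    push_cast
    rw [Finset.sum_neg_distrib, Finset.sum_mul, Finset.sum_div]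
  have hlim : Tendsto (fun N => ∫ ω, Complex.exp ((inner ℝ (∑ n ∈ Finset.range N, c n * ξ n ω) t : ℝ)
      * Complex.I) ∂P) atTop (𝓝 (∫ ω, Complex.exp ((inner ℝ (X ω) t : ℝ) * Complex.I) ∂P)) := by
    refine tendsto_integral_of_dominated_convergence (fun _ => 1) (fun N => ?_)
      (integrable_const _) (fun N => ?_) ?_
    · have : Measurable fun ω => ∑ n ∈ Finset.range N, c n * ξ n ω :=
        Finset.measurable_sum _ fun n _ => (hm n).const_mul _
      exact Measurable.aestronglyMeasurable (by fun_prop)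
    · exact Eventually.of_forall fun ω => by rw [Complex.norm_exp_ofReal_mul_I]
    · refine Eventually.of_forall fun ω => ?_
      have hc : Continuous fun z : ℂ => Complex.exp ((inner ℝ z t : ℝ) * Complex.I) := by
        fun_prop
      exact (hc.tendsto _).comp (hX ω).tendsto_sum_nat
  have hlim2 : Tendsto (fun N => Complex.exp (-((∑ n ∈ Finset.range N, ‖c n‖ ^ 2) * ‖t‖ ^ 2 / 4 : ℝ)))
      atTop (𝓝 (Complex.exp (-(σ * ‖t‖ ^ 2 / 4 : ℝ)))) := by
    have hc : Continuous fun x : ℝ => Complex.exp (-(x * ‖t‖ ^ 2 / 4 : ℝ)) := by fun_prop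
    exact (hc.tendsto _).comp hσ.tendsto_sum_nat
  simp_rw [hfin] at hlim
  exact tendsto_nhds_unique hlim hlim2

lemma measurable_of_hasSum (hm : ∀ n, Measurable (ξ n)) {c : ℕ → ℂ} {X : Ω → ℂ}
    (hX : ∀ ω, HasSum (fun n => c n * ξ n ω) (X ω)) : Measurable X :=
  measurable_of_tendsto_metrizable
    (f := fun N ω => ∑ n ∈ Finset.range N, c n * ξ n ω)
    (fun _ => Finset.measurable_sum _ fun n _ => (hm n).const_mul _)
    (tendsto_pi_nhds.2 fun ω => (hX ω).tendsto_sum_nat)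

lemma map_hasSum_eq_stdComplexGaussian (hm : ∀ n, Measurable (ξ n))
    (hlaw : ∀ n, P.map (ξ n) = stdComplexGaussian) (hind : iIndepFun ξ P)
    {c : ℕ → ℂ} {X : Ω → ℂ} (hX : ∀ ω, HasSum (fun n => c n * ξ n ω) (X ω))
    (hσ : HasSum (fun n => ‖c n‖ ^ 2) 1) : P.map X = stdComplexGaussian := by
  have hXm := measurable_of_hasSum hm hX
  have := Measure.isProbabilityMeasure_map hXm.aemeasurable (μ := P)
  refine Measure.ext_of_charFun ?_
  ext t
  rw [charFun_apply, integral_map (by fun_prop) (by fun_prop),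
    charFun_map_hasSum hm hlaw hind hX hσ, charFun_stdComplexGaussian, one_mul]

/-- Uncorrelated jointly Gaussian variables are independent: X conj(u) + Y conj(v) is again a series
in the `ξ n`, of variance |u|² + |v|², so the joint characteristic function factors. Circular
symmetry makes the single condition ∑ c conj(d) = 0 enough. -/
lemma map_prod_hasSum_eq_prod (hm : ∀ n, Measurable (ξ n))
    (hlaw : ∀ n, P.map (ξ n) = stdComplexGaussian) (hind : iIndepFun ξ P)
    {c d : ℕ → ℂ} {X Y : Ω → ℂ} (hX : ∀ ω, HasSum (fun n => c n * ξ n ω) (X ω))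
    (hY : ∀ ω, HasSum (fun n => d n * ξ n ω) (Y ω))
    (hc : HasSum (fun n => ‖c n‖ ^ 2) 1) (hd : HasSum (fun n => ‖d n‖ ^ 2) 1)
    (hcd : HasSum (fun n => c n * conj (d n)) 0) :
    P.map (fun ω => (X ω, Y ω)) = stdComplexGaussian.prod stdComplexGaussian := by
  have hXm := measurable_of_hasSum hm hX
  have hYm := measurable_of_hasSum hm hY
  have lX := map_hasSum_eq_stdComplexGaussian hm hlaw hind hX hc
  have lY := map_hasSum_eq_stdComplexGaussian hm hlaw hind hY hd
  suffices hXY : X ⟂ᵢ[P] Y by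
    rw [(indepFun_iff_map_prod_eq_prod_map_map hXm.aemeasurable hYm.aemeasurable).1 hXY, lX, lY]
  rw [indepFun_iff_charFun_prod hXm.aemeasurable hYm.aemeasurable, lX, lY]
  intro t
  obtain ⟨⟨u, v⟩, rfl⟩ := (WithLp.equiv 2 (ℂ × ℂ)).symm.surjective t
  have hm2 : Measurable (fun ω => WithLp.toLp 2 (X ω, Y ω)) := by fun_prop
  rw [charFun_apply, integral_map hm2.aemeasurable (by fun_prop)]
  have hS : ∀ ω, HasSum (fun n => (c n * conj u + d n * conj v) * ξ n ω)
      (X ω * conj u + Y ω * conj v) := by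
    intro ω
    convert! ((hX ω).mul_right (conj u)).add ((hY ω).mul_right (conj v)) using 2 with n
    ring
  have hσ : HasSum (fun n => ‖c n * conj u + d n * conj v‖ ^ 2) (‖u‖ ^ 2 + ‖v‖ ^ 2) := by
    have h1 := (hc.mul_right (‖u‖ ^ 2)).add (hd.mul_right (‖v‖ ^ 2))
    have h2 := (Complex.hasSum_re (hcd.mul_right (2 * conj u * v)))
    convert! h1.add h2 using 1
    · ext n
      simp only [← Complex.normSq_eq_norm_sq]
      rw [Complex.normSq_add]
      simp only [map_mul, Complex.normSq_conj, Complex.conj_conj]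
      rw [show c n * conj (d n) * (2 * conj u * v) = 2 * (c n * conj u * (conj (d n) * v)) by ring]
      simp
    · simp
  -- Testing against 1 takes the real part of X conj(u) + Y conj(v), which is the real inner product
  -- of (X, Y) with (u, v).
  have := charFun_map_hasSum hm hlaw hind hS hσ 1
  rw [charFun_stdComplexGaussian, charFun_stdComplexGaussian, ← Complex.exp_add]
  convert! this using 1
  · congr 1
    ext ω
    congr 3
    rw [WithLp.prod_inner_apply]
    simp [Complex.inner]
    ring
  · congr 1
    simp
    ring

/-- For |l| ≥ 1/2 a variance bound suffices. For smaller |l|, Y = conj(l) X + sE with E standard and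
independent of X; replacing Y by sE makes the covariance vanish, at a cost of order |l|. -/
lemma norm_integral_log_mul_log_le : ∃ C : ℝ, ∀ {Ω : Type*} [MeasurableSpace Ω] {P : Measure Ω}
    [IsProbabilityMeasure P] {ξ : ℕ → Ω → ℂ}, (∀ n, Measurable (ξ n)) →
    (∀ n, P.map (ξ n) = stdComplexGaussian) → iIndepFun ξ P →
    ∀ {c d : ℕ → ℂ} {X Y : Ω → ℂ}, (∀ ω, HasSum (fun n => c n * ξ n ω) (X ω)) →
    (∀ ω, HasSum (fun n => d n * ξ n ω) (Y ω)) →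
    HasSum (fun n => ‖c n‖ ^ 2) 1 → HasSum (fun n => ‖d n‖ ^ 2) 1 →
    ∀ {l : ℂ}, HasSum (fun n => c n * conj (d n)) l →
    |∫ ω, (Real.log ‖X ω‖ - ∫ z, Real.log ‖z‖ ∂stdComplexGaussian) *
      (Real.log ‖Y ω‖ - ∫ z, Real.log ‖z‖ ∂stdComplexGaussian) ∂P| ≤ C * ‖l‖ := by
  set m := ∫ z, Real.log ‖z‖ ∂stdComplexGaussian with hmdef
  obtain ⟨K, hK, hKle⟩ := exists_lintegral_mul_log_diff_le m
  set V := ∫ z, (Real.log ‖z‖ - m) ^ 2 ∂stdComplexGaussian with hV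
  have hV0 : 0 ≤ V := integral_nonneg fun z => sq_nonneg _
  have hhm : Measurable (fun z : ℂ => Real.log ‖z‖) := Real.measurable_log.comp measurable_norm
  have hL2 : MemLp (fun z : ℂ => Real.log ‖z‖ - m) 2 stdComplexGaussian :=
    memLp_log_norm_stdComplexGaussian.sub (memLp_const m)
  have hint : Integrable (fun z : ℂ => Real.log ‖z‖ - m) stdComplexGaussian :=
    hL2.integrable (by norm_num)
  have hzero : ∫ z, (Real.log ‖z‖ - m) ∂stdComplexGaussian = 0 := by
    rw [integral_sub (memLp_log_norm_stdComplexGaussian.integrable (by norm_num))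
      (integrable_const m)]
    simp [hmdef]
  -- `2 * V` serves the case |l| ≥ 1/2, where V ≤ 2V|l|; `K` serves the perturbative case.
  refine ⟨max (2 * V) K.toReal, ?_⟩
  intro Ω _ P _ ξ hm hlaw hind c d X Y hX hY hc hd l hl
  have hXm := measurable_of_hasSum hm hX
  have hYm := measurable_of_hasSum hm hY
  have lX := map_hasSum_eq_stdComplexGaussian hm hlaw hind hX hc
  have lY := map_hasSum_eq_stdComplexGaussian hm hlaw hind hY hd
  rcases le_or_gt (1 / 2) ‖l‖ with hl2 | hl2
  · have iX : Integrable (fun ω => (Real.log ‖X ω‖ - m) ^ 2) P := by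
      have := hL2.integrable_sq
      rw [← lX] at this
      exact this.comp_measurable hXm
    have iY : Integrable (fun ω => (Real.log ‖Y ω‖ - m) ^ 2) P := by
      have := hL2.integrable_sq
      rw [← lY] at this
      exact this.comp_measurable hYm
    have vX : ∫ ω, (Real.log ‖X ω‖ - m) ^ 2 ∂P = V := by
      rw [hV, ← lX, integral_map hXm.aemeasurable
        ((hhm.sub_const m).pow_const 2).aestronglyMeasurable]
    have vY : ∫ ω, (Real.log ‖Y ω‖ - m) ^ 2 ∂P = V := by
      rw [hV, ← lY, integral_map hYm.aemeasurable
        ((hhm.sub_const m).pow_const 2).aestronglyMeasurable]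
    calc _ ≤ ∫ ω, (2⁻¹ * (Real.log ‖X ω‖ - m) ^ 2 + 2⁻¹ * (Real.log ‖Y ω‖ - m) ^ 2) ∂P := by
          rw [← Real.norm_eq_abs]
          refine norm_integral_le_of_norm_le ((iX.const_mul _).add (iY.const_mul _))
            (Eventually.of_forall fun ω => ?_)
          rw [Real.norm_eq_abs, abs_mul]
          rw [← sq_abs (Real.log ‖X ω‖ - m), ← sq_abs (Real.log ‖Y ω‖ - m)]
          nlinarith [sq_nonneg (|Real.log ‖X ω‖ - m| - |Real.log ‖Y ω‖ - m|)]
      _ = V := by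
          rw [integral_add (iX.const_mul _) (iY.const_mul _), integral_const_mul,
            integral_const_mul, vX, vY]
          ring
      _ ≤ (2 * V) * ‖l‖ := by nlinarith
      _ ≤ _ := by gcongr; exact le_max_left _ _
  · set s : ℝ := √(1 - ‖l‖ ^ 2) with hs
    have hpos : (1 / 2) ^ 2 ≤ 1 - ‖l‖ ^ 2 := by nlinarith [norm_nonneg l]
    have hs2 : s ^ 2 = 1 - ‖l‖ ^ 2 := Real.sq_sqrt (by linarith [hpos])
    have hs12 : 1 / 2 ≤ s := Real.le_sqrt_of_sq_le hpos
    have hs0 : (s : ℂ) ≠ 0 := by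
      have : s ≠ 0 := by linarith
      exact_mod_cast this
    set μ : ℂ := conj l with hμ
    -- Gram–Schmidt: the part of Y orthogonal to X, scaled to unit variance.
    have hE : ∀ ω, HasSum (fun n => (d n - μ * c n) / s * ξ n ω) ((Y ω - μ * X ω) / s) := by
      intro ω
      convert! ((hY ω).sub ((hX ω).mul_left μ)).div_const (s : ℂ) using 2 with n
      ring
    have hEs : HasSum (fun n => ‖(d n - μ * c n) / s‖ ^ 2) 1 := by
      have h1 := hd.add (hc.mul_left (‖l‖ ^ 2))
      have h2 := (Complex.hasSum_re (hl.mul_left (2 * μ)))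
      have h3 := (h1.sub h2).div_const (s ^ 2)
      convert! h3 using 1
      · ext n
        rw [norm_div, div_pow, Complex.norm_real, Real.norm_eq_abs, sq_abs]
        congr 1
        simp only [← Complex.normSq_eq_norm_sq]
        rw [Complex.normSq_sub]
        simp only [map_mul, hμ, Complex.normSq_conj, Complex.conj_conj]
        rw [show 2 * (starRingEnd ℂ) l * (c n * (starRingEnd ℂ) (d n))
          = ((2 : ℝ) : ℂ) * (conj l * c n * conj (d n)) by push_cast; ring, Complex.re_ofReal_mul]
        have : (d n * (l * conj (c n))).re = (conj l * c n * conj (d n)).re := by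
          rw [← Complex.conj_re]
          simp only [map_mul, Complex.conj_conj]
          congr 1; ring
        rw [this]
      · have h4 : (2 * μ * l).re = 2 * ‖l‖ ^ 2 := by
          rw [hμ, mul_assoc, ← Complex.normSq_eq_conj_mul_self, Complex.normSq_eq_norm_sq]
          norm_cast
        rw [h4, hs2, eq_div_iff (by linarith)]
        ring
    have hcE : HasSum (fun n => c n * conj ((d n - μ * c n) / s)) 0 := by
      have h1 := hl.sub ((Complex.hasSum_ofReal.2 hc).mul_left l)
      have h2 := h1.div_const (s : ℂ)
      convert! h2 using 1
      · ext n
        simp only [map_div₀, map_sub, map_mul, hμ, Complex.conj_conj, Complex.conj_ofReal]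
        rw [← Complex.normSq_eq_norm_sq, ← Complex.mul_conj]
        ring
      · simp
    have lpair := map_prod_hasSum_eq_prod hm hlaw hind hX hE hc hEs hcE
    have hpm : Measurable fun ω => (X ω, (Y ω - μ * X ω) / s) := by fun_prop
    have htrans : ∫ ω, (Real.log ‖X ω‖ - m) * (Real.log ‖Y ω‖ - m) ∂P
        = ∫ p : ℂ × ℂ, (Real.log ‖p.1‖ - m) * (Real.log ‖μ * p.1 + s * p.2‖ - m)
          ∂(stdComplexGaussian.prod stdComplexGaussian) := by
      rw [← lpair, integral_map hpm.aemeasurable]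
      · congr 1; ext ω
        congr 4
        simp only
        field_simp
        ring
      · apply Measurable.aestronglyMeasurable
        have h1 : Measurable fun p : ℂ × ℂ => Real.log ‖p.1‖ := hhm.comp measurable_fst
        have h2 : Measurable fun p : ℂ × ℂ => Real.log ‖μ * p.1 + s * p.2‖ :=
          hhm.comp (by fun_prop)
        fun_prop
    have m1 : Measurable fun p : ℂ × ℂ => Real.log ‖p.1‖ := hhm.comp measurable_fst
    have m2 : Measurable fun p : ℂ × ℂ => Real.log ‖μ * p.1 + s * p.2‖ := hhm.comp (by fun_prop)
    have m3 : Measurable fun p : ℂ × ℂ => Real.log ‖(s : ℂ) * p.2‖ := hhm.comp (by fun_prop)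
    have hlin : ∫⁻ p : ℂ × ℂ, ‖(Real.log ‖p.1‖ - m) *
        (Real.log ‖μ * p.1 + s * p.2‖ - Real.log ‖(s : ℂ) * p.2‖)‖ₑ
          ∂(stdComplexGaussian.prod stdComplexGaussian) ≤ K * ‖l‖ₑ := by
      rw [lintegral_prod _ (by fun_prop)]
      simp_rw [enorm_mul]
      refine (hKle μ s hs12).trans (le_of_eq ?_)
      rw [hμ, ← ofReal_norm, Complex.norm_conj, ofReal_norm]
    have hfin : K * ‖l‖ₑ ≠ ∞ := ENNReal.mul_ne_top hK enorm_ne_top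
    have iA : Integrable (fun p : ℂ × ℂ => (Real.log ‖p.1‖ - m) *
        (Real.log ‖μ * p.1 + s * p.2‖ - Real.log ‖(s : ℂ) * p.2‖))
          (stdComplexGaussian.prod stdComplexGaussian) :=
      ⟨Measurable.aestronglyMeasurable (by fun_prop), hlin.trans_lt hfin.lt_top⟩
    have iS : Integrable (fun z : ℂ => Real.log ‖(s : ℂ) * z‖ - m) stdComplexGaussian := by
      refine (hint.add (integrable_const (Real.log s))).congr ?_
      have h0 : ∀ᵐ z ∂stdComplexGaussian, z ≠ 0 := by simp [ae_iff]
      filter_upwards [h0] with z hz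
      rw [norm_mul, Real.log_mul (by simpa using hs0) (by simpa using hz), Complex.norm_real,
        Real.norm_of_nonneg (by linarith)]
      simp only [Pi.add_apply]
      ring
    have iB : Integrable (fun p : ℂ × ℂ => (Real.log ‖p.1‖ - m) *
        (Real.log ‖(s : ℂ) * p.2‖ - m)) (stdComplexGaussian.prod stdComplexGaussian) :=
      hint.mul_prod iS
    have hsplit : ∫ p : ℂ × ℂ, (Real.log ‖p.1‖ - m) * (Real.log ‖μ * p.1 + s * p.2‖ - m)
          ∂(stdComplexGaussian.prod stdComplexGaussian)
        = ∫ p : ℂ × ℂ, (Real.log ‖p.1‖ - m) *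
        (Real.log ‖μ * p.1 + s * p.2‖ - Real.log ‖(s : ℂ) * p.2‖)
          ∂(stdComplexGaussian.prod stdComplexGaussian) := by
      -- The unperturbed term factors by independence, and the first factor is centred.
      have hB : ∫ p : ℂ × ℂ, (Real.log ‖p.1‖ - m) * (Real.log ‖(s : ℂ) * p.2‖ - m)
          ∂(stdComplexGaussian.prod stdComplexGaussian) = 0 := by
        rw [integral_prod_mul (f := fun z : ℂ => Real.log ‖z‖ - m)
          (g := fun z : ℂ => Real.log ‖(s : ℂ) * z‖ - m), hzero, zero_mul]
      rw [← add_zero (∫ p : ℂ × ℂ, (Real.log ‖p.1‖ - m) *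
        (Real.log ‖μ * p.1 + s * p.2‖ - Real.log ‖(s : ℂ) * p.2‖)
          ∂(stdComplexGaussian.prod stdComplexGaussian)), ← hB, ← integral_add iA iB]
      congr 1; ext p; ring
    rw [htrans, hsplit, ← Real.norm_eq_abs]
    refine (norm_integral_le_lintegral_norm _).trans ?_
    have h5 : (∫⁻ p : ℂ × ℂ, ENNReal.ofReal ‖(Real.log ‖p.1‖ - m) *
        (Real.log ‖μ * p.1 + s * p.2‖ - Real.log ‖(s : ℂ) * p.2‖)‖
          ∂(stdComplexGaussian.prod stdComplexGaussian)).toReal ≤ (K * ‖l‖ₑ).toReal := by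
      refine ENNReal.toReal_mono hfin ?_
      simpa only [ofReal_norm] using hlin
    refine h5.trans ?_
    rw [ENNReal.toReal_mul, toReal_enorm]
    gcongr
    exact le_max_right _ _

end Series

/-! ### Logarithmic moments on circles -/

/-- The average of `z ^ k * log ‖f z‖` over the circle of radius `ρ` around the origin. -/
def logMoment (k : ℕ) (f : ℂ → ℂ) (ρ : ℝ) : ℂ :=
  Real.circleAverage (fun z => z ^ k * (Real.log ‖f z‖ : ℂ)) 0 ρ

/-- Cauchy's theorem on the annulus between the circles; j may be negative, since the possible pole
at 0 is not enclosed. -/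
lemma circleAverage_zpow_mul_eq {q : ℂ → ℂ} {R : ℝ} (hq : DifferentiableOn ℂ q (Metric.ball 0 R))
    (j : ℤ) {r ρ : ℝ} (hr : 0 < r) (hrρ : r ≤ ρ) (hρ : ρ < R) :
    Real.circleAverage (fun z => z ^ j * q z) 0 ρ = Real.circleAverage (fun z => z ^ j * q z) 0 r := by
  rw [Real.circleAverage_eq_circleIntegral (by linarith), Real.circleAverage_eq_circleIntegral hr.ne']
  congr 1
  have hd : ∀ z ∈ Metric.closedBall (0 : ℂ) ρ \ Metric.ball 0 r,
      DifferentiableAt ℂ (fun z => z ^ j * q z) z := by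
    intro z hz
    have hz0 : z ≠ 0 := by
      rintro rfl
      exact hz.2 (Metric.mem_ball_self hr)
    have hzR : z ∈ Metric.ball (0 : ℂ) R := Metric.closedBall_subset_ball hρ hz.1
    exact (differentiableAt_zpow.2 (Or.inl hz0)).mul
      ((hq z hzR).differentiableAt (Metric.isOpen_ball.mem_nhds hzR))
  refine Complex.circleIntegral_sub_center_inv_smul_eq_of_differentiable_on_annulus_off_countable
    hr hrρ Set.countable_empty (fun z hz => (hd z hz).continuousAt.continuousWithinAt)
    (fun z hz => hd z ⟨Metric.ball_subset_closedBall hz.1.1, fun h =>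
      hz.1.2 (Metric.ball_subset_closedBall h)⟩)

lemma exists_circleAverage_zpow_mul_eq {q : ℂ → ℂ} {R : ℝ}
    (hq : DifferentiableOn ℂ q (Metric.ball 0 R)) (j : ℤ) :
    ∃ c : ℂ, ∀ ρ, 0 < ρ → ρ < R → Real.circleAverage (fun z => z ^ j * q z) 0 ρ = c := by
  rcases le_or_gt R 0 with hR | hR
  · exact ⟨0, fun ρ h1 h2 => by linarith⟩
  refine ⟨Real.circleAverage (fun z => z ^ j * q z) 0 (R / 2), fun ρ h1 h2 => ?_⟩
  rcases le_total ρ (R / 2) with h | h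
  · exact (circleAverage_zpow_mul_eq hq j h1 h (by linarith)).symm
  · exact circleAverage_zpow_mul_eq hq j (by linarith) h h2

lemma circleAverage_conj {F : ℂ → ℂ} {ρ : ℝ} :
    Real.circleAverage (fun z => conj (F z)) 0 ρ = conj (Real.circleAverage F 0 ρ) := by
  rw [Real.circleAverage_def, Real.circleAverage_def, Complex.real_smul, Complex.real_smul, map_mul,
    Complex.conj_ofReal, intervalIntegral.integral_of_le Real.two_pi_pos.le,
    intervalIntegral.integral_of_le Real.two_pi_pos.le, integral_conj]

/-- Write Re q = (q + conj q)/2. The first half is given by the mean value property; for the second,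
conj z = ρ²/z on the circle turns z^k conj(q) into ρ^(2k) conj(z^(-k) q). -/
lemma circleAverage_pow_mul_re {q : ℂ → ℂ} {R : ℝ} (hq : DifferentiableOn ℂ q (Metric.ball 0 R))
    (k : ℕ) {ρ : ℝ} (h0 : 0 < ρ) (hR : ρ < R) :
    Real.circleAverage (fun z => z ^ k * ((q z).re : ℂ)) 0 ρ
      = (0 ^ k * q 0 + ρ ^ (2 * k) * conj (Real.circleAverage (fun z => z ^ (-(k : ℤ)) * q z) 0 ρ)) / 2 := by
  have hcl : Metric.closedBall (0 : ℂ) ρ ⊆ Metric.ball 0 R := Metric.closedBall_subset_ball hR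
  have hcont : ContinuousOn q (Metric.sphere 0 ρ) :=
    hq.continuousOn.mono (Metric.sphere_subset_closedBall.trans hcl)
  have hz0 : ∀ z ∈ Metric.sphere (0 : ℂ) ρ, z ≠ 0 := by
    rintro z hz rfl
    simp at hz; linarith
  have h1 : Real.circleAverage (fun z => z ^ k * q z) 0 ρ = 0 ^ k * q 0 := by
    have : DiffContOnCl ℂ (fun z => z ^ k * q z) (Metric.ball 0 |ρ|) := by
      rw [abs_of_pos h0]
      refine DifferentiableOn.diffContOnCl ?_
      rw [closure_ball _ h0.ne']
      exact (by fun_prop : DifferentiableOn ℂ (fun z : ℂ => z ^ k) _).mul (hq.mono hcl)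
    exact this.circleAverage
  have c1 : CircleIntegrable (fun z => z ^ k * q z) 0 ρ :=
    ContinuousOn.circleIntegrable h0.le ((by fun_prop : ContinuousOn (fun z : ℂ => z ^ k) _).mul hcont)
  have c2 : CircleIntegrable (fun z => conj (z ^ (-(k : ℤ)) * q z)) 0 ρ := by
    refine ContinuousOn.circleIntegrable h0.le ?_
    refine Complex.continuous_conj.comp_continuousOn (ContinuousOn.mul ?_ hcont)
    exact fun z hz => (continuousAt_zpow₀ z _ (Or.inl (hz0 z hz))).continuousWithinAt
  calc _ = Real.circleAverage (fun z => (1 / 2 : ℂ) • (z ^ k * q z)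
        + ((ρ : ℂ) ^ (2 * k) / 2) • conj (z ^ (-(k : ℤ)) * q z)) 0 ρ := by
        refine Real.circleAverage_congr_sphere fun z hz => ?_
        rw [abs_of_pos h0] at hz
        have hz' := hz0 z hz
        have hn : z * conj z = (ρ : ℂ) ^ 2 := by
          rw [Complex.mul_conj, Complex.normSq_eq_norm_sq, mem_sphere_zero_iff_norm.1 hz]
          push_cast; rfl
        have hcz : conj z ≠ 0 := by simpa using hz'
        simp only [smul_eq_mul, map_mul, zpow_neg, zpow_natCast, map_inv₀, map_pow]
        rw [Complex.re_eq_add_conj, pow_mul, ← hn, mul_pow]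
        field_simp
    _ = _ := by
        rw [Real.circleAverage_fun_add (c1.const_fun_smul) (c2.const_fun_smul),
          Real.circleAverage_fun_smul, Real.circleAverage_fun_smul, h1, circleAverage_conj]
        simp only [smul_eq_mul]
        ring

/-- Without zeros log|g| is the real part of a holomorphic q, and only one Taylor coefficient of q
survives. The known power of ρ lets a combination of two scales cancel this contribution. -/
lemma exists_logMoment_eq_of_ne_zero {g : ℂ → ℂ} (hg : Differentiable ℂ g) {R : ℝ}
    (h0 : ∀ z ∈ Metric.ball (0 : ℂ) R, g z ≠ 0) (k : ℕ) :
    ∃ κ : ℂ, ∀ ρ, 0 < ρ → ρ < R → logMoment k g ρ = κ * ρ ^ (2 * k) := by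
  obtain ⟨q, hq, hre⟩ := InnerProductSpace.HarmonicOnNhd.exists_analyticOnNhd_ball_re_eq
    (f := fun z => Real.log ‖g z‖) (z := 0) (R := R)
    (fun z hz => (hg.analyticAt z).harmonicAt_log_norm (h0 z hz))
  obtain ⟨c, hc⟩ := exists_circleAverage_zpow_mul_eq hq.differentiableOn (-(k : ℤ))
  refine ⟨(0 ^ k * q 0 + conj c) / 2, fun ρ h1 h2 => ?_⟩
  have : logMoment k g ρ = Real.circleAverage (fun z => z ^ k * ((q z).re : ℂ)) 0 ρ := by
    refine Real.circleAverage_congr_sphere fun z hz => ?_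
    rw [abs_of_pos h1] at hz
    have hz' : z ∈ Metric.ball (0 : ℂ) R :=
      Metric.closedBall_subset_ball h2 (Metric.sphere_subset_closedBall hz)
    have h3 := hre hz'
    simp only at h3 ⊢
    rw [h3]
  rw [this, circleAverage_pow_mul_re hq.differentiableOn k h1 h2, hc ρ h1 h2]
  rcases Nat.eq_zero_or_pos k with rfl | hk
  · simp
  · simp [hk.ne']
    ring

lemma circleAverage_zpow {j : ℤ} (hj : j ≠ 0) {ρ : ℝ} (h0 : 0 < ρ) :
    Real.circleAverage (fun z => z ^ j) 0 ρ = 0 := by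
  rw [Real.circleAverage_eq_circleIntegral h0.ne']
  have : ∮ z in C(0, ρ), (z - 0)⁻¹ • z ^ j = ∮ z in C(0, ρ), (z - 0) ^ (j - 1) := by
    refine circleIntegral.integral_congr h0.le fun z hz => ?_
    have hz0 : z ≠ 0 := by
      rintro rfl
      simp at hz; linarith
    simp only [sub_zero, smul_eq_mul]
    rw [zpow_sub_one₀ hz0]; ring
  rw [this, circleIntegral.integral_sub_zpow_of_ne (by omega), smul_zero]

/-- Extracts the k-th Taylor coefficient of log(1 - bz). For k = 0 the convention x / 0 = 0 gives
the correct constant term. -/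
lemma circleAverage_zpow_mul_log {b : ℂ} {ρ : ℝ} (h0 : 0 < ρ) (hb : ‖b‖ * ρ < 1) (k : ℕ) :
    Real.circleAverage (fun z => z ^ (-(k : ℤ)) * Complex.log (1 - b * z)) 0 ρ = -(b ^ k / k) := by
  have hρ : (ρ : ℂ) ≠ 0 := by exact_mod_cast h0.ne'
  have hcm : ∀ θ, ‖circleMap 0 ρ θ‖ = ρ := fun θ => by simp [abs_of_pos h0]
  have hcm0 : ∀ θ, circleMap 0 ρ θ ≠ 0 := fun θ => circleMap_ne_center h0.ne'
  have hgeo : Summable fun n : ℕ => (‖b‖ * ρ) ^ n :=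
    summable_geometric_of_lt_one (by positivity) hb
  have key := intervalIntegral.hasSum_integral_of_dominated_convergence (μ := volume)
    (a := 0) (b := 2 * Real.pi)
    (F := fun (n : ℕ) θ => circleMap 0 ρ θ ^ (-(k : ℤ)) * ((b * circleMap 0 ρ θ) ^ n / n))
    (f := fun θ => circleMap 0 ρ θ ^ (-(k : ℤ)) * -Complex.log (1 - b * circleMap 0 ρ θ))
    (fun n _ => ρ ^ (-(k : ℤ)) * (‖b‖ * ρ) ^ n)
    (fun n => by
      refine Continuous.aestronglyMeasurable ?_
      exact ((continuous_circleMap 0 ρ).zpow₀ _ (fun θ => Or.inl (hcm0 θ))).mul (by fun_prop))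
    (fun n => Eventually.of_forall fun θ _ => by
      rw [norm_mul, norm_zpow, hcm, norm_div, norm_pow, norm_mul, hcm, Complex.norm_natCast]
      gcongr
      rcases Nat.eq_zero_or_pos n with rfl | hn
      · simp
      · exact div_le_self (by positivity) (by exact_mod_cast hn))
    (Eventually.of_forall fun θ _ => hgeo.mul_left _)
    intervalIntegrable_const
    (Eventually.of_forall fun θ _ => by
      refine (Complex.hasSum_taylorSeries_neg_log ?_).mul_left _
      rw [norm_mul, hcm]; exact hb)
  have key2 := key.mul_left ((2 * Real.pi : ℝ) : ℂ)⁻¹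
  have hterm : ∀ n : ℕ, ((2 * Real.pi : ℝ) : ℂ)⁻¹ * ∫ θ in (0 : ℝ)..2 * Real.pi,
      circleMap 0 ρ θ ^ (-(k : ℤ)) * ((b * circleMap 0 ρ θ) ^ n / n)
      = if n = k then b ^ k / k else 0 := by
    intro n
    have e1 : ((2 * Real.pi : ℝ) : ℂ)⁻¹ * ∫ θ in (0 : ℝ)..2 * Real.pi,
      circleMap 0 ρ θ ^ (-(k : ℤ)) * ((b * circleMap 0 ρ θ) ^ n / n)
      = Real.circleAverage (fun z => (b ^ n / n) • z ^ ((n : ℤ) - k)) 0 ρ := by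
      rw [Real.circleAverage_def, Complex.real_smul, Complex.ofReal_inv]
      congr 1
      refine intervalIntegral.integral_congr fun θ _ => ?_
      simp only [smul_eq_mul]
      rw [zpow_sub₀ (hcm0 θ), zpow_neg, zpow_natCast, zpow_natCast, mul_pow]
      ring
    rw [e1, Real.circleAverage_fun_smul]
    split_ifs with h
    · subst h
      simp [Real.circleAverage_const]
    · rw [circleAverage_zpow (by omega) h0, smul_zero]
  simp_rw [hterm] at key2
  have h3 := key2.unique (hasSum_ite_eq k (b ^ k / (k : ℂ)))
  rw [Real.circleAverage_def, Complex.real_smul, ← h3, Complex.ofReal_inv, ← mul_neg,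
    ← intervalIntegral.integral_neg]
  congr 1
  refine intervalIntegral.integral_congr fun θ _ => ?_
  ring

/-- On the circle z - a = z conj(1 - bz) with b = conj(a)/ρ², so log|z - a| = log ρ + Re log(1 -
bz), where the last function has no singularity in the disc. For k = 0 the term a^k/(2k) is 0 by
convention and Jensen's formula remains. -/
lemma logMoment_sub_of_norm_lt {a : ℂ} {ρ : ℝ} (ha : ‖a‖ < ρ) (k : ℕ) :
    logMoment k (fun z => z - a) ρ = 0 ^ k * Real.log ρ - a ^ k / (2 * k) := by
  have h0 : 0 < ρ := (norm_nonneg a).trans_lt ha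
  have hρ : (ρ : ℂ) ≠ 0 := by exact_mod_cast h0.ne'
  set b : ℂ := conj a / ρ ^ 2 with hb
  have hbn : ‖b‖ = ‖a‖ / ρ ^ 2 := by
    rw [hb, norm_div, Complex.norm_conj, norm_pow, Complex.norm_real, Real.norm_of_nonneg h0.le]
  have hbρ : ‖b‖ * ρ < 1 := by
    rw [hbn]
    have : ‖a‖ / ρ ^ 2 * ρ = ‖a‖ / ρ := by field_simp
    rw [this, div_lt_one h0]; exact ha
  -- Some room beyond ρ, so that log(1 - bz) is holomorphic on an open disc containing the closed
  -- one.
  obtain ⟨R, hR1, hR2⟩ : ∃ R, ρ < R ∧ ‖b‖ * R < 1 := by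
    have hc : ContinuousAt (fun x : ℝ => ‖b‖ * x) ρ := by fun_prop
    have h1 := hc.eventually_lt continuousAt_const hbρ
    obtain ⟨ε, hε, hball⟩ := Metric.eventually_nhds_iff.1 h1
    refine ⟨ρ + ε / 2, by linarith, hball ?_⟩
    simp [abs_of_pos hε]; linarith
  have hlt : ∀ z ∈ Metric.ball (0 : ℂ) R, ‖b * z‖ < 1 := by
    intro z hz
    rw [norm_mul]
    rw [mem_ball_zero_iff] at hz
    exact lt_of_le_of_lt (by gcongr) hR2
  have hslit : ∀ z ∈ Metric.ball (0 : ℂ) R, 1 - b * z ∈ Complex.slitPlane := by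
    intro z hz
    have := Complex.mem_slitPlane_of_norm_lt_one (z := -(b * z)) (by rw [norm_neg]; exact hlt z hz)
    rwa [← sub_eq_add_neg] at this
  have hq : DifferentiableOn ℂ (fun z => Complex.log (1 - b * z)) (Metric.ball 0 R) := by
    intro z hz
    have h1 : DifferentiableAt ℂ (fun z => 1 - b * z) z := by fun_prop
    exact (h1.clog (hslit z hz)).differentiableWithinAt
  have hlog : Set.EqOn (fun z => z ^ k * (Real.log ‖z - a‖ : ℂ))
      (fun z => (Real.log ρ : ℂ) • z ^ k + z ^ k * ((Complex.log (1 - b * z)).re : ℂ))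
      (Metric.sphere 0 |ρ|) := by
    intro z hz
    rw [abs_of_pos h0] at hz
    have hzn : ‖z‖ = ρ := mem_sphere_zero_iff_norm.1 hz
    have hz' : z ∈ Metric.ball (0 : ℂ) R := by rw [mem_ball_zero_iff, hzn]; exact hR1
    have h1 : 1 - b * z ≠ 0 := Complex.slitPlane_ne_zero (hslit z hz')
    have hzz : z * conj z = (ρ : ℂ) ^ 2 := by
      rw [Complex.mul_conj, Complex.normSq_eq_norm_sq, hzn]
      push_cast; rfl
    have h2 : z - a = z * conj (1 - b * z) := by
      simp only [map_sub, map_one, map_mul, hb, map_div₀, Complex.conj_conj, map_pow,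
        Complex.conj_ofReal]
      rw [← hzz]
      have hz0 : z ≠ 0 := by
        intro h; rw [h, norm_zero] at hzn; linarith
      have hcz : conj z ≠ 0 := by simpa using hz0
      field_simp
    simp only [smul_eq_mul]
    rw [h2, norm_mul, Complex.norm_conj, hzn, Real.log_mul h0.ne' (by simpa using h1),
      Complex.log_re]
    push_cast; ring
  unfold logMoment
  rw [Real.circleAverage_congr_sphere hlog, Real.circleAverage_fun_add, Real.circleAverage_fun_smul,
    circleAverage_pow_mul_re hq k h0 hR1, circleAverage_zpow_mul_log h0 hbρ]
  · have h4 : Real.circleAverage (fun z : ℂ => z ^ k) 0 ρ = 0 ^ k := by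
      have : DiffContOnCl ℂ (fun z : ℂ => z ^ k) (Metric.ball 0 |ρ|) :=
        (by fun_prop : Differentiable ℂ fun z : ℂ => z ^ k).diffContOnCl
      exact this.circleAverage
    rw [h4]
    simp only [map_neg, map_div₀, map_pow, hb, Complex.conj_conj, Complex.conj_ofReal, map_natCast,
      mul_zero, sub_zero, Complex.log_one, smul_eq_mul, div_pow]
    field_simp
    ring
  · exact ContinuousOn.circleIntegrable h0.le (by fun_prop)
  · refine ContinuousOn.circleIntegrable h0.le ?_
    have h5 : ContinuousOn (fun z => Complex.log (1 - b * z)) (Metric.sphere 0 ρ) :=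
      hq.continuousOn.mono (Metric.sphere_subset_closedBall.trans (Metric.closedBall_subset_ball hR1))
    exact (by fun_prop : ContinuousOn (fun z : ℂ => z ^ k) _).mul
      (Complex.continuous_ofReal.comp_continuousOn (Complex.continuous_re.comp_continuousOn h5))

lemma finite_inter_zeros {f : ℂ → ℂ} (hf : Differentiable ℂ f) {x : ℂ} (hx : f x ≠ 0) {K : Set ℂ}
    (hK : IsCompact K) : (K ∩ f ⁻¹' {0}).Finite := by
  have h1 : AnalyticOnNhd ℂ f Set.univ := fun z _ => hf.analyticAt z
  have h2 := h1.preimage_zero_mem_codiscrete hx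
  have h3 := hK.finite_sdiff_of_mem_codiscreteWithin
    (codiscreteWithin_mono (Set.subset_univ K) h2)
  refine h3.subset fun z hz => ⟨hz.1, ?_⟩
  simpa using hz.2

lemma countable_zeros {f : ℂ → ℂ} (hf : Differentiable ℂ f) {x : ℂ} (hx : f x ≠ 0) :
    (f ⁻¹' {0}).Countable := by
  have : f ⁻¹' {0} = ⋃ n : ℕ, Metric.closedBall 0 n ∩ f ⁻¹' {0} := by
    rw [← Set.iUnion_inter, Metric.iUnion_closedBall_nat, Set.univ_inter]
  rw [this]
  exact Set.countable_iUnion fun n => (finite_inter_zeros hf hx (isCompact_closedBall 0 _)).countable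

/-- Roots are divided out one at a time; `dslope` is the quotient with its removable singularity
filled in. -/
lemma exists_eq_prod_mul {g : ℂ → ℂ} (hg : Differentiable ℂ g) (S : Finset ℂ)
    (hS : ∀ a ∈ S, g a = 0) :
    ∃ g₁ : ℂ → ℂ, Differentiable ℂ g₁ ∧ ∀ z, g z = (∏ a ∈ S, (z - a)) * g₁ z := by
  classical
  induction S using Finset.induction_on with
  | empty => exact ⟨g, hg, fun z => by simp⟩
  | insert a S ha ih =>
    obtain ⟨g₁, h1, h2⟩ := ih fun b hb => hS b (Finset.mem_insert_of_mem hb)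
    have h3 : g₁ a = 0 := by
      have h4 := h2 a
      rw [hS a (Finset.mem_insert_self a S), eq_comm, mul_eq_zero] at h4
      refine h4.resolve_left (Finset.prod_ne_zero_iff.2 fun b hb => sub_ne_zero.2 ?_)
      rintro rfl
      exact ha hb
    refine ⟨dslope g₁ a, ?_, fun z => ?_⟩
    · rw [← differentiableOn_univ] at h1 ⊢
      exact (Complex.differentiableOn_dslope univ_mem).2 h1
    · have h5 := sub_smul_dslope g₁ a z
      rw [h3, sub_zero, smul_eq_mul] at h5
      rw [h2 z, Finset.prod_insert ha, ← h5]
      ring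

lemma circleIntegrable_pow_mul_log {f : ℂ → ℂ} (hf : Continuous f) {ρ : ℝ} (h0 : 0 < ρ)
    (hz : ∀ z ∈ Metric.sphere (0 : ℂ) ρ, f z ≠ 0) (k : ℕ) :
    CircleIntegrable (fun z => z ^ k * (Real.log ‖f z‖ : ℂ)) 0 ρ := by
  refine ContinuousOn.circleIntegrable h0.le ?_
  refine (by fun_prop : ContinuousOn (fun z : ℂ => z ^ k) _).mul
    (Complex.continuous_ofReal.comp_continuousOn ?_)
  exact ContinuousOn.log (by fun_prop) fun z hz' => norm_ne_zero_iff.2 (hz z hz')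

lemma logMoment_mul {f g : ℂ → ℂ} (hf : Continuous f) (hg : Continuous g) {ρ : ℝ} (h0 : 0 < ρ)
    (hfz : ∀ z ∈ Metric.sphere (0 : ℂ) ρ, f z ≠ 0) (hgz : ∀ z ∈ Metric.sphere (0 : ℂ) ρ, g z ≠ 0)
    (k : ℕ) : logMoment k (fun z => f z * g z) ρ = logMoment k f ρ + logMoment k g ρ := by
  unfold logMoment
  rw [← Real.circleAverage_fun_add (circleIntegrable_pow_mul_log hf h0 hfz k)
    (circleIntegrable_pow_mul_log hg h0 hgz k)]
  refine Real.circleAverage_congr_sphere fun z hz => ?_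
  rw [abs_of_pos h0] at hz
  simp only
  rw [norm_mul, Real.log_mul (norm_ne_zero_iff.2 (hfz z hz)) (norm_ne_zero_iff.2 (hgz z hz))]
  push_cast; ring

lemma logMoment_prod (S : Finset ℂ) {ρ : ℝ} (h0 : 0 < ρ)
    (hS : ∀ a ∈ S, ‖a‖ ≠ ρ) (k : ℕ) :
    logMoment k (fun z => ∏ a ∈ S, (z - a)) ρ = ∑ a ∈ S, logMoment k (fun z => z - a) ρ := by
  classical
  induction S using Finset.induction_on with
  | empty => simp [logMoment, Real.circleAverage_const]
  | insert a S ha ih =>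
    simp_rw [Finset.prod_insert ha]
    have hne : ∀ b ∈ insert a S, ∀ z ∈ Metric.sphere (0 : ℂ) ρ, z - b ≠ 0 := by
      intro b hb z hz h
      rw [sub_eq_zero] at h
      exact hS _ hb (h ▸ mem_sphere_zero_iff_norm.1 hz)
    rw [logMoment_mul (by fun_prop) (by fun_prop) h0 (hne a (Finset.mem_insert_self a S))
      (fun z hz => Finset.prod_ne_zero_iff.2 fun b hb => hne b (Finset.mem_insert_of_mem hb) z hz),
      ih fun b hb => hS b (Finset.mem_insert_of_mem hb), Finset.sum_insert ha]

lemma logMoment_pow (m : ℕ) (k : ℕ) (ρ : ℝ) :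
    logMoment k (fun z => z ^ m) ρ = m * logMoment k (fun z => z - 0) ρ := by
  unfold logMoment
  rw [← smul_eq_mul (m : ℂ), ← Real.circleAverage_fun_smul]
  congr 1
  ext z
  simp only [norm_pow, Real.log_pow, sub_zero, smul_eq_mul]
  push_cast; ring

/-! ### Radial means and the linear statistic -/

/-- The average over `t ∈ [0, 1]` of the logarithmic moments over circles of radius `L * exp t`. -/
def radialMean (k : ℕ) (f : ℂ → ℂ) (L : ℝ) : ℂ :=
  ∫ t in (0 : ℝ)..1, logMoment k f (L * Real.exp t)

/-- Radial averaging makes circles that pass through a zero negligible. -/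
lemma ae_mul_exp_ne {L : ℝ} (hL : 0 < L) (S : Set ℝ) (hS : S.Countable) :
    ∀ᵐ t : ℝ, L * Real.exp t ∉ S := by
  have : ((fun t => L * Real.exp t) ⁻¹' S).Countable := by
    refine hS.preimage fun x y hxy => ?_
    exact Real.exp_injective (mul_left_cancel₀ hL.ne' hxy)
  exact this.ae_notMem _

/-- Explicit continuous formulas hold for radii below and above |a|; only the one radius |a| is
excluded. -/
lemma intervalIntegrable_logMoment_sub (k : ℕ) (a : ℂ) {L : ℝ} (hL : 0 < L) :
    IntervalIntegrable (fun t => logMoment k (fun z => z - a) (L * Real.exp t)) volume 0 1 := by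
  obtain ⟨κ, hκ⟩ := exists_logMoment_eq_of_ne_zero (g := fun z => z - a) (by fun_prop) (R := ‖a‖)
    (fun z hz h => by
      rw [sub_eq_zero] at h
      subst h
      exact lt_irrefl _ (mem_ball_zero_iff.1 hz)) k
  set u : ℝ → ℂ := fun t => κ * ((L * Real.exp t : ℝ) : ℂ) ^ (2 * k) with hu
  set v : ℝ → ℂ := fun t => 0 ^ k * Real.log (L * Real.exp t) - a ^ k / (2 * k) with hv
  have hpos : ∀ t, 0 < L * Real.exp t := fun t => mul_pos hL (Real.exp_pos t)
  have cu : Continuous u := by fun_prop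
  have cv : Continuous v := by
    have : Continuous fun t => Real.log (L * Real.exp t) :=
      Continuous.log (by fun_prop) fun t => (hpos t).ne'
    fun_prop
  classical
  have hs : MeasurableSet {t : ℝ | L * Real.exp t < ‖a‖} :=
    measurableSet_lt (by fun_prop) measurable_const
  rw [intervalIntegrable_iff]
  have iu : IntegrableOn u (Set.uIoc 0 1) := (cu.intervalIntegrable 0 1).def'
  have iv : IntegrableOn v (Set.uIoc 0 1) := (cv.intervalIntegrable 0 1).def'
  refine Integrable.congr (Integrable.piecewise hs iu.integrableOn iv.integrableOn) ?_
  have hae := ae_restrict_of_ae (s := Set.uIoc 0 1) (ae_mul_exp_ne hL {‖a‖} (Set.countable_singleton _))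
  filter_upwards [hae] with t ht
  rcases lt_or_ge (L * Real.exp t) ‖a‖ with h | h
  · rw [Set.piecewise_eq_of_mem {t : ℝ | L * Real.exp t < ‖a‖} u v h, hκ _ (hpos t) h]
  · rw [Set.piecewise_eq_of_notMem {t : ℝ | L * Real.exp t < ‖a‖} u v (not_lt.2 h), logMoment_sub_of_norm_lt]
    exact lt_of_le_of_ne h fun h' => ht h'.symm

lemma exists_radialMean_eq_of_ne_zero {g : ℂ → ℂ} (hg : Differentiable ℂ g) {R : ℝ}
    (h0 : ∀ z ∈ Metric.ball (0 : ℂ) R, g z ≠ 0) (k : ℕ) :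
    ∃ κ : ℂ, ∀ L, 0 < L → L * Real.exp 1 < R → radialMean k g L = κ * L ^ (2 * k) := by
  obtain ⟨κ, hκ⟩ := exists_logMoment_eq_of_ne_zero hg h0 k
  refine ⟨κ * ∫ t in (0 : ℝ)..1, ((Real.exp t ^ (2 * k) : ℝ) : ℂ), fun L hL hLR => ?_⟩
  unfold radialMean
  rw [mul_assoc, mul_comm (∫ t in (0 : ℝ)..1, ((Real.exp t ^ (2 * k) : ℝ) : ℂ)), ← mul_assoc,
    ← intervalIntegral.integral_const_mul]
  refine intervalIntegral.integral_congr fun t ht => ?_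
  rw [Set.uIcc_of_le zero_le_one] at ht
  rw [hκ _ (mul_pos hL (Real.exp_pos t))]
  · push_cast; ring
  · exact lt_of_le_of_lt (by gcongr; exact ht.2) hLR

/-- The weight of the inner annulus in `linearStat`. -/
def innerWeight (k : ℕ) : ℝ :=
  -- The weights solve w_out e^(2k) + w_in = 0, which removes zero-free factors. The normalization
  -- is w_out + w_in = -2k for k > 0, and w_out = 1 for k = 0, where log(eρ) - log ρ = 1; it makes
  -- an inner zero count a^k.
  if k = 0 then -1 else -(2 * k) / (1 - Real.exp (-(2 * k)))

/-- The weight of the outer annulus in `linearStat`. -/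
def outerWeight (k : ℕ) : ℝ :=
  -innerWeight k * Real.exp (-(2 * k))

/-- A linear combination of radial means that only sees the zeros of `f` in a bounded region. -/
def linearStat (k : ℕ) (f : ℂ → ℂ) (L : ℝ) : ℂ :=
  outerWeight k * radialMean k f (Real.exp 1 * L) + innerWeight k * radialMean k f L

lemma weights_cancel (k : ℕ) (L : ℝ) (κ : ℂ) :
    outerWeight k * (κ * ((Real.exp 1 * L : ℝ) : ℂ) ^ (2 * k)) + innerWeight k * (κ * L ^ (2 * k))
      = 0 := by
  have h1 : outerWeight k * Real.exp 1 ^ (2 * k) + innerWeight k = 0 := by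
    unfold outerWeight
    rw [← Real.exp_nat_mul, mul_assoc, ← Real.exp_add]
    push_cast
    rw [mul_one, neg_add_cancel, Real.exp_zero]
    ring
  have h2 : (outerWeight k : ℂ) * (Real.exp 1 : ℂ) ^ (2 * k) + innerWeight k = 0 := by
    exact_mod_cast h1
  rw [Complex.ofReal_mul, mul_pow]
  linear_combination κ * L ^ (2 * k) * h2

lemma weights_inside (k : ℕ) {ρ : ℝ} (hρ : 0 < ρ) (a : ℂ) :
    outerWeight k * (0 ^ k * (Real.log (Real.exp 1 * ρ) : ℂ) - a ^ k / (2 * k))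
      + innerWeight k * (0 ^ k * (Real.log ρ : ℂ) - a ^ k / (2 * k)) = a ^ k := by
  rcases Nat.eq_zero_or_pos k with rfl | hk
  · have : Real.log (Real.exp 1 * ρ) = 1 + Real.log ρ := by
      rw [Real.log_mul (Real.exp_pos 1).ne' hρ.ne', Real.log_exp]
    rw [this]
    simp [outerWeight, innerWeight]
  · have hk' : (0 : ℝ) < k := by exact_mod_cast hk
    have hne : 1 - Real.exp (-(2 * k)) ≠ 0 := by
      have : Real.exp (-(2 * k)) < 1 := Real.exp_lt_one_iff.2 (by linarith)
      linarith
    have h1 : outerWeight k + innerWeight k = -(2 * k) := by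
      unfold outerWeight innerWeight
      rw [if_neg hk.ne']
      field_simp
      ring
    have h2 : (outerWeight k : ℂ) + innerWeight k = -(2 * k) := by exact_mod_cast h1
    have hk2 : (k : ℂ) ≠ 0 := by exact_mod_cast hk.ne'
    rw [zero_pow hk.ne', zero_mul, zero_mul, zero_sub]
    have h3 : (outerWeight k : ℂ) * -(a ^ k / (2 * k)) + innerWeight k * -(a ^ k / (2 * k))
        = ((outerWeight k : ℂ) + innerWeight k) * -(a ^ k / (2 * k)) := by ring
    rw [h3, h2]
    field_simp

lemma linearStat_sub_of_norm_lt (k : ℕ) {a : ℂ} {L : ℝ} (ha : ‖a‖ < L) :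
    linearStat k (fun z => z - a) L = a ^ k := by
  have hL : 0 < L := (norm_nonneg a).trans_lt ha
  have hL' : 0 < Real.exp 1 * L := mul_pos (Real.exp_pos 1) hL
  unfold linearStat radialMean
  rw [← intervalIntegral.integral_const_mul, ← intervalIntegral.integral_const_mul,
    ← intervalIntegral.integral_add]
  · have : ∀ t ∈ Set.uIcc (0 : ℝ) 1,
        (outerWeight k : ℂ) * logMoment k (fun z => z - a) (Real.exp 1 * L * Real.exp t)
          + innerWeight k * logMoment k (fun z => z - a) (L * Real.exp t) = a ^ k := by
      intro t ht
      rw [Set.uIcc_of_le zero_le_one] at ht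
      have h1 : ‖a‖ < L * Real.exp t :=
        ha.trans_le (le_mul_of_one_le_right hL.le (Real.one_le_exp ht.1))
      have h2 : ‖a‖ < Real.exp 1 * L * Real.exp t := by
        refine h1.trans_le ?_
        rw [mul_assoc]
        exact le_mul_of_one_le_left (by positivity) (Real.one_le_exp (by norm_num))
      rw [logMoment_sub_of_norm_lt h1, logMoment_sub_of_norm_lt h2, mul_assoc]
      exact weights_inside k (by positivity) a
    rw [intervalIntegral.integral_congr this]
    simp
  · exact (intervalIntegrable_logMoment_sub k a hL').const_mul _
  · exact (intervalIntegrable_logMoment_sub k a hL).const_mul _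

/-- The outer annulus starts at radius eL and ends at e²L, hence the two factors `Real.exp 1`. -/
lemma linearStat_eq_zero_of_ne_zero (k : ℕ) {g : ℂ → ℂ} (hg : Differentiable ℂ g) {R : ℝ}
    (h0 : ∀ z ∈ Metric.ball (0 : ℂ) R, g z ≠ 0) {L : ℝ} (hL : 0 < L) (hR : Real.exp 1 * L * Real.exp 1 < R) :
    linearStat k g L = 0 := by
  obtain ⟨κ, hκ⟩ := exists_radialMean_eq_of_ne_zero hg h0 k
  have h1 : L * Real.exp 1 < R := by
    refine lt_of_le_of_lt ?_ hR
    rw [mul_assoc]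
    exact le_mul_of_one_le_left (by positivity) (Real.one_le_exp (by norm_num))
  unfold linearStat
  rw [hκ _ (by positivity) hR, hκ _ hL h1]
  exact weights_cancel k L κ

lemma radialMean_factor (k m : ℕ) (S : Finset ℂ) {g : ℂ → ℂ} (hg : Differentiable ℂ g) {R : ℝ}
    (h0 : ∀ z ∈ Metric.ball (0 : ℂ) R, g z ≠ 0) {L : ℝ} (hL : 0 < L) (hR : L * Real.exp 1 < R) :
    radialMean k (fun z => z ^ m * ((∏ a ∈ S, (z - a)) * g z)) L
      = m * radialMean k (fun z => z - 0) L + (∑ a ∈ S, radialMean k (fun z => z - a) L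
        + radialMean k g L) := by
  have hpos : ∀ t, 0 < L * Real.exp t := fun t => mul_pos hL (Real.exp_pos t)
  have hlt : ∀ t ∈ Set.Icc (0 : ℝ) 1, L * Real.exp t < R := fun t ht =>
    lt_of_le_of_lt (by gcongr; exact ht.2) hR
  obtain ⟨κ, hκ⟩ := exists_logMoment_eq_of_ne_zero hg h0 k
  have ig : IntervalIntegrable (fun t => logMoment k g (L * Real.exp t)) volume 0 1 := by
    have : IntervalIntegrable (fun t => κ * ((L * Real.exp t : ℝ) : ℂ) ^ (2 * k)) volume 0 1 :=
      (by fun_prop : Continuous fun t => κ * ((L * Real.exp t : ℝ) : ℂ) ^ (2 * k)).intervalIntegrable _ _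
    refine IntervalIntegrable.congr (fun t ht => ?_) this
    rw [Set.uIoc_of_le zero_le_one] at ht
    exact (hκ _ (hpos t) (hlt t (Set.Ioc_subset_Icc_self ht))).symm
  have i0 := (intervalIntegrable_logMoment_sub k 0 hL).const_mul (m : ℂ)
  have iS : IntervalIntegrable (fun t => ∑ a ∈ S, logMoment k (fun z => z - a) (L * Real.exp t))
      volume 0 1 := by
    have := IntervalIntegrable.sum S (fun a _ => intervalIntegrable_logMoment_sub k a hL)
    convert! this using 1
    ext t; simp
  unfold radialMean
  rw [← intervalIntegral.integral_finsetSum (fun a _ => intervalIntegrable_logMoment_sub k a hL),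
    ← intervalIntegral.integral_add iS ig, ← intervalIntegral.integral_const_mul,
    ← intervalIntegral.integral_add i0 (iS.add ig)]
  refine intervalIntegral.integral_congr_ae ?_
  filter_upwards [ae_mul_exp_ne hL (norm '' (S : Set ℂ)) (S.countable_toSet.image _)] with t ht ht2
  rw [Set.uIoc_of_le zero_le_one] at ht2
  have htI : t ∈ Set.Icc (0 : ℝ) 1 := Set.Ioc_subset_Icc_self ht2
  have hS : ∀ a ∈ S, ‖a‖ ≠ L * Real.exp t := fun a ha h => ht ⟨a, ha, h⟩
  have hSne : ∀ z ∈ Metric.sphere (0 : ℂ) (L * Real.exp t), ∏ a ∈ S, (z - a) ≠ 0 := by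
    intro z hz
    refine Finset.prod_ne_zero_iff.2 fun a ha h => ?_
    rw [sub_eq_zero] at h
    subst h
    exact hS _ ha (mem_sphere_zero_iff_norm.1 hz)
  have hgne : ∀ z ∈ Metric.sphere (0 : ℂ) (L * Real.exp t), g z ≠ 0 := fun z hz => h0 z (by
    rw [mem_ball_zero_iff, mem_sphere_zero_iff_norm.1 hz]; exact hlt t htI)
  have hzne : ∀ z ∈ Metric.sphere (0 : ℂ) (L * Real.exp t), z ^ m ≠ 0 := fun z hz =>
    pow_ne_zero _ (by rintro rfl; exact (hpos t).ne (by simpa using mem_sphere_zero_iff_norm.1 hz))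
  have hgc := hg.continuous
  rw [logMoment_mul (f := fun z => z ^ m) (g := fun z => (∏ a ∈ S, (z - a)) * g z) (by fun_prop)
      (by fun_prop) (hpos t) hzne (fun z hz => mul_ne_zero (hSne z hz) (hgne z hz)),
    logMoment_mul (f := fun z => ∏ a ∈ S, (z - a)) (g := g) (by fun_prop) hgc (hpos t) hSne hgne,
    logMoment_pow, logMoment_prod S (hpos t) hS]

/-- The zeros in a disc slightly larger than |z| ≤ e²L are divided out and the cofactor contributes
nothing. Simplicity permits a product over a set of zeros; only the origin carries a multiplicity.
-/
lemma linearStat_eq_sum_zeros (k m : ℕ) {f g : ℂ → ℂ} (hg : Differentiable ℂ g)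
    (hfg : ∀ z, f z = z ^ m * g z) (hg0 : g 0 ≠ 0) (hsimple : ∀ z, g z = 0 → deriv g z ≠ 0)
    {L : ℝ} (hL : 0 < L) :
    linearStat k f L = m * 0 ^ k + ∑ᶠ a ∈ g ⁻¹' {0}, linearStat k (fun z => z - a) L := by
  classical
  set R := Real.exp 1 * L * Real.exp 1 + 1 with hRdef
  have hfin := finite_inter_zeros hg hg0 (isCompact_closedBall (0 : ℂ) R)
  set S := hfin.toFinset with hS
  have hSmem : ∀ a, a ∈ S ↔ a ∈ Metric.closedBall (0 : ℂ) R ∧ g a = 0 := by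
    intro a; rw [hS, Set.Finite.mem_toFinset]; simp
  obtain ⟨g₁, hg₁, hgg₁⟩ := exists_eq_prod_mul hg S fun a ha => ((hSmem a).1 ha).2
  have hg₁ne : ∀ z ∈ Metric.ball (0 : ℂ) R, g₁ z ≠ 0 := by
    intro a ha h
    have hga : g a = 0 := by rw [hgg₁, h, mul_zero]
    have haS : a ∈ S := (hSmem a).2 ⟨Metric.ball_subset_closedBall ha, hga⟩
    refine hsimple a hga ?_
    -- If the cofactor vanished at a root already divided out, the root would be double and the
    -- derivative of g would vanish there.
    have h1 : g = fun z => (z - a) * ((∏ b ∈ S.erase a, (z - b)) * g₁ z) := by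
      ext z
      rw [hgg₁, ← Finset.mul_prod_erase S _ haS, mul_assoc]
    have h2 : HasDerivAt (fun z => (z - a) * ((∏ b ∈ S.erase a, (z - b)) * g₁ z))
        (1 * ((∏ b ∈ S.erase a, (a - b)) * g₁ a) + (a - a) *
          deriv (fun z => (∏ b ∈ S.erase a, (z - b)) * g₁ z) a) a := by
      refine ((hasDerivAt_id a).sub_const a).mul (DifferentiableAt.hasDerivAt ?_)
      exact DifferentiableAt.mul (by fun_prop) (hg₁ a)
    rw [h1, h2.deriv, h]
    simp
  have hR1 : Real.exp 1 * L * Real.exp 1 < R := by rw [hRdef]; linarith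
  have hR2 : L * Real.exp 1 < R := by
    refine lt_of_le_of_lt ?_ hR1
    rw [mul_assoc]
    exact le_mul_of_one_le_left (by positivity) (Real.one_le_exp (by norm_num))
  have hf : f = fun z => z ^ m * ((∏ a ∈ S, (z - a)) * g₁ z) := by
    ext z; rw [hfg, hgg₁]
  have h3 : linearStat k f L = m * linearStat k (fun z => z - 0) L
      + (∑ a ∈ S, linearStat k (fun z => z - a) L + linearStat k g₁ L) := by
    rw [hf]
    unfold linearStat
    rw [radialMean_factor k m S hg₁ hg₁ne (by positivity) hR1,
      radialMean_factor k m S hg₁ hg₁ne hL hR2, Finset.sum_add_distrib, ← Finset.mul_sum,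
      ← Finset.mul_sum]
    ring
  rw [h3, linearStat_eq_zero_of_ne_zero k hg₁ hg₁ne hL hR1, add_zero,
    linearStat_sub_of_norm_lt k (by simpa using hL)]
  congr 1
  -- Zeros outside the disc have zero contribution, so the sum over all zeros is finitely supported.
  refine (finsum_mem_eq_sum_of_subset _ ?_ ?_).symm
  · rintro a ⟨ha, ha2⟩
    by_contra hna
    have hna' : a ∉ S := hna
    rw [hSmem, not_and'] at hna'
    have h4 : R < ‖a‖ := by simpa using hna' ha
    refine ha2 (linearStat_eq_zero_of_ne_zero k (by fun_prop) (R := R) ?_ hL hR1)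
    intro z hz h
    rw [sub_eq_zero] at h
    subst h
    rw [mem_ball_zero_iff] at hz
    linarith
  · intro a ha
    exact ((hSmem a).1 ha).2

/-! ### Consequences of admissibility: convexity and circle integrals -/

namespace IsAdmissible

variable {G : ℂ → ℂ}

lemma ofReal_re (hG : IsAdmissible G) (r : ℝ) : (((G r).re : ℝ) : ℂ) = G r :=
  Complex.ext (by simp) (by simp [hG.real_on_reals r])

lemma norm_eq_re (hG : IsAdmissible G) {r : ℝ} (hr : 0 < (G r).re) : ‖G r‖ = (G r).re := by
  rw [← hG.ofReal_re, Complex.norm_of_nonneg hr.le, Complex.ofReal_re]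

lemma hasDerivAt_haymanA (hG : IsAdmissible G) {r : ℝ} (hr : 0 < (G r).re) :
    HasDerivAt (haymanA G) (deriv (haymanA G) r) r := by
  have h0 : G r ≠ 0 := by rw [← hG.ofReal_re]; exact_mod_cast hr.ne'
  have h1 : DifferentiableAt ℂ (fun z => z * deriv G z / G z) r := by
    have := (hG.entire.analyticAt (r : ℂ)).deriv.differentiableAt
    exact (differentiableAt_id.mul this).div (hG.entire _) h0
  exact h1.hasDerivAt.real_of_complex.differentiableAt.hasDerivAt

lemma hasDerivAt_log_exp (hG : IsAdmissible G) {x : ℝ} (hx : 0 < (G (Real.exp x : ℝ)).re) :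
    HasDerivAt (fun x => Real.log (G (Real.exp x : ℝ)).re) (haymanA G (Real.exp x)) x := by
  have h1 := ((hG.entire (Real.exp x : ℝ)).hasDerivAt.real_of_complex).comp x (Real.hasDerivAt_exp x)
  have h2 := h1.log hx.ne'
  convert! h2 using 1
  unfold haymanA
  have h3 : G (Real.exp x : ℝ) = (((G (Real.exp x : ℝ)).re : ℝ) : ℂ) := (hG.ofReal_re _).symm
  rw [h3, Complex.div_ofReal_re, Complex.re_ofReal_mul]
  simp only [Function.comp_apply]
  ring

lemma hasDerivAt_haymanA_exp (hG : IsAdmissible G) {x : ℝ} (hx : 0 < (G (Real.exp x : ℝ)).re) :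
    HasDerivAt (fun x => haymanA G (Real.exp x)) (haymanB G (Real.exp x)) x := by
  have h1 := (hG.hasDerivAt_haymanA hx).comp x (Real.hasDerivAt_exp x)
  convert! h1 using 1
  unfold haymanB
  ring

/-- The function log G(e^x) has derivative a(e^x) and second derivative b(e^x) ≥ M, so subtracting
Mx²/2 leaves a convex function; the quadratic gain is the defect in the midpoint inequality. -/
lemma log_midpoint_le (hG : IsAdmissible G) (hpos : ∀ r : ℝ, 0 < r → 0 < (G r).re) {M x₀ : ℝ}
    (hM : ∀ r, Real.exp x₀ ≤ r → M ≤ haymanB G r) {x y : ℝ} (hx : x₀ ≤ x) (hy : x₀ ≤ y) :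
    Real.log (G (Real.exp ((x + y) / 2) : ℝ)).re ≤
      (Real.log (G (Real.exp x : ℝ)).re + Real.log (G (Real.exp y : ℝ)).re) / 2
        - M * (x - y) ^ 2 / 8 := by
  have hp : ∀ x, 0 < (G (Real.exp x : ℝ)).re := fun x => hpos _ (Real.exp_pos x)
  have d1 : ∀ x, HasDerivAt (fun x => Real.log (G (Real.exp x : ℝ)).re - M * x ^ 2 / 2)
      (haymanA G (Real.exp x) - M * x) x := by
    intro x
    convert! (hG.hasDerivAt_log_exp (hp x)).sub (((hasDerivAt_pow 2 x).const_mul M).div_const 2)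
      using 1
    simp; ring
  have d2 : ∀ x, HasDerivAt (fun x => haymanA G (Real.exp x) - M * x)
      (haymanB G (Real.exp x) - M) x := by
    intro x
    convert! (hG.hasDerivAt_haymanA_exp (hp x)).sub ((hasDerivAt_id x).const_mul M) using 1
    simp
  have hconv : ConvexOn ℝ (Set.Ici x₀)
      (fun x => Real.log (G (Real.exp x : ℝ)).re - M * x ^ 2 / 2) := by
    refine convexOn_of_hasDerivWithinAt2_nonneg (convex_Ici x₀)
      (fun x _ => (d1 x).continuousAt.continuousWithinAt)
      (fun x _ => (d1 x).hasDerivWithinAt) (fun x _ => (d2 x).hasDerivWithinAt) fun x hx => ?_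
    rw [interior_Ici] at hx
    linarith [hM (Real.exp x) (Real.exp_le_exp.2 (le_of_lt hx))]
  have h := hconv.2 (Set.mem_Ici.2 hx) (Set.mem_Ici.2 hy) (by norm_num : (0 : ℝ) ≤ 1 / 2)
    (by norm_num : (0 : ℝ) ≤ 1 / 2) (by norm_num)
  simp only [smul_eq_mul] at h
  rw [show 1 / 2 * x + 1 / 2 * y = (x + y) / 2 by ring] at h
  nlinarith [h]

lemma re_midpoint_le (hG : IsAdmissible G) (hpos : ∀ r : ℝ, 0 < r → 0 < (G r).re) {M x₀ : ℝ}
    (hM : ∀ r, Real.exp x₀ ≤ r → M ≤ haymanB G r) {x y : ℝ} (hx : x₀ ≤ x) (hy : x₀ ≤ y) :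
    (G (Real.exp ((x + y) / 2) : ℝ)).re ≤
      √((G (Real.exp x : ℝ)).re * (G (Real.exp y : ℝ)).re) * Real.exp (-(M * (x - y) ^ 2 / 8)) := by
  have hp : ∀ x, 0 < (G (Real.exp x : ℝ)).re := fun x => hpos _ (Real.exp_pos x)
  have h := hG.log_midpoint_le hpos hM hx hy
  have h1 : 0 < √((G (Real.exp x : ℝ)).re * (G (Real.exp y : ℝ)).re) :=
    Real.sqrt_pos.2 (mul_pos (hp x) (hp y))
  rw [← Real.log_le_log_iff (hp _) (mul_pos h1 (Real.exp_pos _)),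
    Real.log_mul h1.ne' (Real.exp_pos _).ne', Real.log_exp, Real.log_sqrt
    (mul_pos (hp x) (hp y)).le, Real.log_mul (hp x).ne' (hp y).ne']
  linarith

/-- Near the positive axis |G| is at most twice a Gaussian in θ of width 1/√b, and elsewhere it is
at most G(r)/√b. Both asymptotic statements are needed only with ε = 1. -/
lemma exists_integral_norm_le (hG : IsAdmissible G) : ∃ C r₀ : ℝ, 0 ≤ C ∧ ∀ r, r₀ ≤ r →
    ∫ θ in -Real.pi..Real.pi, ‖G (circleMap 0 r θ)‖ ≤ C * (‖G r‖ / √(haymanB G r)) := by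
  obtain ⟨δ, hδ, hnear, hfar⟩ := hG.exists_delta
  have hev := ((hnear 1 one_pos).and (hfar 1 one_pos)).and (hG.tendsto_b.eventually_gt_atTop 0)
  obtain ⟨r₀, hr₀⟩ := eventually_atTop.1 hev
  refine ⟨2 * √(2 * Real.pi) + 2 * Real.pi, r₀, by positivity, fun r hr => ?_⟩
  obtain ⟨⟨h1, h2⟩, hb⟩ := hr₀ r hr
  set b := haymanB G r with hbdef
  have hsb : 0 < √b := Real.sqrt_pos.2 hb
  have hpt : ∀ θ ∈ Set.Icc (-Real.pi) Real.pi, ‖G (circleMap 0 r θ)‖ ≤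
      ‖G r‖ * (2 * Real.exp (-(b / 2) * θ ^ 2) + 1 / √b) := by
    intro θ hθ
    have hcm : circleMap 0 r θ = r * Complex.exp (θ * Complex.I) := by simp [circleMap]
    rw [hcm]
    rcases le_or_gt |θ| (δ r) with h | h
    · have h3 := h1 θ h
      rw [one_mul] at h3
      have h4 : ‖Complex.exp (Complex.I * θ * haymanA G r - θ ^ 2 * b / 2)‖
          = Real.exp (-(b / 2) * θ ^ 2) := by
        rw [Complex.norm_exp]
        congr 1
        rw [show Complex.I * θ * haymanA G r - θ ^ 2 * b / 2
          = ((-(b / 2) * θ ^ 2 : ℝ) : ℂ) + ((θ * haymanA G r : ℝ) : ℂ) * Complex.I by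
            push_cast; ring]
        simp [-Complex.ofReal_mul, -Complex.ofReal_neg, -Complex.ofReal_pow, -Complex.ofReal_div]
      have h5 := norm_sub_norm_le (G (r * Complex.exp (θ * Complex.I)))
        (G r * Complex.exp (Complex.I * θ * haymanA G r - θ ^ 2 * b / 2))
      rw [norm_mul, h4] at h3 h5
      have h6 : 0 ≤ ‖G r‖ * (1 / √b) := by positivity
      linarith
    · have h3 := h2 θ h.le (abs_le.2 hθ)
      have h6 : 0 ≤ ‖G r‖ * (2 * Real.exp (-(b / 2) * θ ^ 2)) := by positivity
      rw [one_mul] at h3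
      have h7 : ‖G r‖ * (1 / √b) = ‖G r‖ / √b := by ring
      linarith
  have hgi : Integrable (fun θ : ℝ => Real.exp (-(b / 2) * θ ^ 2)) :=
    integrable_exp_neg_mul_sq (by positivity)
  have hgle : ∫ θ in -Real.pi..Real.pi, Real.exp (-(b / 2) * θ ^ 2) ≤ √(2 * Real.pi) / √b := by
    rw [intervalIntegral.integral_of_le (by linarith [Real.pi_pos])]
    refine (setIntegral_le_integral hgi (Eventually.of_forall fun θ => (Real.exp_pos _).le)).trans ?_
    rw [integral_gaussian, ← Real.sqrt_div (by positivity)]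
    apply le_of_eq; congr 1; field_simp
  calc _ ≤ ∫ θ in -Real.pi..Real.pi, ‖G r‖ * (2 * Real.exp (-(b / 2) * θ ^ 2) + 1 / √b) := by
        have hc := hG.entire.continuous
        refine intervalIntegral.integral_mono_on (by linarith [Real.pi_pos])
          (Continuous.intervalIntegrable (by fun_prop) _ _)
          (Continuous.intervalIntegrable (by fun_prop) _ _) hpt
    _ = ‖G r‖ * (2 * ∫ θ in -Real.pi..Real.pi, Real.exp (-(b / 2) * θ ^ 2))
        + ‖G r‖ * (2 * Real.pi * (1 / √b)) := by
        rw [intervalIntegral.integral_const_mul, intervalIntegral.integral_add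
          (Continuous.intervalIntegrable (by fun_prop) _ _) intervalIntegrable_const,
          intervalIntegral.integral_const_mul, intervalIntegral.integral_const, smul_eq_mul]
        ring
    _ ≤ ‖G r‖ * (2 * (√(2 * Real.pi) / √b)) + ‖G r‖ * (2 * Real.pi * (1 / √b)) := by gcongr
    _ = _ := by ring

end IsAdmissible

/-! ### Integrating the normalized kernel over an annulus -/

/-- The uniform measure on the rectangle parametrizing an annulus in logarithmic polar
coordinates. -/
def annulusMeasure : Measure (ℝ × ℝ) :=
  (volume.restrict (Set.Ioc 0 1)).prod (volume.restrict (Set.Ioc 0 (2 * Real.pi)))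

instance isFiniteMeasure_annulusMeasure : IsFiniteMeasure annulusMeasure := by
  unfold annulusMeasure; infer_instance

/-- The point of the annulus of inner radius `L` with logarithmic polar coordinates `τ`. -/
def annulusPoint (L : ℝ) (τ : ℝ × ℝ) : ℂ :=
  circleMap 0 (L * Real.exp τ.1) τ.2

lemma continuous_annulusPoint (L : ℝ) : Continuous (annulusPoint L) := by
  unfold annulusPoint circleMap; fun_prop

lemma norm_annulusPoint {L : ℝ} (hL : 0 < L) (τ : ℝ × ℝ) :
    ‖annulusPoint L τ‖ = L * Real.exp τ.1 := by
  simp [annulusPoint, abs_of_pos hL]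

lemma annulusPoint_mul_conj (L : ℝ) (τ σ : ℝ × ℝ) :
    annulusPoint L τ * conj (annulusPoint L σ)
      = circleMap 0 (L ^ 2 * Real.exp (τ.1 + σ.1)) (τ.2 - σ.2) := by
  simp only [annulusPoint, circleMap, zero_add, map_mul, Complex.conj_ofReal, ← Complex.exp_conj,
    Complex.conj_I, Real.exp_add]
  rw [Complex.ofReal_sub, sub_mul, Complex.exp_sub, mul_neg, Complex.exp_neg]
  push_cast
  ring

/-- The modulus of the normalized kernel. -/
def normalizedKernel (G : ℂ → ℂ) (z w : ℂ) : ℝ :=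
  ‖G (z * conj w)‖ / √((G (‖z‖ ^ 2 : ℝ)).re * (G (‖w‖ ^ 2 : ℝ)).re)

lemma integral_circleMap_sub_eq {F : ℂ → ℝ} (r s : ℝ) :
    ∫ θ in (0 : ℝ)..2 * Real.pi, F (circleMap 0 r (θ - s)) =
      ∫ θ in -Real.pi..Real.pi, F (circleMap 0 r θ) := by
  have hper : Function.Periodic (fun θ => F (circleMap 0 r θ)) (2 * Real.pi) :=
    (periodic_circleMap 0 r).comp F
  rw [intervalIntegral.integral_comp_sub_right (fun θ => F (circleMap 0 r θ))]
  have := hper.intervalIntegral_add_eq (0 - s) (-Real.pi)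
  rw [show 0 - s + 2 * Real.pi = 2 * Real.pi - s by ring,
    show -Real.pi + 2 * Real.pi = Real.pi by ring] at this
  exact this

/-- At fixed radii the angular integral gives C/√M times exp(-M(t - s)²/2), by
`exists_integral_norm_le` and `re_midpoint_le`; the integral over t then contributes √(2π/M). -/
lemma IsAdmissible.exists_lintegral_normalizedKernel_le {G : ℂ → ℂ} (hG : IsAdmissible G)
    (hpos : ∀ r : ℝ, 0 < r → 0 < (G r).re) :
    ∃ C r₀ : ℝ, 0 ≤ C ∧ ∀ L M : ℝ, 0 < L → r₀ ≤ L ^ 2 → 0 < M →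
      (∀ r, L ^ 2 ≤ r → M ≤ haymanB G r) → ∀ σ : ℝ × ℝ, 0 ≤ σ.1 →
      ∫⁻ τ, ENNReal.ofReal (normalizedKernel G (annulusPoint L τ) (annulusPoint L σ))
        ∂annulusMeasure ≤ ENNReal.ofReal (C / M) := by
  obtain ⟨C, r₀, hC, hint⟩ := hG.exists_integral_norm_le
  refine ⟨C * √(2 * Real.pi), r₀, by positivity, fun L M hL hLr hM hMb σ hσ => ?_⟩
  have hc := hG.entire.continuous
  -- Chosen so that e^(x t) = |z|²; the midpoint of two such values is then log|z conj(w)|, and M(x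
  -- - y)²/8 becomes M(t - s)²/2.
  set x : ℝ → ℝ := fun t => 2 * Real.log L + 2 * t with hx
  have hex : ∀ t, Real.exp (x t) = (L * Real.exp t) ^ 2 := by
    intro t
    rw [hx]
    simp only
    rw [Real.exp_add, mul_pow, two_mul, Real.exp_add, Real.exp_log hL, two_mul, Real.exp_add]
    ring
  have hexm : ∀ t, Real.exp ((x t + x σ.1) / 2) = L ^ 2 * Real.exp (t + σ.1) := by
    intro t
    rw [hx]
    simp only
    rw [show (2 * Real.log L + 2 * t + (2 * Real.log L + 2 * σ.1)) / 2
      = Real.log L + Real.log L + (t + σ.1) by ring, Real.exp_add, Real.exp_add, Real.exp_log hL]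
    ring
  have hx0 : Real.exp (2 * Real.log L) = L ^ 2 := by
    rw [two_mul, Real.exp_add, Real.exp_log hL]; ring
  have hθ : ∀ t, 0 ≤ t → ∫⁻ θ in Set.Ioc 0 (2 * Real.pi),
      ENNReal.ofReal (normalizedKernel G (annulusPoint L (t, θ)) (annulusPoint L σ))
      ≤ ENNReal.ofReal (C / √M * Real.exp (-(M / 2) * (t - σ.1) ^ 2)) := by
    intro t ht
    have hr : L ^ 2 ≤ L ^ 2 * Real.exp (t + σ.1) :=
      le_mul_of_one_le_right (by positivity) (Real.one_le_exp (by linarith))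
    set r := L ^ 2 * Real.exp (t + σ.1) with hrdef
    have hr0 : 0 < r := by positivity
    set D := √((G (Real.exp (x t) : ℝ)).re * (G (Real.exp (x σ.1) : ℝ)).re) with hD
    have hDpos : 0 < D := Real.sqrt_pos.2 (mul_pos (hpos _ (Real.exp_pos _)) (hpos _ (Real.exp_pos _)))
    have hker : ∀ θ, normalizedKernel G (annulusPoint L (t, θ)) (annulusPoint L σ)
        = ‖G (circleMap 0 r (θ - σ.2))‖ / D := by
      intro θ
      unfold normalizedKernel
      rw [annulusPoint_mul_conj, norm_annulusPoint hL, norm_annulusPoint hL, hD, hex, hex]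
    simp_rw [hker]
    rw [← ofReal_integral_eq_lintegral_ofReal]
    · apply ENNReal.ofReal_le_ofReal
      rw [← intervalIntegral.integral_of_le Real.two_pi_pos.le, intervalIntegral.integral_div,
        integral_circleMap_sub_eq (F := fun z => ‖G z‖)]
      have h1 := hint r (hLr.trans hr)
      have h2 : (G (r : ℝ)).re ≤ D * Real.exp (-(M / 2) * (t - σ.1) ^ 2) := by
        have := hG.re_midpoint_le hpos (M := M) (x₀ := 2 * Real.log L) (fun r hr => hMb r (hx0 ▸ hr))
          (x := x t) (y := x σ.1) (by simp only [hx]; linarith) (by simp only [hx]; linarith)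
        rw [hexm] at this
        refine this.trans (le_of_eq ?_)
        congr 2
        simp only [hx]; ring
      have h3 : √M ≤ √(haymanB G r) := Real.sqrt_le_sqrt (hMb r hr)
      have hsM : 0 < √M := Real.sqrt_pos.2 hM
      rw [hG.norm_eq_re (hpos r hr0)] at h1
      rw [div_le_iff₀ hDpos]
      have hE := Real.exp_pos (-(M / 2) * (t - σ.1) ^ 2)
      calc _ ≤ C * ((G r).re / √(haymanB G r)) := h1
        _ ≤ C * (D * Real.exp (-(M / 2) * (t - σ.1) ^ 2) / √M) := by
            gcongr
        _ = _ := by ring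
    · exact (Continuous.integrableOn_Icc (by fun_prop)).mono_set Set.Ioc_subset_Icc_self
    · exact Eventually.of_forall fun θ => by positivity
  have hmeas : Measurable fun τ =>
      ENNReal.ofReal (normalizedKernel G (annulusPoint L τ) (annulusPoint L σ)) := by
    have h1 := (continuous_annulusPoint L)
    have h2 : Continuous fun r : ℝ => (G r).re := by fun_prop
    unfold normalizedKernel
    refine ENNReal.measurable_ofReal.comp (Measurable.div ?_ ?_)
    · exact Continuous.measurable (by fun_prop)
    · refine Continuous.measurable (Continuous.sqrt (Continuous.mul ?_ continuous_const))
      exact h2.comp (by fun_prop)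
  unfold annulusMeasure
  rw [lintegral_prod _ hmeas.aemeasurable]
  calc _ ≤ ∫⁻ t in Set.Ioc (0 : ℝ) 1, ENNReal.ofReal (C / √M * Real.exp (-(M / 2) * (t - σ.1) ^ 2)) :=
        setLIntegral_mono' measurableSet_Ioc fun t ht => hθ t ht.1.le
    _ ≤ ∫⁻ t, ENNReal.ofReal (C / √M * Real.exp (-(M / 2) * (t - σ.1) ^ 2)) :=
        setLIntegral_le_lintegral _ _
    _ = ENNReal.ofReal (∫ t, C / √M * Real.exp (-(M / 2) * (t - σ.1) ^ 2)) := by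
        rw [ofReal_integral_eq_lintegral_ofReal]
        · exact ((integrable_exp_neg_mul_sq (b := M / 2) (by positivity)).comp_sub_right σ.1).const_mul _
        · exact Eventually.of_forall fun t => by positivity
    _ = _ := by
        congr 1
        rw [integral_const_mul, integral_sub_right_eq_self
          (fun t => Real.exp (-(M / 2) * t ^ 2)), integral_gaussian,
          show Real.pi / (M / 2) = 2 * Real.pi / M by field_simp, Real.sqrt_div (by positivity)]
        have := Real.mul_self_sqrt hM.le
        have hsM : 0 < √M := Real.sqrt_pos.2 hM
        rw [div_mul_div_comm, this]

/-! ### Random power series and their covariance kernel -/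

section PowerSeries

variable {c : ℕ → ℂ}

lemma hasSum_mul_pow (hc : ∀ R : ℝ, 0 ≤ R → Summable fun n => ‖c n‖ * R ^ n) (z : ℂ) :
    HasSum (fun n => c n * z ^ n) (∑' n, c n * z ^ n) := by
  refine Summable.hasSum (Summable.of_norm ?_)
  simpa only [norm_mul, norm_pow] using hc ‖z‖ (norm_nonneg z)

lemma differentiable_tsum_mul_pow (hc : ∀ R : ℝ, 0 ≤ R → Summable fun n => ‖c n‖ * R ^ n) :
    Differentiable ℂ fun z => ∑' n, c n * z ^ n := by
  intro z
  have hd : DifferentiableOn ℂ (fun z => ∑' n, c n * z ^ n) (Metric.ball 0 (‖z‖ + 1)) := by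
    refine Complex.differentiableOn_tsum_of_summable_norm (hc (‖z‖ + 1) (by positivity))
      (fun n => by fun_prop) Metric.isOpen_ball fun n w hw => ?_
    rw [norm_mul, norm_pow]
    gcongr
    exact (mem_ball_zero_iff.1 hw).le
  refine (hd z ?_).differentiableAt (Metric.isOpen_ball.mem_nhds ?_) <;> simp

end PowerSeries

/-- Independent standard complex Gaussian coefficients `ξ` and weights `a` for which the random
power series `∑ ξₙ aₙ zⁿ` converges everywhere on the sample space. -/
structure GaussianCoefficients {Ω : Type*} [MeasurableSpace Ω] (P : Measure Ω) (a : ℕ → ℝ)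
    (ξ : ℕ → Ω → ℂ) : Prop where
  nonneg : ∀ n, 0 ≤ a n
  infinite : {n | a n ≠ 0}.Infinite
  measurable : ∀ n, Measurable (ξ n)
  law : ∀ n, P.map (ξ n) = stdComplexGaussian
  indep : iIndepFun ξ P
  summable_weights : ∀ R : ℝ, 0 ≤ R → Summable fun n => a n * R ^ n
  summable : ∀ ω, ∀ R : ℝ, 0 ≤ R → Summable fun n => ‖ξ n ω * a n‖ * R ^ n

/-- The random power series with coefficients `ξₙ aₙ`. -/
def gaussianSeries {Ω : Type*} (a : ℕ → ℝ) (ξ : ℕ → Ω → ℂ) (ω : Ω) (z : ℂ) : ℂ :=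
  ∑' n, ξ n ω * a n * z ^ n

lemma summable_mul_pow_of_tendsto {a : ℕ → ℝ} (h0 : ∀ n, 0 ≤ a n)
    (ha : Tendsto (fun n : ℕ => a n ^ (1 / (n : ℝ))) atTop (𝓝 0)) {R : ℝ} (hR : 0 ≤ R) :
    Summable fun n => a n * R ^ n := by
  have hpos : 0 < (2 * (R + 1))⁻¹ := by positivity
  have hev := (ha.eventually_lt_const hpos).and (eventually_ge_atTop 1)
  have hgeo : Summable fun n : ℕ => (1 / 2 : ℝ) ^ n :=
    summable_geometric_of_lt_one (by norm_num) (by norm_num)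
  refine Summable.of_norm_bounded_eventually_nat hgeo ?_
  filter_upwards [hev] with n hn
  have hn0 : (n : ℝ) ≠ 0 := by
    have : n ≠ 0 := by omega
    exact_mod_cast this
  have h1 : a n ≤ ((2 * (R + 1))⁻¹) ^ n := by
    calc a n = (a n ^ (1 / (n : ℝ))) ^ n := by
          rw [← Real.rpow_natCast, ← Real.rpow_mul (h0 n), one_div_mul_cancel hn0, Real.rpow_one]
      _ ≤ _ := by
          have := Real.rpow_nonneg (h0 n) (1 / (n : ℝ))
          gcongr
          exact hn.1.le
  rw [Real.norm_of_nonneg (mul_nonneg (h0 n) (by positivity))]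
  calc a n * R ^ n ≤ ((2 * (R + 1))⁻¹) ^ n * (R + 1) ^ n := by gcongr; linarith
    _ = (1 / 2) ^ n := by
        rw [← mul_pow]; congr 1; field_simp

/-- Finite first moments give ∑ |ξ_n| a_n N^n < ∞ almost surely for all N. On the exceptional null
set the coefficients are replaced by 0: the series then converges at every sample point, while laws
and independence are unchanged. -/
lemma IsGaussianEntireFunction.exists_gaussianCoefficients {Ω : Type*} [MeasurableSpace Ω]
    {P : Measure Ω} [IsProbabilityMeasure P] {f : Ω → ℂ → ℂ} (hf : IsGaussianEntireFunction P f) :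
    ∃ (a : ℕ → ℝ) (ξ : ℕ → Ω → ℂ), GaussianCoefficients P a ξ ∧
      ∀ᵐ ω ∂P, f ω = gaussianSeries a ξ ω := by
  obtain ⟨a, ξ, ha0, hainf, hatend, hm, hlaw, hind, hfeq⟩ := hf
  have hsum := fun R (hR : 0 ≤ R) => summable_mul_pow_of_tendsto ha0 hatend (R := R) hR
  set T : ℕ → Ω → ℝ≥0∞ := fun N ω => ∑' n, ‖ξ n ω‖ₑ * ENNReal.ofReal (a n * N ^ n) with hT
  have hTm : ∀ N, Measurable (T N) := fun N =>
    Measurable.tsum fun n => (hm n).enorm.mul_const _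
  have hTfin : ∀ N, ∀ᵐ ω ∂P, T N ω < ∞ := by
    intro N
    refine ae_lt_top (hTm N) ?_
    rw [hT]
    simp only
    rw [lintegral_tsum fun n => ((hm n).enorm.mul_const _).aemeasurable]
    have hK : ∫⁻ z, ‖z‖ₑ ∂stdComplexGaussian ≠ ∞ :=
      (memLp_id_stdComplexGaussian.integrable (by norm_num)).hasFiniteIntegral.ne
    have h1 : ∀ n, ∫⁻ ω, ‖ξ n ω‖ₑ * ENNReal.ofReal (a n * N ^ n) ∂P
        = (∫⁻ z, ‖z‖ₑ ∂stdComplexGaussian) * ENNReal.ofReal (a n * N ^ n) := by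
      intro n
      rw [lintegral_mul_const _ (hm n).enorm, ← hlaw n, lintegral_map (by fun_prop) (hm n)]
    simp_rw [h1]
    rw [ENNReal.tsum_mul_left]
    refine ENNReal.mul_ne_top hK ?_
    rw [← ENNReal.ofReal_tsum_of_nonneg (fun n => mul_nonneg (ha0 n) (by positivity))
      (hsum N (by positivity))]
    exact ENNReal.ofReal_ne_top
  set A : Set Ω := ⋂ N, {ω | T N ω < ∞} with hA
  have hAm : MeasurableSet A := MeasurableSet.iInter fun N => measurableSet_lt (hTm N) measurable_const
  have hAae : ∀ᵐ ω ∂P, ω ∈ A := by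
    rw [← ae_all_iff] at hTfin
    filter_upwards [hTfin] with ω hω
    exact Set.mem_iInter.2 hω
  have hcongr : ∀ n, ξ n =ᵐ[P] A.indicator (ξ n) := by
    intro n
    filter_upwards [hAae] with ω hω
    rw [Set.indicator_of_mem hω]
  refine ⟨a, fun n => A.indicator (ξ n), ⟨ha0, hainf, fun n => (hm n).indicator hAm, fun n => ?_,
    hind.congr hcongr, hsum, fun ω R hR => ?_⟩, ?_⟩
  · rw [← Measure.map_congr (hcongr n), hlaw n]
  · by_cases hω : ω ∈ A
    · obtain ⟨N, hN⟩ := exists_nat_ge R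
      have h1 : T N ω ≠ ∞ := (Set.mem_iInter.1 hω N).ne
      have h2 := ENNReal.summable_toReal h1
      refine Summable.of_nonneg_of_le (fun n => by positivity) (fun n => ?_) h2
      rw [Set.indicator_of_mem hω, ENNReal.toReal_mul, toReal_enorm,
        ENNReal.toReal_ofReal (mul_nonneg (ha0 n) (by positivity)), norm_mul, Complex.norm_real,
        Real.norm_of_nonneg (ha0 n), ← mul_assoc]
      have := ha0 n
      gcongr
    · simp only [Set.indicator_of_notMem hω, zero_mul, norm_zero]
      exact summable_zero
  · filter_upwards [hfeq, hAae] with ω h1 h2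
    ext z
    rw [h1 z]
    simp only [gaussianSeries, Set.indicator_of_mem h2]

namespace GaussianCoefficients

variable {Ω : Type*} [MeasurableSpace Ω] {P : Measure Ω} {a : ℕ → ℝ} {ξ : ℕ → Ω → ℂ}

lemma hasSum (h : GaussianCoefficients P a ξ) (ω : Ω) (z : ℂ) :
    HasSum (fun n => ξ n ω * a n * z ^ n) (gaussianSeries a ξ ω z) :=
  hasSum_mul_pow (h.summable ω) z

lemma measurable_uncurry (h : GaussianCoefficients P a ξ) :
    Measurable fun p : ℂ × Ω => gaussianSeries a ξ p.2 p.1 := by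
  refine measurable_of_tendsto_metrizable
    (f := fun N (p : ℂ × Ω) => ∑ n ∈ Finset.range N, ξ n p.2 * a n * p.1 ^ n)
    (fun N => Finset.measurable_sum _ fun n _ => ?_)
    (tendsto_pi_nhds.2 fun p => (h.hasSum p.2 p.1).tendsto_sum_nat)
  exact (((h.measurable n).comp measurable_snd).mul_const _).mul (measurable_fst.pow_const n)

lemma summable_sq (h : GaussianCoefficients P a ξ) {R : ℝ} (hR : 0 ≤ R) :
    Summable fun n => a n ^ 2 * R ^ n := by
  have h1 := h.summable_weights (√R) (Real.sqrt_nonneg R)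
  have h0 : ∀ n, 0 ≤ a n * √R ^ n := fun n => mul_nonneg (h.nonneg n) (by positivity)
  have h2 := (h1.mul_of_nonneg h1 h0 h0).comp_injective (i := fun n : ℕ => (n, n))
    (fun x y hxy => (Prod.mk.inj hxy).1)
  refine h2.congr fun n => ?_
  simp only [Function.comp_apply]
  rw [mul_mul_mul_comm, ← mul_pow, Real.mul_self_sqrt hR, sq]

lemma tsum_sq_pos (h : GaussianCoefficients P a ξ) {r : ℝ} (hr : 0 < r) :
    0 < ∑' n, a n ^ 2 * r ^ n := by
  obtain ⟨n, hn⟩ := h.infinite.nonempty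
  exact (h.summable_sq hr.le).tsum_pos (fun n => by positivity) n
    (mul_pos (pow_pos ((h.nonneg n).lt_of_ne' hn) 2) (pow_pos hr n))

lemma hasSum_normalized_sq (h : GaussianCoefficients P a ξ) {z : ℂ} (hz : z ≠ 0) :
    HasSum (fun n => ‖(a n * z ^ n / (√(∑' n, a n ^ 2 * (‖z‖ ^ 2) ^ n) : ℝ) : ℂ)‖ ^ 2) 1 := by
  have hpos := h.tsum_sq_pos (r := ‖z‖ ^ 2) (by positivity)
  have h1 := ((h.summable_sq (R := ‖z‖ ^ 2) (by positivity)).hasSum).div_const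
    (∑' n, a n ^ 2 * (‖z‖ ^ 2) ^ n)
  rw [div_self hpos.ne'] at h1
  convert! h1 using 1
  ext n
  rw [norm_div, norm_mul, norm_pow, Complex.norm_real, Complex.norm_real,
    Real.norm_of_nonneg (Real.sqrt_nonneg _), Real.norm_of_nonneg (h.nonneg n), div_pow,
    Real.sq_sqrt hpos.le]
  ring

lemma hasSum_normalized (h : GaussianCoefficients P a ξ) (z : ℂ) (s : ℝ) (ω : Ω) :
    HasSum (fun n => (a n * z ^ n / (s : ℝ) : ℂ) * ξ n ω) (gaussianSeries a ξ ω z / s) := by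
  convert! (h.hasSum ω z).div_const (s : ℂ) using 1
  ext n; ring

lemma measurable_apply (h : GaussianCoefficients P a ξ) (z : ℂ) :
    Measurable fun ω => gaussianSeries a ξ ω z :=
  h.measurable_uncurry.comp (measurable_const.prodMk measurable_id)

lemma summable_norm_sq (h : GaussianCoefficients P a ξ) (R : ℝ) (hR : 0 ≤ R) :
    Summable fun n => ‖((a n ^ 2 : ℝ) : ℂ)‖ * R ^ n := by
  refine (h.summable_sq hR).congr fun n => ?_
  rw [Complex.norm_real, Real.norm_of_nonneg (sq_nonneg _)]

variable [IsProbabilityMeasure P]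

lemma map_normalized (h : GaussianCoefficients P a ξ) {z : ℂ} (hz : z ≠ 0) :
    P.map (fun ω => gaussianSeries a ξ ω z / (√(∑' n, a n ^ 2 * (‖z‖ ^ 2) ^ n) : ℝ))
      = stdComplexGaussian :=
  map_hasSum_eq_stdComplexGaussian h.measurable h.law h.indep
    (h.hasSum_normalized z _) (h.hasSum_normalized_sq hz)

lemma ae_ne_zero (h : GaussianCoefficients P a ξ) {z : ℂ} (hz : z ≠ 0) :
    ∀ᵐ ω ∂P, gaussianSeries a ξ ω z ≠ 0 := by
  have h1 : ∀ᵐ w ∂stdComplexGaussian, w ≠ 0 := by simp [ae_iff]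
  rw [← h.map_normalized hz] at h1
  have := ae_of_ae_map ((h.measurable_apply z).div_const _).aemeasurable h1
  filter_upwards [this] with ω hω h0
  exact hω (by rw [h0, zero_div])

lemma integral_mul_conj (h : GaussianCoefficients P a ξ) {z : ℂ} (hz : z ≠ 0) :
    ∫ ω, gaussianSeries a ξ ω z * conj (gaussianSeries a ξ ω z) ∂P
      = ((∑' n, a n ^ 2 * (‖z‖ ^ 2) ^ n : ℝ) : ℂ) := by
  set s := ∑' n, a n ^ 2 * (‖z‖ ^ 2) ^ n with hs
  have hpos : 0 < s := h.tsum_sq_pos (r := ‖z‖ ^ 2) (by positivity)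
  have h1 := integral_sq_norm_stdComplexGaussian
  rw [← h.map_normalized hz, integral_map ((h.measurable_apply z).div_const _).aemeasurable
    (by fun_prop)] at h1
  have h2 : ∀ ω, gaussianSeries a ξ ω z * conj (gaussianSeries a ξ ω z)
      = ((s * ‖gaussianSeries a ξ ω z / (√s : ℝ)‖ ^ 2 : ℝ) : ℂ) := by
    intro ω
    rw [Complex.mul_conj, Complex.normSq_eq_norm_sq, norm_div, Complex.norm_real,
      Real.norm_of_nonneg (Real.sqrt_nonneg _), div_pow, Real.sq_sqrt hpos.le]
    congr 1
    field_simp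
  simp_rw [h2]
  rw [integral_complex_ofReal, integral_const_mul, h1, mul_one]

/-- The diagonal of the covariance determines G on the positive reals, and the identity theorem does
the rest. -/
lemma eq_tsum_of_hasCovarianceKernel (h : GaussianCoefficients P a ξ) {f : Ω → ℂ → ℂ}
    (hf : ∀ᵐ ω ∂P, f ω = gaussianSeries a ξ ω) {G : ℂ → ℂ} (hG : Differentiable ℂ G)
    (hcov : HasCovarianceKernel P f G) (z : ℂ) : G z = ∑' n, ((a n ^ 2 : ℝ) : ℂ) * z ^ n := by
  have hreal : ∀ r : ℝ, 0 < r → G r = ∑' n, ((a n ^ 2 : ℝ) : ℂ) * (r : ℂ) ^ n := by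
    intro r hr
    have hs : ((√r : ℝ) : ℂ) ≠ 0 := by exact_mod_cast (Real.sqrt_pos.2 hr).ne'
    have h1 := hcov (√r : ℝ) (√r : ℝ)
    have h2 : ∫ ω, f ω (√r : ℝ) * conj (f ω (√r : ℝ)) ∂P
        = ∫ ω, gaussianSeries a ξ ω (√r : ℝ) * conj (gaussianSeries a ξ ω (√r : ℝ)) ∂P := by
      refine integral_congr_ae ?_
      filter_upwards [hf] with ω hω
      rw [hω]
    rw [h2, h.integral_mul_conj hs, Complex.conj_ofReal, ← Complex.ofReal_mul,
      Real.mul_self_sqrt hr.le, Complex.norm_real, Real.norm_of_nonneg (Real.sqrt_nonneg _),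
      Real.sq_sqrt hr.le] at h1
    rw [← h1]
    push_cast
    rfl
  have hd := differentiable_tsum_mul_pow h.summable_norm_sq
  have hfreq : ∃ᶠ w in 𝓝[≠] ((1 : ℝ) : ℂ), G w = ∑' n, ((a n ^ 2 : ℝ) : ℂ) * w ^ n := by
    have htend : Tendsto (fun r : ℝ => (r : ℂ)) (𝓝[≠] 1) (𝓝[≠] ((1 : ℝ) : ℂ)) :=
      tendsto_nhdsWithin_of_tendsto_nhds_of_eventually_within _
        (Complex.continuous_ofReal.continuousAt.tendsto.mono_left nhdsWithin_le_nhds)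
        (eventually_nhdsWithin_of_forall fun r hr => by
          simpa using hr)
    refine htend.frequently (Eventually.frequently ?_)
    have : ∀ᶠ r : ℝ in 𝓝 1, 0 < r := lt_mem_nhds one_pos
    filter_upwards [nhdsWithin_le_nhds this] with r hr
    exact hreal r hr
  exact congrFun (AnalyticOnNhd.eq_of_frequently_eq (fun w _ => hG.analyticAt w)
    (fun w _ => hd.analyticAt w) hfreq) z

end GaussianCoefficients

/-! ### Centred logarithms and their covariances -/

/-- The mean of `log ‖·‖` under the standard complex Gaussian law. -/
def gaussianLogMean : ℝ := ∫ z, Real.log ‖z‖ ∂stdComplexGaussian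

/-- The centred logarithm of the modulus of a Gaussian series with covariance kernel `G`. -/
def centredLog {Ω : Type*} (G : ℂ → ℂ) (a : ℕ → ℝ) (ξ : ℕ → Ω → ℂ) (z : ℂ) (ω : Ω) : ℝ :=
  Real.log ‖gaussianSeries a ξ ω z‖ - (Real.log (G (‖z‖ ^ 2 : ℝ)).re / 2 + gaussianLogMean)

namespace GaussianCoefficients

variable {Ω : Type*} [MeasurableSpace Ω] {P : Measure Ω} {a : ℕ → ℝ}
  {ξ : ℕ → Ω → ℂ} {G : ℂ → ℂ}

lemma re_eq_tsum (hG : ∀ z, G z = ∑' n, ((a n ^ 2 : ℝ) : ℂ) * z ^ n) (r : ℝ) :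
    (G r).re = ∑' n, a n ^ 2 * r ^ n := by
  rw [hG]
  have : ∀ n, ((a n ^ 2 : ℝ) : ℂ) * (r : ℂ) ^ n = ((a n ^ 2 * r ^ n : ℝ) : ℂ) := by
    intro n; push_cast; ring
  simp_rw [this]
  rw [← Complex.ofReal_tsum, Complex.ofReal_re]

lemma re_pos (h : GaussianCoefficients P a ξ)
    (hG : ∀ z, G z = ∑' n, ((a n ^ 2 : ℝ) : ℂ) * z ^ n) {r : ℝ} (hr : 0 < r) : 0 < (G r).re := by
  rw [re_eq_tsum hG]
  exact h.tsum_sq_pos hr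

lemma measurable_centredLog (h : GaussianCoefficients P a ξ) (hG : Continuous G) :
    Measurable fun p : ℂ × Ω => centredLog G a ξ p.1 p.2 := by
  unfold centredLog
  refine (Real.measurable_log.comp h.measurable_uncurry.norm).sub ?_
  have : Measurable fun z : ℂ => Real.log (G (‖z‖ ^ 2 : ℝ)).re :=
    Real.measurable_log.comp (Continuous.measurable (by fun_prop))
  exact ((this.comp measurable_fst).div_const 2).add_const _

variable [IsProbabilityMeasure P]

/-- Only almost sure, because the logarithm of the quotient splits only where f(z) ≠ 0; `Real.log 0`
has the default value 0. -/
lemma centredLog_ae_eq (h : GaussianCoefficients P a ξ)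
    (hG : ∀ z, G z = ∑' n, ((a n ^ 2 : ℝ) : ℂ) * z ^ n) {z : ℂ} (hz : z ≠ 0) :
    centredLog G a ξ z =ᵐ[P] fun ω =>
      Real.log ‖gaussianSeries a ξ ω z / (√(∑' n, a n ^ 2 * (‖z‖ ^ 2) ^ n) : ℝ)‖
        - gaussianLogMean := by
  filter_upwards [h.ae_ne_zero hz] with ω hω
  have hpos := h.tsum_sq_pos (r := ‖z‖ ^ 2) (by positivity)
  rw [centredLog, re_eq_tsum hG, norm_div, Complex.norm_real,
    Real.norm_of_nonneg (Real.sqrt_nonneg _), Real.log_div (norm_ne_zero_iff.2 hω)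
    (Real.sqrt_pos.2 hpos).ne', Real.log_sqrt hpos.le]
  ring

lemma integrable_centredLog_sq (h : GaussianCoefficients P a ξ)
    (hG : ∀ z, G z = ∑' n, ((a n ^ 2 : ℝ) : ℂ) * z ^ n) {z : ℂ} (hz : z ≠ 0) :
    Integrable (fun ω => centredLog G a ξ z ω ^ 2) P ∧
      ∫ ω, centredLog G a ξ z ω ^ 2 ∂P
        = ∫ w, (Real.log ‖w‖ - gaussianLogMean) ^ 2 ∂stdComplexGaussian := by
  have hL2 : MemLp (fun z : ℂ => Real.log ‖z‖ - gaussianLogMean) 2 stdComplexGaussian :=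
    memLp_log_norm_stdComplexGaussian.sub (memLp_const _)
  have hm : Measurable fun w : ℂ => (Real.log ‖w‖ - gaussianLogMean) ^ 2 :=
    ((Real.measurable_log.comp measurable_norm).sub_const _).pow_const 2
  have hX := ((h.measurable_apply z).div_const
    ((√(∑' n, a n ^ 2 * (‖z‖ ^ 2) ^ n) : ℝ) : ℂ))
  have hae : (fun ω => centredLog G a ξ z ω ^ 2) =ᵐ[P] fun ω =>
      (Real.log ‖gaussianSeries a ξ ω z / (√(∑' n, a n ^ 2 * (‖z‖ ^ 2) ^ n) : ℝ)‖
        - gaussianLogMean) ^ 2 := by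
    filter_upwards [h.centredLog_ae_eq hG hz] with ω hω
    rw [hω]
  constructor
  · refine Integrable.congr ?_ hae.symm
    have := hL2.integrable_sq
    rw [← h.map_normalized hz] at this
    exact this.comp_measurable hX
  · rw [integral_congr_ae hae, ← h.map_normalized hz,
      integral_map hX.aemeasurable hm.aestronglyMeasurable]

end GaussianCoefficients

/-- The correlation of the normalized values is G(z conj(w)) / √(G(|z|²) G(|w|²)). The constant
depends on neither the series nor the points. -/
lemma exists_abs_integral_centredLog_mul_le : ∃ C : ℝ, 0 ≤ C ∧ ∀ {Ω : Type*} [MeasurableSpace Ω]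
    {P : Measure Ω} [IsProbabilityMeasure P] {a : ℕ → ℝ} {ξ : ℕ → Ω → ℂ} {G : ℂ → ℂ},
    GaussianCoefficients P a ξ → (∀ z, G z = ∑' n, ((a n ^ 2 : ℝ) : ℂ) * z ^ n) →
    ∀ {z w : ℂ}, z ≠ 0 → w ≠ 0 →
    |∫ ω, centredLog G a ξ z ω * centredLog G a ξ w ω ∂P| ≤ C * normalizedKernel G z w := by
  obtain ⟨C, hC⟩ := norm_integral_log_mul_log_le
  refine ⟨max C 0, le_max_right _ _, ?_⟩
  intro Ω _ P _ a ξ G h hG z w hz hw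
  set s := ∑' n, a n ^ 2 * (‖z‖ ^ 2) ^ n with hs
  set t := ∑' n, a n ^ 2 * (‖w‖ ^ 2) ^ n with ht
  have hs0 : 0 < s := h.tsum_sq_pos (r := ‖z‖ ^ 2) (by positivity)
  have ht0 : 0 < t := h.tsum_sq_pos (r := ‖w‖ ^ 2) (by positivity)
  have hl : HasSum (fun n => (a n * z ^ n / (√s : ℝ) : ℂ) * conj (a n * w ^ n / (√t : ℝ) : ℂ))
      (G (z * conj w) / ((√s : ℝ) * (√t : ℝ))) := by
    have h1 := (hasSum_mul_pow h.summable_norm_sq (z * conj w)).div_const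
      (((√s : ℝ) : ℂ) * (√t : ℝ))
    rw [← hG] at h1
    convert! h1 using 1
    ext n
    simp only [map_div₀, map_mul, Complex.conj_ofReal, map_pow]
    push_cast
    ring
  have hcongr : ∫ ω, centredLog G a ξ z ω * centredLog G a ξ w ω ∂P =
      ∫ ω, (Real.log ‖gaussianSeries a ξ ω z / (√s : ℝ)‖ - ∫ z, Real.log ‖z‖ ∂stdComplexGaussian) *
      (Real.log ‖gaussianSeries a ξ ω w / (√t : ℝ)‖ - ∫ z, Real.log ‖z‖ ∂stdComplexGaussian) ∂P := by
    refine integral_congr_ae ?_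
    filter_upwards [h.centredLog_ae_eq hG hz, h.centredLog_ae_eq hG hw] with ω h1 h2
    rw [h1, h2]; rfl
  rw [hcongr]
  refine (hC h.measurable h.law h.indep (h.hasSum_normalized z _) (h.hasSum_normalized w _)
    (h.hasSum_normalized_sq hz) (h.hasSum_normalized_sq hw) hl).trans ?_
  have hn : ‖G (z * conj w) / (((√s : ℝ) : ℂ) * (√t : ℝ))‖ = normalizedKernel G z w := by
    unfold normalizedKernel
    rw [GaussianCoefficients.re_eq_tsum hG, GaussianCoefficients.re_eq_tsum hG, norm_div, norm_mul,
      Complex.norm_real, Complex.norm_real, Real.norm_of_nonneg (Real.sqrt_nonneg _),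
      Real.norm_of_nonneg (Real.sqrt_nonneg _), Real.sqrt_mul hs0.le]
  rw [hn]
  have : 0 ≤ normalizedKernel G z w := by unfold normalizedKernel; positivity
  gcongr
  exact le_max_left _ _

/-! ### Second moments of averaged random fields -/

section RandomField

variable {Ω T : Type*} [MeasurableSpace Ω] [MeasurableSpace T] {P : Measure Ω}
  [IsProbabilityMeasure P] {ν : Measure T} [IsFiniteMeasure ν] {Y : T → Ω → ℝ} {V : ℝ}

lemma integrable_uncurry_of_sq (hY : Measurable fun p : T × Ω => Y p.1 p.2)
    (hint : ∀ τ, Integrable (fun ω => Y τ ω ^ 2) P) (hV : ∀ τ, ∫ ω, Y τ ω ^ 2 ∂P = V) :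
    Integrable (fun p : T × Ω => Y p.1 p.2) (ν.prod P) := by
  have h2 : Integrable (fun p : T × Ω => Y p.1 p.2 ^ 2) (ν.prod P) := by
    rw [integrable_prod_iff (hY.pow_const 2).aestronglyMeasurable]
    refine ⟨Eventually.of_forall hint, ?_⟩
    have : ∀ τ, ∫ ω, ‖Y τ ω ^ 2‖ ∂P = V := by
      intro τ
      rw [← hV τ]
      congr 1; ext ω
      rw [Real.norm_of_nonneg (sq_nonneg _)]
    simp_rw [this]
    exact integrable_const _
  exact ((memLp_two_iff_integrable_sq hY.aestronglyMeasurable).2 h2).integrable (by norm_num)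

/-- Expanding the square and exchanging integrals turns the second moment into a double integral of
covariances, with weights bounded by `K`. -/
lemma lintegral_enorm_integral_sq_le (hY : Measurable fun p : T × Ω => Y p.1 p.2)
    (hint : ∀ τ, Integrable (fun ω => Y τ ω ^ 2) P) (hV : ∀ τ, ∫ ω, Y τ ω ^ 2 ∂P = V)
    {w : T → ℂ} (hw : Measurable w) {K : ℝ} (hK : ∀ᵐ τ ∂ν, ‖w τ‖ ≤ K) :
    ∫⁻ ω, ‖∫ τ, w τ * Y τ ω ∂ν‖ₑ ^ 2 ∂P
      ≤ ENNReal.ofReal (K ^ 2) * ∫⁻ σ, ∫⁻ τ, ENNReal.ofReal |∫ ω, Y τ ω * Y σ ω ∂P| ∂ν ∂ν := by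
  have hYτ : ∀ τ, Measurable (Y τ) := fun τ => hY.comp (measurable_const.prodMk measurable_id)
  have hYY : ∀ τ σ, Integrable (fun ω => Y τ ω * Y σ ω) P := fun τ σ =>
    ((memLp_two_iff_integrable_sq (hYτ τ).aestronglyMeasurable).2 (hint τ)).integrable_mul
      ((memLp_two_iff_integrable_sq (hYτ σ).aestronglyMeasurable).2 (hint σ))
  set H : (T × T) × Ω → ℂ := fun q =>
    (w q.1.1 * Y q.1.1 q.2) * (conj (w q.1.2) * Y q.1.2 q.2) with hHdef
  have m1 : Measurable fun q : (T × T) × Ω => Y q.1.1 q.2 :=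
    hY.comp ((measurable_fst.comp measurable_fst).prodMk measurable_snd)
  have m2 : Measurable fun q : (T × T) × Ω => Y q.1.2 q.2 :=
    hY.comp ((measurable_snd.comp measurable_fst).prodMk measurable_snd)
  have mw1 : Measurable fun q : (T × T) × Ω => w q.1.1 := hw.comp (measurable_fst.comp measurable_fst)
  have mw2 : Measurable fun q : (T × T) × Ω => w q.1.2 := hw.comp (measurable_snd.comp measurable_fst)
  have hHm : Measurable H := by
    have := Complex.continuous_conj.measurable.comp mw2
    exact (mw1.mul m1.complex_ofReal).mul (this.mul m2.complex_ofReal)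
  have hV0 : ∀ τ σ, ∫ ω, |Y τ ω * Y σ ω| ∂P ≤ V := by
    intro τ σ
    calc _ ≤ ∫ ω, (2⁻¹ * Y τ ω ^ 2 + 2⁻¹ * Y σ ω ^ 2) ∂P := by
          refine integral_mono (hYY τ σ).abs (((hint τ).const_mul _).add ((hint σ).const_mul _))
            fun ω => ?_
          simp only [abs_mul]
          rw [← sq_abs (Y τ ω), ← sq_abs (Y σ ω)]
          nlinarith [sq_nonneg (|Y τ ω| - |Y σ ω|)]
      _ = V := by
          rw [integral_add ((hint τ).const_mul _) ((hint σ).const_mul _), integral_const_mul,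
            integral_const_mul, hV, hV]
          ring
  have hK2 : ∀ᵐ p ∂(ν.prod ν), ‖w p.1‖ ≤ K ∧ ‖w p.2‖ ≤ K :=
    (Measure.quasiMeasurePreserving_fst.ae hK).and (Measure.quasiMeasurePreserving_snd.ae hK)
  have hHslice : ∀ p, (fun ω => H (p, ω)) = fun ω =>
      (w p.1 * conj (w p.2)) * ((Y p.1 ω * Y p.2 ω : ℝ) : ℂ) := by
    intro p; ext ω; simp only [hHdef]; push_cast; ring
  have hHint : Integrable H ((ν.prod ν).prod P) := by
    rw [integrable_prod_iff hHm.aestronglyMeasurable]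
    refine ⟨Eventually.of_forall fun p => ?_, ?_⟩
    · rw [hHslice]
      exact (hYY p.1 p.2).ofReal.const_mul _
    · refine Integrable.mono' (integrable_const (K * K * V))
        (hHm.stronglyMeasurable.norm.integral_prod_right').aestronglyMeasurable ?_
      filter_upwards [hK2] with p hp
      rw [Real.norm_of_nonneg (integral_nonneg fun ω => norm_nonneg _)]
      have : ∀ ω, ‖H (p, ω)‖ = ‖w p.1‖ * ‖w p.2‖ * |Y p.1 ω * Y p.2 ω| := by
        intro ω
        rw [congrFun (hHslice p) ω, norm_mul, norm_mul, Complex.norm_conj, Complex.norm_real,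
          Real.norm_eq_abs]
      simp_rw [this]
      rw [integral_const_mul]
      have : 0 ≤ ∫ ω, |Y p.1 ω * Y p.2 ω| ∂P := integral_nonneg fun ω => abs_nonneg _
      have hK0 : 0 ≤ K := (norm_nonneg _).trans hp.1
      gcongr
      · exact hp.1
      · exact hp.2
      · exact hV0 _ _
  -- Valid at every ω: the product formula for Bochner integrals persists without integrability,
  -- both sides being 0 by convention.
  have hsq : ∀ ω, ∫ p, H (p, ω) ∂(ν.prod ν) = ((‖∫ τ, w τ * Y τ ω ∂ν‖ ^ 2 : ℝ) : ℂ) := by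
    intro ω
    simp only [hHdef]
    rw [integral_prod_mul (f := fun τ => w τ * (Y τ ω : ℂ)) (g := fun τ => conj (w τ) * (Y τ ω : ℂ))]
    have : ∫ τ, conj (w τ) * (Y τ ω : ℂ) ∂ν = conj (∫ τ, w τ * Y τ ω ∂ν) := by
      rw [← integral_conj]
      congr 1; ext τ; simp
    rw [this, Complex.mul_conj, Complex.normSq_eq_norm_sq]
  have hIsq : Integrable (fun ω => ‖∫ τ, w τ * Y τ ω ∂ν‖ ^ 2) P := by
    have := hHint.integral_prod_right
    simp_rw [hsq] at this
    exact this.re.congr (Eventually.of_forall fun ω => Complex.ofReal_re _)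
  have e1 : ∫⁻ ω, ‖∫ τ, w τ * Y τ ω ∂ν‖ₑ ^ 2 ∂P
      = ENNReal.ofReal (∫ ω, ‖∫ τ, w τ * Y τ ω ∂ν‖ ^ 2 ∂P) := by
    rw [ofReal_integral_eq_lintegral_ofReal hIsq (Eventually.of_forall fun ω => by positivity)]
    congr 1; ext ω
    rw [ENNReal.ofReal_pow (norm_nonneg _), ofReal_norm]
  have e2 : ((∫ ω, ‖∫ τ, w τ * Y τ ω ∂ν‖ ^ 2 ∂P : ℝ) : ℂ)
      = ∫ p, ∫ ω, H (p, ω) ∂P ∂(ν.prod ν) := by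
    rw [integral_integral_swap (f := fun p ω => H (p, ω)) hHint, ← integral_complex_ofReal]
    congr 1; ext ω
    exact (hsq ω).symm
  have e3 : ENNReal.ofReal (∫ ω, ‖∫ τ, w τ * Y τ ω ∂ν‖ ^ 2 ∂P)
      = ‖∫ p, ∫ ω, H (p, ω) ∂P ∂(ν.prod ν)‖ₑ := by
    rw [← e2, ← ofReal_norm, Complex.norm_real, Real.norm_of_nonneg
      (integral_nonneg fun ω => by positivity)]
  rw [e1, e3]
  have hcm : Measurable fun p : T × T => ∫ ω, Y p.1 ω * Y p.2 ω ∂P :=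
    ((m1.mul m2).stronglyMeasurable.integral_prod_right' (ν := P)).measurable
  calc _ ≤ ∫⁻ p, ‖∫ ω, H (p, ω) ∂P‖ₑ ∂(ν.prod ν) := enorm_integral_le_lintegral_enorm _
    _ ≤ ∫⁻ p, ENNReal.ofReal (K ^ 2) * ENNReal.ofReal |∫ ω, Y p.1 ω * Y p.2 ω ∂P| ∂(ν.prod ν) := by
        refine lintegral_mono_ae ?_
        filter_upwards [hK2] with p hp
        rw [hHslice, integral_const_mul, integral_complex_ofReal, ← ofReal_norm, norm_mul, norm_mul,
          Complex.norm_conj, Complex.norm_real, Real.norm_eq_abs,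
          ← ENNReal.ofReal_mul (sq_nonneg K)]
        apply ENNReal.ofReal_le_ofReal
        have hK0 : 0 ≤ K := (norm_nonneg _).trans hp.1
        rw [sq]
        gcongr
        · exact hp.1
        · exact hp.2
    _ = _ := by
        have hcm' : Measurable fun p : T × T => ENNReal.ofReal |∫ ω, Y p.1 ω * Y p.2 ω ∂P| :=
          ENNReal.measurable_ofReal.comp hcm.abs
        rw [lintegral_const_mul _ hcm', lintegral_prod_symm _ hcm'.aemeasurable]

end RandomField

/-! ### Fluctuations over annuli -/

lemma annulusPoint_ne_zero {L : ℝ} (hL : 0 < L) (τ : ℝ × ℝ) : annulusPoint L τ ≠ 0 := by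
  rw [← norm_pos_iff, norm_annulusPoint hL]
  positivity

lemma ae_annulusMeasure_mem : ∀ᵐ τ ∂annulusMeasure, τ.1 ∈ Set.Ioc (0 : ℝ) 1 :=
  Measure.quasiMeasurePreserving_fst.ae (ae_restrict_mem measurableSet_Ioc)

lemma integral_annulusMeasure_eq_radialMean (k : ℕ) {f : ℂ → ℂ} {L : ℝ}
    (hi : Integrable (fun τ => annulusPoint L τ ^ k * (Real.log ‖f (annulusPoint L τ)‖ : ℂ))
      annulusMeasure) :
    ∫ τ, annulusPoint L τ ^ k * (Real.log ‖f (annulusPoint L τ)‖ : ℂ) ∂annulusMeasure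
      = 2 * Real.pi * radialMean k f L := by
  unfold annulusMeasure at hi ⊢
  rw [integral_prod _ hi, radialMean, intervalIntegral.integral_of_le zero_le_one,
    ← integral_const_mul]
  congr 1
  ext t
  rw [logMoment, Real.circleAverage_def, intervalIntegral.integral_of_le Real.two_pi_pos.le,
    Complex.real_smul, ← mul_assoc]
  have : (2 * Real.pi * (((2 * Real.pi)⁻¹ : ℝ) : ℂ)) = 1 := by
    have h0 : (Real.pi : ℂ) ≠ 0 := by exact_mod_cast Real.pi_ne_zero
    push_cast; field_simp
  rw [this, one_mul]
  rfl

/-- The fluctuation of the `k`-th logarithmic moment over the annulus of inner radius `L`. -/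
def fluctuation {Ω : Type*} (G : ℂ → ℂ) (a : ℕ → ℝ) (ξ : ℕ → Ω → ℂ) (k : ℕ) (L : ℝ) (ω : Ω) : ℂ :=
  ∫ τ, annulusPoint L τ ^ k * (centredLog G a ξ (annulusPoint L τ) ω : ℂ) ∂annulusMeasure

lemma ae_norm_annulusPoint_pow_le {L : ℝ} (hL : 0 < L) (k : ℕ) :
    ∀ᵐ τ ∂annulusMeasure, ‖annulusPoint L τ ^ k‖ ≤ (L * Real.exp 1) ^ k := by
  filter_upwards [ae_annulusMeasure_mem] with τ hτ
  rw [norm_pow, norm_annulusPoint hL]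
  gcongr
  exact hτ.2

namespace GaussianCoefficients

variable {Ω : Type*} [MeasurableSpace Ω] {P : Measure Ω} {a : ℕ → ℝ}
  {ξ : ℕ → Ω → ℂ} {G : ℂ → ℂ}

lemma measurable_centredLog_comp (h : GaussianCoefficients P a ξ) (hGc : Continuous G)
    {T : Type*} [MeasurableSpace T] {φ : T → ℂ} (hφ : Measurable φ) :
    Measurable fun p : T × Ω => centredLog G a ξ (φ p.1) p.2 := by
  have h1 : Measurable fun p : T × Ω => (φ p.1, p.2) :=
    (hφ.comp measurable_fst).prodMk measurable_snd
  have h2 := (h.measurable_centredLog hGc).comp h1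
  simpa only [Function.comp_def] using h2

lemma measurable_centredLog_annulus (h : GaussianCoefficients P a ξ) (hGc : Continuous G) (L : ℝ) :
    Measurable fun p : (ℝ × ℝ) × Ω => centredLog G a ξ (annulusPoint L p.1) p.2 :=
  h.measurable_centredLog_comp hGc (continuous_annulusPoint L).measurable

lemma measurable_fluctuation (h : GaussianCoefficients P a ξ) (hGc : Continuous G) (k : ℕ) (L : ℝ) :
    Measurable (fluctuation G a ξ k L) := by
  have h1 := h.measurable_centredLog_annulus hGc L
  have h2 : Measurable fun q : Ω × (ℝ × ℝ) => annulusPoint L q.2 ^ k *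
      (centredLog G a ξ (annulusPoint L q.2) q.1 : ℂ) :=
    (((continuous_annulusPoint L).measurable.comp measurable_snd).pow_const k).mul
      (h1.comp measurable_swap).complex_ofReal
  exact (h2.stronglyMeasurable.integral_prod_right' (ν := annulusMeasure)).measurable

variable [IsProbabilityMeasure P]

/-- D is the deterministic mean. The logarithm can be split under the integral for those ω whose
slice is integrable, which by Fubini are almost all; 2π appears because `annulusMeasure` is not
normalized in the angle. -/
lemma radialMean_ae_eq (h : GaussianCoefficients P a ξ)
    (hG : ∀ z, G z = ∑' n, ((a n ^ 2 : ℝ) : ℂ) * z ^ n) (hGc : Continuous G) (k : ℕ) {L : ℝ}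
    (hL : 0 < L) : ∃ D : ℂ, ∀ᵐ ω ∂P, 2 * Real.pi * radialMean k (gaussianSeries a ξ ω) L
      = fluctuation G a ξ k L ω + D := by
  refine ⟨∫ τ, annulusPoint L τ ^ k * ((Real.log (G (‖annulusPoint L τ‖ ^ 2 : ℝ)).re / 2
    + gaussianLogMean : ℝ) : ℂ) ∂annulusMeasure, ?_⟩
  have hint := integrable_uncurry_of_sq (P := P) (ν := annulusMeasure)
    (Y := fun τ ω => centredLog G a ξ (annulusPoint L τ) ω) (h.measurable_centredLog_annulus hGc L)
    (fun τ => (h.integrable_centredLog_sq hG (annulusPoint_ne_zero hL τ)).1)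
    (fun τ => (h.integrable_centredLog_sq hG (annulusPoint_ne_zero hL τ)).2)
  have hcont : Continuous fun τ => annulusPoint L τ ^ k := (continuous_annulusPoint L).pow k
  have iD : Integrable (fun τ => annulusPoint L τ ^ k *
      ((Real.log (G (‖annulusPoint L τ‖ ^ 2 : ℝ)).re / 2 + gaussianLogMean : ℝ) : ℂ))
      annulusMeasure := by
    have hc : Continuous fun τ => annulusPoint L τ ^ k *
      ((Real.log (G (‖annulusPoint L τ‖ ^ 2 : ℝ)).re / 2 + gaussianLogMean : ℝ) : ℂ) := by
      have h1 : Continuous fun τ => Real.log (G (‖annulusPoint L τ‖ ^ 2 : ℝ)).re := by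
        refine Continuous.log ?_ fun τ => ?_
        · have := continuous_annulusPoint L
          fun_prop
        · refine (h.re_pos hG ?_).ne'
          have := norm_pos_iff.2 (annulusPoint_ne_zero hL τ)
          positivity
      exact hcont.mul (Complex.continuous_ofReal.comp ((h1.div_const 2).add continuous_const))
    unfold annulusMeasure
    rw [Measure.prod_restrict]
    exact (hc.continuousOn.integrableOn_compact (isCompact_Icc.prod isCompact_Icc)).mono_set
      (Set.prod_mono Set.Ioc_subset_Icc_self Set.Ioc_subset_Icc_self)
  filter_upwards [hint.prod_left_ae] with ω hω
  have i1 : Integrable (fun τ => annulusPoint L τ ^ k *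
      (centredLog G a ξ (annulusPoint L τ) ω : ℂ)) annulusMeasure := by
    refine hω.ofReal.bdd_mul (c := (L * Real.exp 1) ^ k) hcont.aestronglyMeasurable ?_
    exact ae_norm_annulusPoint_pow_le hL k
  have hsum : (fun τ => annulusPoint L τ ^ k *
        (Real.log ‖gaussianSeries a ξ ω (annulusPoint L τ)‖ : ℂ))
      = fun τ => annulusPoint L τ ^ k * (centredLog G a ξ (annulusPoint L τ) ω : ℂ)
        + annulusPoint L τ ^ k * ((Real.log (G (‖annulusPoint L τ‖ ^ 2 : ℝ)).re / 2
          + gaussianLogMean : ℝ) : ℂ) := by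
    ext τ
    rw [centredLog]
    push_cast
    ring
  have i3 := i1.add iD
  rw [← integral_annulusMeasure_eq_radialMean k (by rw [hsum]; exact i3), hsum,
    integral_add i1 iD]
  rfl

/-- The weight z^k gives L^(2k), and the covariance bound together with the integrated kernel gives
1/M. -/
lemma exists_lintegral_fluctuation_le (h : GaussianCoefficients P a ξ)
    (hG : ∀ z, G z = ∑' n, ((a n ^ 2 : ℝ) : ℂ) * z ^ n) (hadm : IsAdmissible G) (k : ℕ) :
    ∃ C r₀ : ℝ, 0 ≤ C ∧ ∀ L M : ℝ, 0 < L → r₀ ≤ L ^ 2 → 0 < M →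
      (∀ r, L ^ 2 ≤ r → M ≤ haymanB G r) →
      ∫⁻ ω, ‖fluctuation G a ξ k L ω‖ₑ ^ 2 ∂P ≤ ENNReal.ofReal (C * L ^ (2 * k) / M) := by
  obtain ⟨C₁, hC₁, hcov⟩ := exists_abs_integral_centredLog_mul_le
  obtain ⟨C₂, r₀, hC₂, hker⟩ := hadm.exists_lintegral_normalizedKernel_le
    (fun r hr => h.re_pos hG hr)
  refine ⟨Real.exp 1 ^ (2 * k) * C₁ * C₂ * annulusMeasure.real Set.univ, r₀, by positivity,
    fun L M hL hr hM hMb => ?_⟩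
  have hGc := hadm.entire.continuous
  have hmain := lintegral_enorm_integral_sq_le (P := P) (ν := annulusMeasure)
    (Y := fun τ ω => centredLog G a ξ (annulusPoint L τ) ω) (h.measurable_centredLog_annulus hGc L)
    (fun τ => (h.integrable_centredLog_sq hG (annulusPoint_ne_zero hL τ)).1)
    (fun τ => (h.integrable_centredLog_sq hG (annulusPoint_ne_zero hL τ)).2)
    (w := fun τ => annulusPoint L τ ^ k) ((continuous_annulusPoint L).pow k).measurable
    (ae_norm_annulusPoint_pow_le hL k)
  refine hmain.trans ?_
  have hinner : ∀ᵐ σ ∂annulusMeasure, ∫⁻ τ, ENNReal.ofReal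
      |∫ ω, centredLog G a ξ (annulusPoint L τ) ω * centredLog G a ξ (annulusPoint L σ) ω ∂P|
        ∂annulusMeasure ≤ ENNReal.ofReal C₁ * ENNReal.ofReal (C₂ / M) := by
    filter_upwards [ae_annulusMeasure_mem] with σ hσ
    calc _ ≤ ∫⁻ τ, ENNReal.ofReal C₁ *
          ENNReal.ofReal (normalizedKernel G (annulusPoint L τ) (annulusPoint L σ))
            ∂annulusMeasure := by
          refine lintegral_mono fun τ => ?_
          rw [← ENNReal.ofReal_mul hC₁]
          exact ENNReal.ofReal_le_ofReal
            (hcov h hG (annulusPoint_ne_zero hL τ) (annulusPoint_ne_zero hL σ))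
      _ = ENNReal.ofReal C₁ * ∫⁻ τ, 
          ENNReal.ofReal (normalizedKernel G (annulusPoint L τ) (annulusPoint L σ))
            ∂annulusMeasure := lintegral_const_mul' _ _ ENNReal.ofReal_ne_top
      _ ≤ _ := by
          gcongr
          exact hker L M hL hr hM hMb σ hσ.1.le
  calc _ ≤ ENNReal.ofReal (((L * Real.exp 1) ^ k) ^ 2) *
        ∫⁻ σ : ℝ × ℝ, ENNReal.ofReal C₁ * ENNReal.ofReal (C₂ / M) ∂annulusMeasure := by
        exact mul_le_mul' le_rfl (lintegral_mono_ae hinner)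
    _ = ENNReal.ofReal (((L * Real.exp 1) ^ k) ^ 2) * (ENNReal.ofReal C₁ * ENNReal.ofReal (C₂ / M)
        * ENNReal.ofReal (annulusMeasure.real Set.univ)) := by
        rw [lintegral_const, ofReal_measureReal]
    _ ≤ _ := by
        rw [← ENNReal.ofReal_mul hC₁, ← ENNReal.ofReal_mul (by positivity),
          ← ENNReal.ofReal_mul (by positivity)]
        apply ENNReal.ofReal_le_ofReal
        apply le_of_eq
        rw [mul_pow, mul_pow, ← pow_mul, ← pow_mul, mul_comm k 2]
        ring

/-- The second moments along L = e^j are summable, so the sum of the squares is almost surely finite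
and its terms tend to 0. -/
lemma ae_tendsto_fluctuation (h : GaussianCoefficients P a ξ)
    (hG : ∀ z, G z = ∑' n, ((a n ^ 2 : ℝ) : ℂ) * z ^ n) (hadm : IsAdmissible G) (k : ℕ) {c : ℝ}
    (hkc : (k : ℝ) < c) (hc : ∀ᶠ r in atTop, r ^ c ≤ haymanB G r) :
    ∀ᵐ ω ∂P, Tendsto (fun j : ℕ => fluctuation G a ξ k (Real.exp j) ω) atTop (𝓝 0) := by
  obtain ⟨C, r₀, hC, hfl⟩ := h.exists_lintegral_fluctuation_le hG hadm k
  obtain ⟨r₁, hr₁⟩ := eventually_atTop.1 hc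
  have htop : Tendsto (fun j : ℕ => Real.exp j ^ 2) atTop atTop :=
    (tendsto_pow_atTop (by norm_num)).comp (Real.tendsto_exp_atTop.comp tendsto_natCast_atTop_atTop)
  obtain ⟨N, hN⟩ := eventually_atTop.1 (htop.eventually_ge_atTop (max r₀ r₁))
  -- The ratio of L^(2k)/M at consecutive scales, for M = (L²)^c and L = e^j.
  set q : ℝ := Real.exp (-(2 * (c - k))) with hq
  have hq1 : q < 1 := Real.exp_lt_one_iff.2 (by linarith)
  have hq0 : 0 < q := Real.exp_pos _
  have hbound : ∀ j ≥ N, ∫⁻ ω, ‖fluctuation G a ξ k (Real.exp j) ω‖ₑ ^ 2 ∂P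
      ≤ ENNReal.ofReal (C * q ^ j) := by
    intro j hj
    have hL := Real.exp_pos (j : ℝ)
    have hmax := hN j hj
    have hc0 : 0 ≤ c := (Nat.cast_nonneg k).trans hkc.le
    refine (hfl (Real.exp j) ((Real.exp j ^ 2) ^ c) hL ((le_max_left _ _).trans hmax)
      (by positivity) fun r hr => ?_).trans (ENNReal.ofReal_le_ofReal (le_of_eq ?_))
    · exact (Real.rpow_le_rpow (by positivity) hr hc0).trans
        (hr₁ r (((le_max_right _ _).trans hmax).trans hr))
    · rw [mul_div_assoc]
      congr 1
      rw [hq, ← Real.exp_nat_mul, ← Real.exp_nat_mul, ← Real.exp_nat_mul, ← Real.exp_mul,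
        ← Real.exp_sub]
      congr 1
      push_cast
      ring
  have hGc := hadm.entire.continuous
  have hfin : ∫⁻ ω, ∑' j : ℕ, ‖fluctuation G a ξ k (Real.exp (j + N : ℕ)) ω‖ₑ ^ 2 ∂P ≠ ∞ := by
    rw [lintegral_tsum fun j => ((h.measurable_fluctuation hGc k _).enorm.pow_const 2).aemeasurable]
    have hgeo : Summable fun j : ℕ => C * q ^ (j + N) :=
      (((summable_geometric_of_lt_one hq0.le hq1).mul_left (C * q ^ N))).congr fun j => by ring
    refine ne_top_of_le_ne_top ?_ (ENNReal.tsum_le_tsum fun j => hbound (j + N) (by omega))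
    rw [← ENNReal.ofReal_tsum_of_nonneg (fun j => by positivity) hgeo]
    exact ENNReal.ofReal_ne_top
  have hae := ae_lt_top (Measurable.tsum fun j =>
    ((h.measurable_fluctuation hGc k (Real.exp (j + N : ℕ))).enorm.pow_const 2)) hfin
  filter_upwards [hae] with ω hω
  have h1 := ENNReal.tendsto_atTop_zero_of_tsum_ne_top hω.ne
  have h2 := (ENNReal.continuous_rpow_const (y := 1 / 2)).tendsto 0 |>.comp h1
  rw [ENNReal.zero_rpow_of_pos (by norm_num)] at h2
  have h3 : Tendsto (fun j : ℕ => ‖fluctuation G a ξ k (Real.exp (j + N : ℕ)) ω‖ₑ) atTop (𝓝 0) := by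
    refine h2.congr fun j => ?_
    simp only [Function.comp_apply]
    rw [← ENNReal.rpow_natCast, ← ENNReal.rpow_mul]
    norm_num
  rw [← tendsto_add_atTop_iff_nat N]
  exact tendsto_zero_iff_enorm_tendsto_zero.2 h3

/-- Since e · e^j = e^(j+1), the outer annulus at step j is the inner annulus at step j + 1, so one
convergent sequence controls both terms. -/
lemma exists_ae_tendsto_linearStat (h : GaussianCoefficients P a ξ)
    (hG : ∀ z, G z = ∑' n, ((a n ^ 2 : ℝ) : ℂ) * z ^ n) (hadm : IsAdmissible G) (k : ℕ) {c : ℝ}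
    (hkc : (k : ℝ) < c) (hc : ∀ᶠ r in atTop, r ^ c ≤ haymanB G r) :
    ∃ m : ℕ → ℂ, ∀ᵐ ω ∂P, Tendsto (fun j : ℕ =>
      linearStat k (gaussianSeries a ξ ω) (Real.exp j) - m j) atTop (𝓝 0) := by
  have hD := fun j : ℕ => h.radialMean_ae_eq hG hadm.entire.continuous k (Real.exp_pos j)
  choose D hD using hD
  have hpi : (2 * Real.pi : ℂ) ≠ 0 := by
    have := Real.pi_ne_zero
    exact_mod_cast (by positivity : 2 * Real.pi ≠ 0)
  refine ⟨fun j => (outerWeight k * D (j + 1) + innerWeight k * D j) / (2 * Real.pi), ?_⟩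
  filter_upwards [h.ae_tendsto_fluctuation hG hadm k hkc hc, ae_all_iff.2 hD] with ω h1 h2
  have h3 := (((tendsto_add_atTop_iff_nat 1).2 h1).const_mul (outerWeight k : ℂ)).add
    (h1.const_mul (innerWeight k : ℂ))
  have h4 := h3.div_const (2 * Real.pi : ℂ)
  simp only [mul_zero, add_zero, zero_div] at h4
  refine h4.congr fun j => ?_
  have e : Real.exp 1 * Real.exp j = Real.exp (j + 1 : ℕ) := by
    rw [← Real.exp_add]; push_cast; ring_nf
  rw [linearStat, e]
  have a1 : radialMean k (gaussianSeries a ξ ω) (Real.exp (j + 1 : ℕ))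
      = (fluctuation G a ξ k (Real.exp (j + 1 : ℕ)) ω + D (j + 1)) / (2 * Real.pi) := by
    rw [eq_div_iff hpi, mul_comm]; exact h2 (j + 1)
  have a2 : radialMean k (gaussianSeries a ξ ω) (Real.exp j)
      = (fluctuation G a ξ k (Real.exp j) ω + D j) / (2 * Real.pi) := by
    rw [eq_div_iff hpi, mul_comm]; exact h2 j
  rw [a1, a2]
  ring

end GaussianCoefficients

/-! ### Almost sure simplicity of the zeros -/

section PowerSeries

variable {c : ℕ → ℂ}

lemma summable_natCast_mul (hc : ∀ R : ℝ, 0 ≤ R → Summable fun n => ‖c n‖ * R ^ n) (R : ℝ)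
    (hR : 0 ≤ R) : Summable fun n : ℕ => ‖(n : ℂ) * c n‖ * R ^ n := by
  refine Summable.of_nonneg_of_le (fun n => by positivity) (fun n => ?_) (hc (2 * R) (by positivity))
  rw [norm_mul, Complex.norm_natCast, mul_pow]
  have : (n : ℝ) ≤ 2 ^ n := by exact_mod_cast Nat.lt_two_pow_self.le
  calc (n : ℝ) * ‖c n‖ * R ^ n = ‖c n‖ * (n * R ^ n) := by ring
    _ ≤ _ := by gcongr

lemma mul_deriv_tsum_mul_pow (hc : ∀ R : ℝ, 0 ≤ R → Summable fun n => ‖c n‖ * R ^ n) (z : ℂ) :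
    z * deriv (fun z => ∑' n, c n * z ^ n) z = ∑' n : ℕ, (n * c n) * z ^ n := by
  set R := ‖z‖ + 1 with hR
  have hR1 : 1 ≤ R := by rw [hR]; linarith [norm_nonneg z]
  have hd : HasDerivAt (fun z => ∑' n, c n * z ^ n) (∑' n : ℕ, c n * (n * z ^ (n - 1))) z := by
    refine hasDerivAt_tsum_of_isPreconnected (u := fun n : ℕ => ‖(n : ℂ) * c n‖ * R ^ n)
      (summable_natCast_mul hc R (by positivity)) (t := Metric.ball 0 R) Metric.isOpen_ball
      (convex_ball _ _).isPreconnected (fun n y _ => (hasDerivAt_pow n y).const_mul (c n))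
      (fun n y hy => ?_) (y₀ := 0) (by simp; linarith) (hasSum_mul_pow hc 0).summable (by simp [hR])
    rw [← mul_assoc, mul_comm (c n), norm_mul, norm_pow]
    have hy' : ‖y‖ ≤ R := (mem_ball_zero_iff.1 hy).le
    gcongr
    calc ‖y‖ ^ (n - 1) ≤ R ^ (n - 1) := by gcongr
      _ ≤ R ^ n := pow_le_pow_right₀ hR1 (Nat.sub_le n 1)
  rw [hd.deriv, ← tsum_mul_left]
  congr 1
  ext n
  rcases Nat.eq_zero_or_pos n with rfl | hn
  · simp
  · obtain ⟨k, rfl⟩ := Nat.exists_eq_add_of_le' hn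
    simp only [Nat.add_sub_cancel]
    rw [pow_succ]; ring

lemma eq_zero_of_tsum_mul_pow_eq_zero (hc : ∀ R : ℝ, 0 ≤ R → Summable fun n => ‖c n‖ * R ^ n)
    (h0 : ∀ z, ∑' n, c n * z ^ n = 0) (n : ℕ) : c n = 0 := by
  have h1 : HasFPowerSeriesAt (0 : ℂ → ℂ) (FormalMultilinearSeries.ofScalars ℂ c) 0 := by
    rw [hasFPowerSeriesAt_iff]
    refine Eventually.of_forall fun z => ?_
    have := hasSum_mul_pow hc z
    rw [h0 z] at this
    simpa [FormalMultilinearSeries.coeff_ofScalars, mul_comm] using this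
  have h2 := h1.eq_zero
  have h3 : (FormalMultilinearSeries.ofScalars ℂ c).coeff n = 0 := by rw [h2]; rfl
  rwa [FormalMultilinearSeries.coeff_ofScalars] at h3

end PowerSeries

/-- By compactness a zero exists exactly when |ψ s| takes arbitrarily small values on a countable
dense subset, which is a countable condition. -/
lemma measurableSet_exists_eq_zero {S X : Type*} [MeasurableSpace S] [PseudoMetricSpace X]
    {ψ : S → X → ℝ} (hm : ∀ x, Measurable fun s => ψ s x)
    (hc : ∀ s, Continuous (ψ s)) {K : Set X} (hK : IsCompact K) :
    MeasurableSet {s | ∃ x ∈ K, ψ s x = 0} := by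
  obtain ⟨D, hDK, hDc, hKD⟩ := hK.isSeparable.exists_countable_dense_subset
  have : {s | ∃ x ∈ K, ψ s x = 0} = ⋂ j : ℕ, ⋃ q ∈ D, {s | |ψ s q| < 1 / ((j : ℝ) + 1)} := by
    ext s
    simp only [Set.mem_ofPred_eq, Set.mem_iInter, Set.mem_iUnion, exists_prop]
    constructor
    · rintro ⟨x, hx, h0⟩ j
      have hopen : IsOpen {y | |ψ s y| < 1 / ((j : ℝ) + 1)} :=
        isOpen_lt (hc s).abs continuous_const
      obtain ⟨y, hy, hyD⟩ := mem_closure_iff.1 (hKD hx) _ hopen (by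
        simp only [Set.mem_ofPred_eq, h0, abs_zero]; positivity)
      exact ⟨y, hyD, hy⟩
    · intro h
      obtain ⟨q₀, hq₀, -⟩ := h 0
      obtain ⟨x, hx, hmin⟩ := hK.exists_isMinOn ⟨q₀, hDK hq₀⟩ (hc s).abs.continuousOn
      refine ⟨x, hx, abs_eq_zero.1 (le_antisymm ?_ (abs_nonneg _))⟩
      refine ge_of_tendsto' tendsto_one_div_add_atTop_nhds_zero_nat fun j => ?_
      obtain ⟨q, hq, hlt⟩ := h j
      exact (hmin (hDK hq)).trans hlt.le
  rw [this]
  exact MeasurableSet.iInter fun j => MeasurableSet.biUnion hDc fun q _ =>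
    measurableSet_lt (hm q).abs measurable_const

/-- The coefficient sequences whose power series with weights `a` converges everywhere. -/
def ConvergentCoefficients (a : ℕ → ℝ) : Type :=
  {v : ℕ → ℂ // ∀ R : ℝ, 0 ≤ R → Summable fun n => ‖v n * a n‖ * R ^ n}

instance measurableSpace_convergentCoefficients (a : ℕ → ℝ) :
    MeasurableSpace (ConvergentCoefficients a) :=
  inferInstanceAs (MeasurableSpace (Subtype fun v : ℕ → ℂ =>
    ∀ R : ℝ, 0 ≤ R → Summable fun n => ‖v n * a n‖ * R ^ n))

namespace ConvergentCoefficients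

variable {a : ℕ → ℝ}

lemma summable_shift (v : ConvergentCoefficients a) (m : ℕ) (R : ℝ) (hR : 0 ≤ R) :
    Summable fun n : ℕ => ‖((n : ℂ) - m) * (v.1 n * a n)‖ * R ^ n := by
  refine Summable.of_nonneg_of_le (fun n => by positivity) (fun n => ?_)
    ((summable_natCast_mul v.2 R hR).add ((v.2 R hR).mul_left (m : ℝ)))
  rw [sub_mul]
  calc _ ≤ (‖(n : ℂ) * (v.1 n * a n)‖ + ‖(m : ℂ) * (v.1 n * a n)‖) * R ^ n := by
        gcongr; exact norm_sub_le _ _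
    _ = _ := by rw [norm_mul (m : ℂ), Complex.norm_natCast]; ring

lemma measurable_tsum (d : ℕ → ℂ) (z : ℂ)
    (hd : ∀ v : ConvergentCoefficients a, Summable fun n => d n * (v.1 n * a n) * z ^ n) :
    Measurable fun v : ConvergentCoefficients a => ∑' n, d n * (v.1 n * a n) * z ^ n := by
  refine measurable_of_tendsto_metrizable
    (f := fun N (v : ConvergentCoefficients a) ↦ ∑ n ∈ Finset.range N, d n * (v.1 n * a n) * z ^ n)
    (fun N => Finset.measurable_sum _ fun n _ => ?_)
    (tendsto_pi_nhds.2 fun v => (hd v).hasSum.tendsto_sum_nat)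
  have : Measurable fun v : ConvergentCoefficients a => v.1 n :=
    (measurable_pi_apply n).comp measurable_subtype_coe
  exact ((this.mul_const _).const_mul _).mul_const _

end ConvergentCoefficients

namespace GaussianCoefficients

variable {Ω : Type*} [MeasurableSpace Ω] {P : Measure Ω} {a : ℕ → ℝ} {ξ : ℕ → Ω → ℂ}

lemma summable_update (h : GaussianCoefficients P a ξ) (m : ℕ) (ω : Ω) (R : ℝ) (hR : 0 ≤ R) :
    Summable fun n => ‖Function.update (fun n => ξ n ω) m 0 n * a n‖ * R ^ n := by
  refine Summable.of_nonneg_of_le (fun n => by positivity) (fun n => ?_) (h.summable ω R hR)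
  gcongr
  rcases eq_or_ne n m with rfl | hn
  · rw [Function.update_self, zero_mul, norm_zero]
    exact norm_nonneg _
  · rw [Function.update_of_ne hn]

/-- The coefficients with the `m`-th one replaced by `0`. -/
def removeCoefficient (h : GaussianCoefficients P a ξ) (m : ℕ) (ω : Ω) : ConvergentCoefficients a :=
  ⟨Function.update (fun n => ξ n ω) m 0, h.summable_update m ω⟩

lemma gaussianSeries_eq_add (h : GaussianCoefficients P a ξ) (m : ℕ) (ω : Ω) (z : ℂ) :
    gaussianSeries a ξ ω z
      = ξ m ω * a m * z ^ m + ∑' n, (h.removeCoefficient m ω).1 n * a n * z ^ n := by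
  have h1 := hasSum_mul_pow (h.summable_update m ω) z
  have h2 := h1.add (hasSum_ite_eq m (ξ m ω * a m * z ^ m))
  have h3 : (fun n => Function.update (fun n => ξ n ω) m 0 n * a n * z ^ n
      + if n = m then ξ m ω * a m * z ^ m else 0) = fun n => ξ n ω * a n * z ^ n := by
    ext n
    rcases eq_or_ne n m with rfl | hn
    · simp
    · simp [hn]
  rw [h3] at h2
  rw [add_comm]
  exact (h.hasSum ω z).unique h2

lemma measurable_removeCoefficient (h : GaussianCoefficients P a ξ) (m : ℕ) :
    Measurable (h.removeCoefficient m) := by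
  refine Measurable.subtype_mk (measurable_pi_lambda _ fun n => ?_)
  rcases eq_or_ne n m with rfl | hn
  · simp
  · simp only [Function.update_of_ne hn]
    exact h.measurable n

lemma indepFun_removeCoefficient (h : GaussianCoefficients P a ξ) (m : ℕ) :
    IndepFun (ξ m) (h.removeCoefficient m) P := by
  have h1 := indep_iSup_of_disjoint (fun n => (h.measurable n).comap_le) h.indep
    (S := {m}) (T := {m}ᶜ) disjoint_compl_right
  rw [IndepFun_iff_Indep]
  refine indep_of_indep_of_le_left (indep_of_indep_of_le_right h1 ?_) ?_
  · rw [← measurable_iff_comap_le]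
    refine @Measurable.subtype_mk _ _ _ (_) _ _ (@measurable_pi_lambda _ _ _ (_) _ _ fun n => ?_) _
    rcases eq_or_ne n m with rfl | hn
    · simp only [Function.update_self]
      exact measurable_const
    · simp only [Function.update_of_ne hn]
      exact (comap_measurable (ξ n)).mono (le_iSup₂_of_le n hn le_rfl) le_rfl
  · simp

lemma ae_coefficient_ne_zero (h : GaussianCoefficients P a ξ) (n : ℕ) : ∀ᵐ ω ∂P, ξ n ω ≠ 0 := by
  have h1 : ∀ᵐ w ∂stdComplexGaussian, w ≠ 0 := by simp [ae_iff]
  rw [← h.law n] at h1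
  exact ae_of_ae_map (h.measurable n).aemeasurable h1

variable [IsProbabilityMeasure P]

/-- Almost surely all zeros of a Gaussian entire function, except possibly the origin, are simple. -/
lemma ae_deriv_ne_zero (h : GaussianCoefficients P a ξ) :
    ∀ᵐ ω ∂P, ∀ z, z ≠ 0 → gaussianSeries a ξ ω z = 0 → deriv (gaussianSeries a ξ ω) z ≠ 0 := by
  obtain ⟨m, hm⟩ := h.infinite.nonempty
  obtain ⟨l, hl, hlm⟩ := h.infinite.exists_gt m
  have ham : (a m : ℂ) ≠ 0 := by exact_mod_cast hm
  have hal : (a l : ℂ) ≠ 0 := by exact_mod_cast hl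
  -- Write f = ξ_m a_m z^m + H. Then zf' - mf = zH' - mH = Q does not involve ξ_m, so a double zero
  -- z ≠ 0 lies in the zero set of Q, which the other coefficients determine. For each such z only
  -- one value of ξ_m gives f(z) = 0, and the Gaussian law of ξ_m, independent of the rest, avoids a
  -- countable set almost surely.
  set H : ConvergentCoefficients a → ℂ → ℂ := fun v z => ∑' n, v.1 n * a n * z ^ n with hH
  set Q : ConvergentCoefficients a → ℂ → ℂ :=
    fun v z => ∑' n : ℕ, ((n : ℂ) - m) * (v.1 n * a n) * z ^ n with hQ
  have cH : ∀ v, Differentiable ℂ (H v) := fun v => differentiable_tsum_mul_pow v.2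
  have cQ : ∀ v, Differentiable ℂ (Q v) := fun v => differentiable_tsum_mul_pow (v.summable_shift m)
  have mH : ∀ z, Measurable fun v => H v z := by
    intro z
    have := ConvergentCoefficients.measurable_tsum (a := a) (fun _ => 1) z
      (fun v => by simpa using (hasSum_mul_pow v.2 z).summable)
    simpa using this
  have mQ : ∀ z, Measurable fun v => Q v z := fun z =>
    ConvergentCoefficients.measurable_tsum (fun n : ℕ => (n : ℂ) - m) z
      (fun v => (hasSum_mul_pow (v.summable_shift m) z).summable)
  set bad : Set (ℂ × ConvergentCoefficients a) :=
    {p | ∃ z, z ≠ 0 ∧ p.1 * a m * z ^ m + H p.2 z = 0 ∧ Q p.2 z = 0} with hbad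
  have hbadm : MeasurableSet bad := by
    -- The punctured plane is exhausted by compact annuli, and the two equations become one
    -- vanishing sum of norms.
    have : bad = ⋃ N : ℕ, {p : ℂ × ConvergentCoefficients a |
        ∃ z ∈ Metric.closedBall (0 : ℂ) N \ Metric.ball 0 (1 / ((N : ℝ) + 1)),
          ‖p.1 * a m * z ^ m + H p.2 z‖ + ‖Q p.2 z‖ = 0} := by
      ext p
      simp only [hbad, Set.mem_ofPred_eq, Set.mem_iUnion]
      constructor
      · rintro ⟨z, hz, h1, h2⟩
        have hz' := norm_pos_iff.2 hz
        obtain ⟨N₁, hN₁⟩ := exists_nat_ge ‖z‖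
        obtain ⟨N₂, hN₂⟩ := exists_nat_one_div_lt hz'
        refine ⟨max N₁ N₂, z, ⟨?_, ?_⟩, by rw [h1, h2]; simp⟩
        · rw [mem_closedBall_zero_iff]
          exact hN₁.trans (by exact_mod_cast le_max_left _ _)
        · rw [mem_ball_zero_iff, not_lt]
          refine le_trans ?_ hN₂.le
          gcongr
          exact le_max_right _ _
      · rintro ⟨N, z, hz, h0⟩
        have n1 := norm_nonneg (p.1 * a m * z ^ m + H p.2 z)
        have n2 := norm_nonneg (Q p.2 z)
        refine ⟨z, ?_, norm_eq_zero.1 (by linarith), norm_eq_zero.1 (by linarith)⟩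
        · rintro rfl
          exact hz.2 (Metric.mem_ball_self (by positivity))
    rw [this]
    refine MeasurableSet.iUnion fun N => measurableSet_exists_eq_zero
      (ψ := fun (p : ℂ × ConvergentCoefficients a) z => ‖p.1 * a m * z ^ m + H p.2 z‖ + ‖Q p.2 z‖)
      (fun z => ?_) (fun p => ?_) ((isCompact_closedBall (0 : ℂ) N).diff Metric.isOpen_ball)
    · exact (((measurable_fst.mul_const _).mul_const _).add ((mH z).comp measurable_snd)).norm.add
        ((mQ z).comp measurable_snd).norm
    · have h1 := (cH p.2).continuous
      have h2 := (cQ p.2).continuous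
      fun_prop
  have hmeas := h.measurable_removeCoefficient m
  have hprob := Measure.isProbabilityMeasure_map (μ := P) hmeas.aemeasurable
  have hprod := (indepFun_iff_map_prod_eq_prod_map_map (h.measurable m).aemeasurable
    hmeas.aemeasurable).1 (h.indepFun_removeCoefficient m)
  rw [h.law m] at hprod
  have hQne : ∀ᵐ v ∂(P.map (h.removeCoefficient m)), v.1 l ≠ 0 := by
    have hset : MeasurableSet {v : ConvergentCoefficients a | v.1 l ≠ 0} :=
      ((measurable_pi_apply l).comp measurable_subtype_coe) (measurableSet_singleton 0).compl
    rw [ae_map_iff hmeas.aemeasurable hset]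
    filter_upwards [h.ae_coefficient_ne_zero l] with ω hω
    simpa [removeCoefficient, Function.update_of_ne hlm.ne'] using hω
  have hnull : (stdComplexGaussian.prod (P.map (h.removeCoefficient m))) bad = 0 := by
    rw [Measure.prod_apply_symm hbadm]
    refine lintegral_eq_zero_of_ae_eq_zero ?_
    filter_upwards [hQne] with v hv
    -- The coefficient of z^l in Q is (l - m) v_l a_l, nonzero because l ≠ m.
    have hQv : ∃ x, Q v x ≠ 0 := by
      by_contra! hcon
      have h1 := eq_zero_of_tsum_mul_pow_eq_zero (v.summable_shift m) hcon l
      have h2 : ((l : ℂ) - m) ≠ 0 := by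
        rw [sub_ne_zero]
        exact_mod_cast hlm.ne'
      exact mul_ne_zero h2 (mul_ne_zero hv hal) h1
    obtain ⟨x, hx⟩ := hQv
    have hcount := (countable_zeros (cQ v) hx).image fun z => -H v z / (a m * z ^ m)
    refine measure_mono_null ?_ (hcount.measure_zero _)
    rintro y ⟨z, hz, h1, h2⟩
    refine ⟨z, h2, ?_⟩
    have hzm : z ^ m ≠ 0 := pow_ne_zero m hz
    simp only
    rw [div_eq_iff (mul_ne_zero ham hzm)]
    linear_combination -h1
  rw [← hprod] at hnull
  have hae : ∀ᵐ ω ∂P, (ξ m ω, h.removeCoefficient m ω) ∉ bad := by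
    have := (measure_eq_zero_iff_ae_notMem).1 hnull
    exact ae_of_ae_map ((h.measurable m).prodMk hmeas).aemeasurable this
  filter_upwards [hae] with ω hω z hz h0 hd
  refine hω ⟨z, hz, ?_, ?_⟩
  · rw [← h0, h.gaussianSeries_eq_add m ω z]
  · have e1 : z * deriv (gaussianSeries a ξ ω) z - m * gaussianSeries a ξ ω z
        = z * deriv (H (h.removeCoefficient m ω)) z - m * H (h.removeCoefficient m ω) z := by
      have hfun : gaussianSeries a ξ ω
          = fun z => ξ m ω * a m * z ^ m + H (h.removeCoefficient m ω) z := by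
        ext w; exact h.gaussianSeries_eq_add m ω w
      have hder : HasDerivAt (gaussianSeries a ξ ω) (ξ m ω * a m * (m * z ^ (m - 1))
          + deriv (H (h.removeCoefficient m ω)) z) z := by
        rw [hfun]
        exact ((hasDerivAt_pow m z).const_mul _).add (cH _ z).hasDerivAt
      rw [hder.deriv, h.gaussianSeries_eq_add m ω z]
      have : z * (m * z ^ (m - 1)) = m * z ^ m := by
        rcases Nat.eq_zero_or_pos m with h0 | hm0
        · simp [h0]
        · obtain ⟨k, hk⟩ := Nat.exists_eq_add_of_le' hm0
          rw [hk, Nat.add_sub_cancel, pow_succ]; ring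
      linear_combination ξ m ω * a m * this
    rw [h0, hd, mul_zero, mul_zero, sub_zero, mul_deriv_tsum_mul_pow (h.removeCoefficient m ω).2]
      at e1
    rw [e1, ← tsum_mul_left, ← Summable.tsum_sub]
    · refine tsum_congr fun n => ?_
      ring
    · exact (hasSum_mul_pow (summable_natCast_mul (h.removeCoefficient m ω).2) z).summable
    · exact (hasSum_mul_pow (h.removeCoefficient m ω).2 z).summable.mul_left _

end GaussianCoefficients

namespace GaussianCoefficients

variable {Ω : Type*} [MeasurableSpace Ω] {P : Measure Ω} [IsProbabilityMeasure P] {a : ℕ → ℝ}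
  {ξ : ℕ → Ω → ℂ}

/-- Almost surely the random series is a fixed power of `z` times an entire function which has
simple zeros only and does not vanish at the origin. -/
lemma exists_ae_factorization (h : GaussianCoefficients P a ξ) :
    ∃ m : ℕ, ∀ᵐ ω ∂P, ∃ g : ℂ → ℂ, Differentiable ℂ g ∧
      (∀ z, gaussianSeries a ξ ω z = z ^ m * g z) ∧ g 0 ≠ 0 ∧ ∀ z, g z = 0 → deriv g z ≠ 0 := by
  classical
  have hex : ∃ n, a n ≠ 0 := h.infinite.nonempty
  -- The least index with a_m ≠ 0; it is the order of vanishing at the origin whenever ξ_m ≠ 0.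
  refine ⟨Nat.find hex, ?_⟩
  set m := Nat.find hex with hm
  filter_upwards [h.ae_coefficient_ne_zero m, h.ae_deriv_ne_zero] with ω hω hsimple
  set c : ℕ → ℂ := fun n => ξ n ω * a n with hc
  have hc0 : ∀ n < m, c n = 0 := fun n hn => by
    have : a n = 0 := not_not.1 (Nat.find_min hex hn)
    simp [hc, this]
  have hshift : ∀ R : ℝ, 0 ≤ R → Summable fun n => ‖c (n + m)‖ * R ^ n := by
    intro R hR
    have h1 := (summable_nat_add_iff m).2 (h.summable ω (R + 1) (by positivity))
    refine Summable.of_nonneg_of_le (fun n => by positivity) (fun n => ?_) h1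
    gcongr
    calc R ^ n ≤ (R + 1) ^ n := by gcongr; linarith
      _ ≤ (R + 1) ^ (n + m) := pow_le_pow_right₀ (by linarith) (Nat.le_add_right n m)
  set g : ℂ → ℂ := fun z => ∑' n, c (n + m) * z ^ n with hg
  have hgd : Differentiable ℂ g := differentiable_tsum_mul_pow hshift
  have hfac : ∀ z, gaussianSeries a ξ ω z = z ^ m * g z := by
    intro z
    have h1 := (h.hasSum ω z).summable.sum_add_tsum_nat_add m
    have h2 : ∑ n ∈ Finset.range m, ξ n ω * a n * z ^ n = 0 :=
      Finset.sum_eq_zero fun n hn => by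
        have := hc0 n (Finset.mem_range.1 hn)
        simp only [hc] at this
        rw [this, zero_mul]
    rw [h2, zero_add] at h1
    rw [gaussianSeries, ← h1, hg, ← tsum_mul_left]
    refine tsum_congr fun n => ?_
    simp only [hc, pow_add]
    ring
  have hg0 : g 0 ≠ 0 := by
    have : g 0 = c m := by
      simp only [hg]
      rw [tsum_eq_single 0 (fun n hn => by simp [hn])]
      simp
    rw [this]
    have ham : (a m : ℂ) ≠ 0 := by exact_mod_cast Nat.find_spec hex
    exact mul_ne_zero hω ham
  refine ⟨g, hgd, hfac, hg0, fun z hz hd => ?_⟩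
  have hz0 : z ≠ 0 := by
    rintro rfl
    exact hg0 hz
  refine hsimple z hz0 (by rw [hfac, hz, mul_zero]) ?_
  have h1 : HasDerivAt (gaussianSeries a ξ ω) (m * z ^ (m - 1) * g z + z ^ m * deriv g z) z := by
    rw [funext hfac]
    exact (hasDerivAt_pow m z).mul (hgd z).hasDerivAt
  rw [h1.deriv, hz, hd, mul_zero, mul_zero, add_zero]

end GaussianCoefficients

/-! ### Reconstruction of the moments and conclusion -/

section Reconstruction

variable {F g : ℂ → ℂ} {m : ℕ}

lemma finite_inter_zeros_of_factorization (hg : Differentiable ℂ g)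
    (hF : ∀ z, F z = z ^ m * g z) (hg0 : g 0 ≠ 0) {K : Set ℂ} (hK : IsCompact K) :
    (K ∩ F ⁻¹' {0}).Finite := by
  refine ((Set.finite_singleton (0 : ℂ)).union (finite_inter_zeros hg hg0 hK)).subset ?_
  rintro z ⟨hzK, hz⟩
  have hz' : z ^ m * g z = 0 := by rw [← hF z]; exact hz
  rcases mul_eq_zero.1 hz' with h0 | h0
  · exact Or.inl (eq_zero_of_pow_eq_zero h0)
  · exact Or.inr ⟨hzK, h0⟩

/-- The `k`-th moment of the zeros in `D`, computed from the configuration `C` of the zeros outside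
`D`, the compensators `μ` and the order `m` of the zero at the origin. -/
def momentFromOutside (k m : ℕ) (μ : ℕ → ℂ) (D C : Set ℂ) : ℂ := by
  classical
  -- A `limUnder` is defined for every configuration and is meaningful where the limit exists. The
  -- statistic counts the origin m times whereas a sum over a set counts it at most once, so its
  -- contribution is removed and then restored once when 0 lies in D and is a zero.
  exact limUnder atTop (fun j : ℕ => μ j - m * 0 ^ k
      - ∑ᶠ a ∈ C \ {0}, linearStat k (fun z => z - a) (Real.exp j))
    + if (0 : ℂ) ∈ D ∧ 0 < m then 0 ^ k else 0

/-- Once e^j exceeds the radius of D, every zero in D away from the origin enters `linearStat` as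
exactly z^k; subtracting the outer contributions isolates the moment up to an error tending to 0. -/
lemma finsum_pow_eq_momentFromOutside (hg : Differentiable ℂ g)
    (hF : ∀ z, F z = z ^ m * g z) (hg0 : g 0 ≠ 0) (hsimple : ∀ z, g z = 0 → deriv g z ≠ 0)
    {k : ℕ} {μ : ℕ → ℂ}
    (hlim : Tendsto (fun j : ℕ => linearStat k F (Real.exp j) - μ j) atTop (𝓝 0))
    {D : Set ℂ} (hD : Bornology.IsBounded D) :
    ∑ᶠ z ∈ D ∩ F ⁻¹' {0}, z ^ k = momentFromOutside k m μ D (F ⁻¹' {0} ∩ Dᶜ) := by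
  classical
  obtain ⟨R, hR⟩ := hD.subset_closedBall (0 : ℂ)
  have hfin : ∀ K : Set ℂ, IsCompact K → (K ∩ g ⁻¹' {0}).Finite := fun K hK =>
    finite_inter_zeros hg hg0 hK
  have hDfin : (D ∩ g ⁻¹' {0}).Finite :=
    (hfin _ (isCompact_closedBall 0 R)).subset (Set.inter_subset_inter_left _ hR)
  have hdiff : (F ⁻¹' {0} ∩ Dᶜ) \ {0} = g ⁻¹' {0} \ D := by
    ext z
    simp only [Set.mem_sdiff, Set.mem_inter_iff, Set.mem_preimage, Set.mem_singleton_iff,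
      Set.mem_compl_iff, hF, mul_eq_zero]
    constructor
    · rintro ⟨⟨h1 | h1, h2⟩, h3⟩
      · exact absurd (eq_zero_of_pow_eq_zero h1) h3
      · exact ⟨h1, h2⟩
    · rintro ⟨h1, h2⟩
      refine ⟨⟨Or.inr h1, h2⟩, ?_⟩
      rintro rfl
      exact hg0 h1
  have hinside : ∑ᶠ z ∈ D ∩ F ⁻¹' {0}, z ^ k
      = ∑ᶠ z ∈ D ∩ g ⁻¹' {0}, z ^ k + if (0 : ℂ) ∈ D ∧ 0 < m then 0 ^ k else 0 := by
    split_ifs with h0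
    · have : D ∩ F ⁻¹' {0} = insert 0 (D ∩ g ⁻¹' {0}) := by
        ext z
        simp only [Set.mem_inter_iff, Set.mem_preimage, Set.mem_singleton_iff, hF, mul_eq_zero,
          Set.mem_insert_iff, pow_eq_zero_iff h0.2.ne']
        constructor
        · rintro ⟨h1, h2 | h2⟩
          · exact Or.inl h2
          · exact Or.inr ⟨h1, h2⟩
        · rintro (rfl | ⟨h1, h2⟩)
          · exact ⟨h0.1, Or.inl rfl⟩
          · exact ⟨h1, Or.inr h2⟩
      rw [this, finsum_mem_insert _ (fun h => hg0 h.2) hDfin, add_comm]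
    · have : D ∩ F ⁻¹' {0} = D ∩ g ⁻¹' {0} := by
        ext z
        simp only [Set.mem_inter_iff, Set.mem_preimage, Set.mem_singleton_iff, hF, mul_eq_zero,
          pow_eq_zero_iff']
        constructor
        · rintro ⟨h1, ⟨rfl, h2⟩ | h2⟩
          · exact absurd ⟨h1, Nat.pos_of_ne_zero h2⟩ h0
          · exact ⟨h1, h2⟩
        · exact fun h => ⟨h.1, Or.inr h.2⟩
      rw [this, add_zero]
  rw [hinside, momentFromOutside, hdiff]
  congr 1
  refine (Tendsto.limUnder_eq ?_).symm
  have hlim' : Tendsto (fun j : ℕ => ∑ᶠ z ∈ D ∩ g ⁻¹' {0}, z ^ k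
      - (linearStat k F (Real.exp j) - μ j)) atTop (𝓝 (∑ᶠ z ∈ D ∩ g ⁻¹' {0}, z ^ k)) := by
    simpa using tendsto_const_nhds.sub hlim
  refine hlim'.congr' ?_
  have hlarge : ∀ᶠ j : ℕ in atTop, R < Real.exp j :=
    (Real.tendsto_exp_atTop.comp tendsto_natCast_atTop_atTop).eventually_gt_atTop R
  filter_upwards [hlarge] with j hj
  set L := Real.exp j with hL
  have hL0 : 0 < L := Real.exp_pos _
  have hsupp : (g ⁻¹' {0} ∩ Function.support fun a => linearStat k (fun z => z - a) L).Finite := by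
    refine (hfin _ (isCompact_closedBall 0 (Real.exp 1 * L * Real.exp 1))).subset ?_
    rintro a ⟨ha, hs⟩
    refine ⟨?_, ha⟩
    rw [mem_closedBall_zero_iff]
    by_contra! hlt
    refine hs (linearStat_eq_zero_of_ne_zero k (R := ‖a‖) (by fun_prop) (fun z hz h0 => ?_) hL0 hlt)
    rw [sub_eq_zero] at h0
    rw [h0, mem_ball_zero_iff] at hz
    exact lt_irrefl _ hz
  have hsplit := finsum_mem_inter_add_sdiff' D hsupp
  have hin : ∑ᶠ a ∈ g ⁻¹' {0} ∩ D, linearStat k (fun z => z - a) L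
      = ∑ᶠ z ∈ D ∩ g ⁻¹' {0}, z ^ k := by
    rw [Set.inter_comm]
    refine finsum_mem_congr rfl fun a ha => linearStat_sub_of_norm_lt k ?_
    exact (mem_closedBall_zero_iff.1 (hR ha.1)).trans_lt hj
  rw [linearStat_eq_sum_zeros k m hg hF hg0 hsimple hL0, ← hsplit, hin]
  ring

end Reconstruction

lemma GaussianCoefficients.exists_moment_reconstruction {Ω : Type*} [MeasurableSpace Ω]
    {P : Measure Ω} [IsProbabilityMeasure P] {a : ℕ → ℝ} {ξ : ℕ → Ω → ℂ} {f : Ω → ℂ → ℂ}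
    {G : ℂ → ℂ} (h : GaussianCoefficients P a ξ) (hf : ∀ᵐ ω ∂P, f ω = gaussianSeries a ξ ω)
    (hG : ∀ z, G z = ∑' n, ((a n ^ 2 : ℝ) : ℂ) * z ^ n) (hadm : IsAdmissible G) {k : ℕ} {c : ℝ}
    (hkc : (k : ℝ) < c) (hc : ∀ᶠ r in atTop, r ^ c ≤ haymanB G r) {D : Set ℂ}
    (hD : Bornology.IsBounded D) :
    ∃ S : LocallyFiniteConfig Dᶜ → ℂ, ∀ᵐ ω ∂P, (D ∩ zeroSet f ω).Finite ∧
      ∃ hZ : zeroSet f ω ∩ Dᶜ ∈ LocallyFiniteConfig Dᶜ,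
        ∑ᶠ z ∈ D ∩ zeroSet f ω, z ^ k = S ⟨zeroSet f ω ∩ Dᶜ, hZ⟩ := by
  obtain ⟨μ, hμ⟩ := h.exists_ae_tendsto_linearStat hG hadm k hkc hc
  obtain ⟨m, hm⟩ := h.exists_ae_factorization
  refine ⟨fun C => momentFromOutside k m μ D C, ?_⟩
  filter_upwards [hf, hμ, hm] with ω hω hlim ⟨g, hg, hF, hg0, hsimple⟩
  have hfin : ∀ K : Set ℂ, IsCompact K → (K ∩ zeroSet f ω).Finite := fun K hK => by
    rw [zeroSet, hω]
    exact finite_inter_zeros_of_factorization hg hF hg0 hK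
  obtain ⟨R, hR⟩ := hD.subset_closedBall (0 : ℂ)
  refine ⟨(hfin _ (isCompact_closedBall 0 R)).subset (Set.inter_subset_inter_left _ hR),
    ⟨Set.inter_subset_right, fun K hK => (hfin K hK).subset fun z hz => ⟨hz.2, hz.1.1⟩⟩, ?_⟩
  simp only [zeroSet, hω]
  exact finsum_pow_eq_momentFromOutside hg hF hg0 hsimple hlim hD

lemma IsAdmissible.rpow_le_haymanB {G : ℂ → ℂ} (hG : IsAdmissible G) {c : ℝ}
    (hc : ∀ᶠ r : ℝ in atTop, c < Real.log (haymanB G r) / Real.log r) :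
    ∀ᶠ r in atTop, r ^ c ≤ haymanB G r := by
  filter_upwards [hc, hG.tendsto_b.eventually_gt_atTop 0, eventually_gt_atTop 1] with r h1 h2 h3
  rw [lt_div_iff₀ (Real.log_pos h3)] at h1
  rw [← Real.log_le_log_iff (Real.rpow_pos_of_pos (by linarith) c) h2,
    Real.log_rpow (by linarith)]
  exact h1.le

lemma exists_eventually_lt_of_lt_growthExponent {G : ℂ → ℂ} {x : ℝ}
    (hx : (x : EReal) < growthExponent G) :
    ∃ c, x < c ∧ ∀ᶠ r : ℝ in atTop, c < Real.log (haymanB G r) / Real.log r := by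
  obtain ⟨c, h1, h2⟩ := EReal.lt_iff_exists_real_btwn.1 hx
  refine ⟨c, by exact_mod_cast h1, ?_⟩
  filter_upwards [eventually_lt_of_lt_liminf h2] with r hr
  exact_mod_cast hr

end

theorem theorem1 {Ω : Type*} [MeasurableSpace Ω] (P : Measure Ω) [IsProbabilityMeasure P]
    (f : Ω → ℂ → ℂ) (G : ℂ → ℂ)
    (hf : IsGaussianEntireFunction P f) (hfG : HasCovarianceKernel P f G)
    (hG : IsAdmissible G) (hB : 0 < growthExponent G) :
    (∀ B : ℝ, growthExponent G = (B : EReal) →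
      IsRigidOfLevel P (zeroSet f) ((⌈B⌉₊ : ℕ) : ℕ∞)) ∧
    (Tendsto (fun r : ℝ => Real.log (haymanB G r) / Real.log r) atTop atTop →
      IsFullyRigid P (zeroSet f)) := by
  obtain ⟨a, ξ, h, hfa⟩ := hf.exists_gaussianCoefficients
  have hGa := h.eq_tsum_of_hasCovarianceKernel hfa hG.entire hfG
  constructor
  · intro B hB' D _ hD k hk
    -- For an integer k, k < ⌈B⌉ is the same as k < B, which leaves room for an exponent c strictly
    -- between k and the liminf.
    have hkB : (k : ℝ) < B := Nat.lt_ceil.1 (by exact_mod_cast hk)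
    obtain ⟨c, hkc, hc⟩ := exists_eventually_lt_of_lt_growthExponent (G := G) (x := k)
      (by rw [hB']; exact_mod_cast hkB)
    exact h.exists_moment_reconstruction hfa hGa hG hkc (hG.rpow_le_haymanB hc) hD
  · intro hlim D _ hD k _
    exact h.exists_moment_reconstruction hfa hGa hG (lt_add_one (k : ℝ))
      (hG.rpow_le_haymanB (hlim.eventually_gt_atTop _)) hD
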